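/- Let $d\ge 0$ be an integer, $T\in(0,\infty)$, $\Omega\subset\mathbb{R}^d$ an open set and $\boldsymbol b:(0,T)\times\Omega\to\mathbb{R}^d$ a Borel vector field. For a closed interval $I=[a,b]\subset[0,T]$ let $\mathcal L_{I,\Omega}$ be the class of nonnegative, essentially bounded functions on $I\times\Omega$ whose support is a compact subset of $I\times\Omega$. Such functions are extended by zero outside $\Omega$, and so are their products with $\boldsymbol b$. A family $I\ni t\mapsto\rho_t$ in $\mathcal L_{I,\Omega}$ is weakly$^*$ continuous if $t\mapsto\rho_t$ is continuous on $I$ for the weak$^*$ topology of $L^\infty(\Omega)$. The continuity equation is understood in the sense of distributions. Consider the following assumptions. (a-$\Omega$) $\int_0^T\int_{\Omega'}|\boldsymbol b(t,x)|\,dx\,dt<\infty$ for every open set $\Omega'$ whose closure is a compact subset of $\Omega$. (b-$\Omega$) For every nonnegative $\bar\rho\in L^\infty(\Omega)$ with compact support in $\Omega$ and every closed interval $I=[a,b]\subset[0,T]$, the continuity equation $$\frac{d}{dt}\rho_t+\operatorname{div}(\boldsymbol b\rho_t)=0\qquad\text{in }(a,b)\times\Omega$$ has at most one weakly$^*$ continuous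 solution $I\ni t\mapsto\rho_t\in\mathcal L_{I,\Omega}$ with $\rho_a=\bar\rho$. (b'-$\Omega$) For every $t_0\ge 0$ and $x_0\in\Omega$ there exists $\varepsilon=\varepsilon(t_0,x_0)>0$ with $B_\varepsilon(x_0)\subset\Omega$ such that, for every nonnegative $\bar\rho\in L^\infty(\mathbb{R}^d)$ with compact support contained in $B_\varepsilon(x_0)$ and every closed interval $I=[a,b]\subset[t_0-\varepsilon,t_0+\varepsilon]\cap[0,T]$, the continuity equation $$\frac{d}{dt}\rho_t+\operatorname{div}(\boldsymbol b\rho_t)=0\qquad\text{in }(a,b)\times\mathbb{R}^d$$ has at most one weakly$^*$ continuous solution $I\ni t\mapsto\rho_t\in\mathcal L_{I,\Omega}$ with $\rho_a=\bar\rho$ and with $\rho_t$ compactly supported in $B_\varepsilon(x_0)$ for every $t\in[a,b]$. If $\boldsymbol b$ satisfies (a-$\Omega$) and (b'-$\Omega$), then it satisfies (b-$\Omega$). -/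

import Mathlib

open MeasureTheory Set

namespace ContinuityEquation

/-- The Euclidean space `ℝ^d`. -/
abbrev E (d : ℕ) : Type := EuclideanSpace ℝ (Fin d)

variable {d : ℕ}

/-- `f`, as an element of `L^∞(Ω)` (an a.e. class on `Ω`), has compact support contained in `S`. -/
def HasCompactEssSupportIn (Ω S : Set (E d)) (f : E d → ℝ) : Prop :=
  ∃ K : Set (E d), IsCompact K ∧ K ⊆ S ∧ ∀ᵐ x ∂(volume.restrict Ω), x ∉ K → f x = 0

/-- `ρ = (ρ_t)_{t ∈ [a,b]}` belongs to the class `𝓛_{I,Ω}`, `I = [a,b]`: it is a measurable,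
nonnegative, essentially bounded function on `I × Ω` whose support is a compact subset of `I × Ω`.
The values `ρ t x` with `t ∉ I` or `x ∉ Ω` play no role. As `ρ` is used below only through weakly*
continuous representatives `t ↦ ρ_t`, the conditions are imposed at every time `t ∈ I`. -/
structure IsInClassL (Ω : Set (E d)) (a b : ℝ) (ρ : ℝ → E d → ℝ) : Prop where
  measurable : AEStronglyMeasurable (fun z : ℝ × E d => ρ z.1 z.2)
    (volume.restrict (Icc a b ×ˢ Ω))
  measurable_slice : ∀ t ∈ Icc a b, AEStronglyMeasurable (ρ t) (volume.restrict Ω)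
  nonneg : ∀ t ∈ Icc a b, ∀ᵐ x ∂(volume.restrict Ω), 0 ≤ ρ t x
  bounded : ∃ C : ℝ, ∀ t ∈ Icc a b, ∀ᵐ x ∂(volume.restrict Ω), ρ t x ≤ C
  support : ∃ K : Set (E d), IsCompact K ∧ K ⊆ Ω ∧
    ∀ t ∈ Icc a b, ∀ᵐ x ∂(volume.restrict Ω), x ∉ K → ρ t x = 0

/-- `t ↦ ρ_t` is continuous on `[a,b]` for the weak* topology of `L^∞(Ω) = L^1(Ω)^*`. -/
def IsWeakStarContinuous (Ω : Set (E d)) (a b : ℝ) (ρ : ℝ → E d → ℝ) : Prop :=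
  ∀ g : E d → ℝ, IntegrableOn g Ω →
    ContinuousOn (fun t => ∫ x in Ω, g x * ρ t x) (Icc a b)

/-- The continuity equation `d/dt ρ_t + div (v ρ_t) = 0` in `(a,b) × U`, in the sense of
distributions; `ρ` and `v ρ` are extended by zero outside `Ω`. For a test function `φ(t,x)`,
`fderiv ℝ φ (t,x) (1, v t x)` is `∂_t φ(t,x) + v(t,x) · ∇_x φ(t,x)`. -/
def SolvesContinuityEq (v : ℝ → E d → E d) (Ω U : Set (E d)) (a b : ℝ)
    (ρ : ℝ → E d → ℝ) : Prop :=
  ∀ φ : ℝ × E d → ℝ, ContDiff ℝ ((⊤ : ℕ∞) : WithTop ℕ∞) φ → HasCompactSupport φ →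
    tsupport φ ⊆ Ioo a b ×ˢ U →
    ∫ z in Ioo a b ×ˢ Ω, ρ z.1 z.2 * fderiv ℝ φ z ((1 : ℝ), v z.1 z.2) = 0

/-- `t ↦ ρ_t` is a weakly* continuous solution in `𝓛_{[a,b],Ω}` of the continuity equation in
`(a,b) × U` with initial datum `ρ_a = ρbar`. -/
structure IsSolution (v : ℝ → E d → E d) (Ω U : Set (E d)) (a b : ℝ)
    (ρbar : E d → ℝ) (ρ : ℝ → E d → ℝ) : Prop where
  mem_class : IsInClassL Ω a b ρ
  weakStar : IsWeakStarContinuous Ω a b ρ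
  equation : SolvesContinuityEq v Ω U a b ρ
  initial : ρ a =ᵐ[volume.restrict Ω] ρbar

/-- `v` is Borel measurable as a map `(0,T) × Ω → ℝ^d`. -/
def IsBorelField (T : ℝ) (Ω : Set (E d)) (v : ℝ → E d → E d) : Prop :=
  Measurable ((Ioo 0 T ×ˢ Ω).domRestrict (fun z : ℝ × E d => v z.1 z.2))

/-- Local integrability: `∫_0^T ∫_{Ω'} |v| dx dt < ∞` for every open `Ω'` compactly contained
in `Ω`. -/
def LocallyIntegrableField (T : ℝ) (Ω : Set (E d)) (v : ℝ → E d → E d) : Prop :=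
  ∀ Ω' : Set (E d), IsOpen Ω' → IsCompact (closure Ω') → closure Ω' ⊆ Ω →
    IntegrableOn (fun z : ℝ × E d => v z.1 z.2) (Ioo 0 T ×ˢ Ω')

/-- Global uniqueness: for every initial datum `0 ≤ ρbar ∈ L^∞(Ω)` with compact support in `Ω` and
every interval `[a,b] ⊆ [0,T]`, there is at most one weakly* continuous solution in
`𝓛_{[a,b],Ω}` of the continuity equation in `(a,b) × Ω` starting from `ρbar`. -/
def GlobalUniqueness (T : ℝ) (Ω : Set (E d)) (v : ℝ → E d → E d) : Prop :=
  ∀ ρbar : E d → ℝ, MemLp ρbar ⊤ (volume.restrict Ω) →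
    (∀ᵐ x ∂(volume.restrict Ω), 0 ≤ ρbar x) → HasCompactEssSupportIn Ω Ω ρbar →
    ∀ a b : ℝ, a ≤ b → Icc a b ⊆ Icc 0 T →
    ∀ ρ₁ ρ₂ : ℝ → E d → ℝ,
      IsSolution v Ω Ω a b ρbar ρ₁ → IsSolution v Ω Ω a b ρbar ρ₂ →
      ∀ t ∈ Icc a b, ρ₁ t =ᵐ[volume.restrict Ω] ρ₂ t

/-- Local uniqueness: every `(t₀,x₀)` with `t₀ ≥ 0`, `x₀ ∈ Ω` has an `ε > 0` with
`B_ε(x₀) ⊆ Ω` such that for every initial datum `0 ≤ ρbar ∈ L^∞(ℝ^d)` with compact support in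
`B_ε(x₀)` and every interval `[a,b] ⊆ [t₀-ε,t₀+ε] ∩ [0,T]`, there is at most one weakly* continuous
solution in `𝓛_{[a,b],Ω}` of the continuity equation in `(a,b) × ℝ^d` that starts from `ρbar` and
has `ρ_t` compactly supported in `B_ε(x₀)` for every `t ∈ [a,b]`. -/
def LocalUniqueness (T : ℝ) (Ω : Set (E d)) (v : ℝ → E d → E d) : Prop :=
  ∀ t₀ : ℝ, 0 ≤ t₀ → ∀ x₀ ∈ Ω, ∃ ε : ℝ, 0 < ε ∧ Metric.ball x₀ ε ⊆ Ω ∧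
    ∀ ρbar : E d → ℝ, MemLp ρbar ⊤ volume → (∀ᵐ x ∂volume, 0 ≤ ρbar x) →
      HasCompactEssSupportIn univ (Metric.ball x₀ ε) ρbar →
    ∀ a b : ℝ, a ≤ b → Icc a b ⊆ Icc (t₀ - ε) (t₀ + ε) ∩ Icc 0 T →
    ∀ ρ₁ ρ₂ : ℝ → E d → ℝ,
      IsSolution v Ω univ a b ρbar ρ₁ →
      (∀ t ∈ Icc a b, HasCompactEssSupportIn Ω (Metric.ball x₀ ε) (ρ₁ t)) →
      IsSolution v Ω univ a b ρbar ρ₂ →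
      (∀ t ∈ Icc a b, HasCompactEssSupportIn Ω (Metric.ball x₀ ε) (ρ₂ t)) →
      ∀ t ∈ Icc a b, ρ₁ t =ᵐ[volume.restrict Ω] ρ₂ t

end ContinuityEquation

open Filter Topology
open scoped ContDiff Manifold

namespace ContinuityEquation

variable {d : ℕ}

/-! Two solutions σ, τ with the same datum live, at all times of the interval, in one compact set K
⊆ Ω. There they are nonnegative bounded flows (`IsFlowOn`), which may be tested with every smooth
function, so their mass is conserved. Hence it suffices to show that min(σ_b, τ_b) carries the full
mass at the final time b: then σ_b and τ_b both coincide with this minimum.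

If the flows were carried by trajectories, one would cut the trajectories into short pieces, each
lying in a ball where local uniqueness applies. The proof does this without trajectories. A piece of
a flow ρ is a flow below ρ, and such pieces come from duality. By Hahn-Banach, a weight W with
values in [0, 1] for which W ρ solves the equation with a given datum exists as soon as an
inequality holds for all test functions φ, and this inequality follows by testing the equation of ρ
with smooth truncations of φ. `IsFlowOn.exists_flow_of_weight` turns W ρ into a genuine flow. Two
consequences carry the proof. Selection (`IsFlowOn.exists_flow_with_initial`): every datum between 0
and ρ_a starts a flow below ρ. Confinement (`IsFlowOn.exists_flow_of_barriers`): barrier functions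
yield a flow below ρ that never leaves a set S, with a controlled loss of mass.

Fix a radius r and a speed level M, and take a time step of length h with 6 M h / r ≤ 1. Mass
starting in a ball of radius r and moving at speed at most M stays in the ball of radius 3r, so
confinement there loses at most 2 ∫ ρ q, where q = C (6/r) (|v| - M)⁺. Confine both flows, select
flows below them with a common datum, and apply local uniqueness in the larger ball: the selected
flows agree at the end of the step, so σ and τ share that mass
(`IsFlowOn.exists_common_mass_of_closedBall`).

The losses add up without accumulating. Over the balls of a cover the data are split into parts
whose flows sum to the original one, and over successive steps the time slabs are disjoint. The
total loss is at most 2 ∫ (σ + τ) q over the whole time interval, however many balls and steps are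
used (`IsFlowOn.le_integral_min`). Since v is integrable on K and the densities are bounded, this
bound tends to 0 as M tends to infinity with r fixed. -/

/-! ### Integral representation of dominated functionals. -/

/-- A linear functional on `L¹` of a finite measure that is dominated by the integral of the
positive part is integration against a weight with values in `[0, 1]`. -/
theorem exists_weight_of_functional_le {X : Type*} [MeasurableSpace X] (μ : Measure X)
    [IsFiniteMeasure μ] (Λ : (X →₁[μ] ℝ) →ₗ[ℝ] ℝ)
    (hΛ : ∀ F : X →₁[μ] ℝ, Λ F ≤ ∫ x, max (F x) 0 ∂μ) :
    ∃ w : X → ℝ, Measurable w ∧ (∀ x, w x ∈ Icc (0 : ℝ) 1) ∧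
      ∀ F : X →₁[μ] ℝ, Λ F = ∫ x, w x * F x ∂μ := by
  have hle : ∀ F : X →₁[μ] ℝ, Λ F ≤ ‖F‖ := by
    intro F
    rw [L1.norm_eq_integral_norm]
    refine (hΛ F).trans (integral_mono (L1.integrable_coeFn F).pos_part
      (L1.integrable_coeFn F).norm fun x => ?_)
    simp only [Real.norm_eq_abs]
    exact max_le (le_abs_self _) (abs_nonneg _)
  have habs : ∀ F : X →₁[μ] ℝ, ‖Λ F‖ ≤ 1 * ‖F‖ := by
    intro F
    rw [one_mul, Real.norm_eq_abs, abs_le]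
    have := hle (-F)
    rw [map_neg, norm_neg] at this
    exact ⟨by linarith, hle F⟩
  let Λc : (X →₁[μ] ℝ) →L[ℝ] ℝ := Λ.mkContinuous 1 habs
  -- The weight is found in L²: the measure is finite, so L² maps continuously into L¹, and the
  -- Riesz theorem represents the restriction of `Λ` to L².
  have h12 : ∀ F : Lp ℝ 2 μ, MemLp (F : X → ℝ) 1 μ := fun F =>
    (Lp.memLp F).mono_exponent (by norm_num)
  let T : Lp ℝ 2 μ →ₗ[ℝ] (X →₁[μ] ℝ) :=
    { toFun := fun F => (h12 F).toLp
      map_add' := by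
        intro F G
        rw [← MemLp.toLp_add]
        exact MemLp.toLp_congr _ _ (Lp.coeFn_add F G)
      map_smul' := by
        intro c F
        rw [RingHom.id_apply, ← MemLp.toLp_const_smul]
        exact MemLp.toLp_congr _ _ (Lp.coeFn_smul c F) }
  have hT : ∀ F : Lp ℝ 2 μ, (T F : X → ℝ) =ᵐ[μ] F := fun F => (h12 F).coeFn_toLp
  let C : ℝ := (μ univ ^ (1 / (1 : ENNReal).toReal - 1 / (2 : ENNReal).toReal)).toReal
  have hC : ∀ F : Lp ℝ 2 μ, ‖(Λ ∘ₗ T) F‖ ≤ C * ‖F‖ := by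
    intro F
    have h1 := habs (T F)
    rw [one_mul] at h1
    refine h1.trans ?_
    rw [Lp.norm_def, Lp.norm_def, eLpNorm_congr_ae (hT F), mul_comm, ← ENNReal.toReal_mul]
    refine ENNReal.toReal_mono ?_ (eLpNorm_le_eLpNorm_mul_rpow_measure_univ (by norm_num)
      (Lp.aestronglyMeasurable F))
    refine ENNReal.mul_ne_top (Lp.eLpNorm_ne_top F) ?_
    exact ENNReal.rpow_ne_top_of_nonneg (by norm_num) (measure_ne_top _ _)
  let Λ₂ : StrongDual ℝ (Lp ℝ 2 μ) := (Λ ∘ₗ T).mkContinuous C hC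
  let w₀ : Lp ℝ 2 μ := (InnerProductSpace.toDual ℝ (Lp ℝ 2 μ)).symm Λ₂
  have hw₀int : Integrable (w₀ : X → ℝ) μ := (h12 w₀).integrable le_rfl
  have hset : ∀ (s : Set X) (hs : MeasurableSet s),
      Λ (indicatorConstLp 1 hs (measure_ne_top μ s) (1 : ℝ)) = ∫ x in s, w₀ x ∂μ := by
    intro s hs
    have h1 : inner ℝ w₀ (indicatorConstLp 2 hs (measure_ne_top μ s) (1 : ℝ))
        = Λ₂ (indicatorConstLp 2 hs (measure_ne_top μ s) (1 : ℝ)) :=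
      InnerProductSpace.toDual_symm_apply
    rw [real_inner_comm, MeasureTheory.L2.inner_indicatorConstLp_one hs (measure_ne_top μ s) w₀]
      at h1
    rw [h1]
    change _ = Λ (T _)
    congr 1
    refine Lp.ext ?_
    exact indicatorConstLp_coeFn.trans (indicatorConstLp_coeFn.symm.trans (hT _).symm)
  have hind : ∀ (s : Set X) (hs : MeasurableSet s),
      ((indicatorConstLp 1 hs (measure_ne_top μ s) (1 : ℝ) : X →₁[μ] ℝ) : X → ℝ)
        =ᵐ[μ] s.indicator fun _ => 1 := fun s hs => indicatorConstLp_coeFn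
  -- The function -1_s has zero positive part, so the domination gives -Λ(1_s) ≤ 0. The upper bound
  -- below comes from 1_s in the same way.
  have hpos : 0 ≤ᵐ[μ] (w₀ : X → ℝ) := by
    refine ae_nonneg_of_forall_setIntegral_nonneg hw₀int fun s hs _ => ?_
    rw [← hset s hs]
    have h1 := hΛ (-(indicatorConstLp 1 hs (measure_ne_top μ s) (1 : ℝ)))
    rw [map_neg] at h1
    have h2 : ∫ x, max ((-(indicatorConstLp 1 hs (measure_ne_top μ s) (1 : ℝ)) :
        X →₁[μ] ℝ) x) 0 ∂μ = ∫ x, (0 : ℝ) ∂μ := by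
      refine integral_congr_ae ?_
      filter_upwards [hind s hs, Lp.coeFn_neg
        (indicatorConstLp 1 hs (measure_ne_top μ s) (1 : ℝ))] with x hx hx'
      rw [hx', Pi.neg_apply, hx]
      by_cases hxs : x ∈ s <;> simp [hxs]
    rw [h2, integral_zero] at h1
    linarith
  have hle1 : (w₀ : X → ℝ) ≤ᵐ[μ] fun _ => (1 : ℝ) := by
    refine ae_le_of_forall_setIntegral_le hw₀int (integrable_const _) fun s hs _ => ?_
    rw [← hset s hs]
    refine (hΛ _).trans (le_of_eq ?_)
    rw [← integral_indicator hs]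
    refine integral_congr_ae ?_
    filter_upwards [hind s hs] with x hx
    rw [hx]
    by_cases hxs : x ∈ s <;> simp [hxs]
  let w₁ : X → ℝ := (Lp.aestronglyMeasurable w₀).mk w₀
  have hw₁ : (w₀ : X → ℝ) =ᵐ[μ] w₁ := (Lp.aestronglyMeasurable w₀).ae_eq_mk
  -- Clipping makes the bounds hold at every point, not only almost everywhere.
  let w : X → ℝ := fun x => max 0 (min 1 (w₁ x))
  have hw_meas : Measurable w :=
    measurable_const.max (measurable_const.min
      (Lp.aestronglyMeasurable w₀).stronglyMeasurable_mk.measurable)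
  have hw_mem : ∀ x, w x ∈ Icc (0 : ℝ) 1 := fun x =>
    ⟨le_max_left _ _, max_le zero_le_one (min_le_left _ _)⟩
  have hww : (w₀ : X → ℝ) =ᵐ[μ] w := by
    filter_upwards [hw₁, hpos, hle1] with x h1 h2 h3
    simp only [w, ← h1, min_eq_right h3]
    exact (max_eq_right h2).symm
  have hwint : ∀ {F : X → ℝ}, Integrable F μ → Integrable (fun x => w x * F x) μ := by
    intro F hF
    refine hF.bdd_mul (c := 1) hw_meas.aestronglyMeasurable (ae_of_all _ fun x => ?_)
    rw [Real.norm_eq_abs, abs_of_nonneg (hw_mem x).1]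
    exact (hw_mem x).2
  refine ⟨w, hw_meas, hw_mem, ?_⟩
  let Mw : (X →₁[μ] ℝ) →ₗ[ℝ] ℝ :=
    { toFun := fun F => ∫ x, w x * F x ∂μ
      map_add' := by
        intro F G
        rw [← integral_add (hwint (L1.integrable_coeFn F)) (hwint (L1.integrable_coeFn G))]
        refine integral_congr_ae ?_
        filter_upwards [Lp.coeFn_add F G] with x hx
        rw [hx, Pi.add_apply, mul_add]
      map_smul' := by
        intro c F
        rw [RingHom.id_apply, smul_eq_mul, ← integral_const_mul]
        refine integral_congr_ae ?_
        filter_upwards [Lp.coeFn_smul c F] with x hx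
        rw [hx, Pi.smul_apply, smul_eq_mul]
        ring }
  have hMw : ∀ F, ‖Mw F‖ ≤ 1 * ‖F‖ := by
    intro F
    rw [one_mul, L1.norm_eq_integral_norm]
    refine (norm_integral_le_integral_norm _).trans (integral_mono
      (hwint (L1.integrable_coeFn F)).norm (L1.integrable_coeFn F).norm fun x => ?_)
    simp only [norm_mul]
    refine mul_le_of_le_one_left (norm_nonneg _) ?_
    rw [Real.norm_eq_abs, abs_of_nonneg (hw_mem x).1]
    exact (hw_mem x).2
  let Mc : (X →₁[μ] ℝ) →L[ℝ] ℝ := Mw.mkContinuous 1 hMw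
  intro F
  change Λc F = Mc F
  refine Lp.induction (by norm_num) (motive := fun F : X →₁[μ] ℝ => Λc F = Mc F) ?_ ?_ ?_ F
  · intro c s hs hμs
    have h1 : (Lp.simpleFunc.indicatorConst 1 hs hμs.ne c : X →₁[μ] ℝ)
        = c • indicatorConstLp 1 hs (measure_ne_top μ s) (1 : ℝ) := by
      rw [Lp.simpleFunc.coe_indicatorConst]
      refine Lp.ext ?_
      filter_upwards [hind s hs, indicatorConstLp_coeFn (p := 1) (hs := hs) (hμs := hμs.ne)
        (c := c), Lp.coeFn_smul c (indicatorConstLp 1 hs (measure_ne_top μ s) (1 : ℝ))]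
        with x h1 h2 h3
      rw [h2, h3, Pi.smul_apply, h1]
      by_cases hxs : x ∈ s <;> simp [hxs]
    rw [h1, map_smul, map_smul]
    congr 1
    change Λ _ = ∫ x, w x * _ ∂μ
    rw [hset s hs, ← integral_indicator hs]
    refine integral_congr_ae ?_
    filter_upwards [hww, hind s hs] with x h1 h2
    rw [h2]
    by_cases hxs : x ∈ s <;> simp [hxs, h1]
  · intro f g hf hg _ h1 h2
    rw [map_add, map_add, h1, h2]
  · exact isClosed_eq Λc.continuous Mc.continuous

/-- **Duality.** Let `ι` map a vector space `V` linearly into the integrable functions. A linear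
functional on `V` dominated by `∫ (ι φ)⁺` has the form `φ ↦ ∫ w * ι φ` with `0 ≤ w ≤ 1`. -/
theorem exists_weight_of_le_integral_posPart {X : Type*} [MeasurableSpace X] (μ : Measure X)
    [IsFiniteMeasure μ] {V : Type*} [AddCommGroup V] [Module ℝ V] (ι : V →ₗ[ℝ] (X → ℝ))
    (hι : ∀ φ, Integrable (ι φ) μ) (ℓ : V →ₗ[ℝ] ℝ)
    (h : ∀ φ, ℓ φ ≤ ∫ x, max (ι φ x) 0 ∂μ) :
    ∃ w : X → ℝ, Measurable w ∧ (∀ x, w x ∈ Icc (0 : ℝ) 1) ∧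
      ∀ φ, ℓ φ = ∫ x, w x * ι φ x ∂μ := by
  let J : V →ₗ[ℝ] (X →₁[μ] ℝ) :=
    { toFun := fun φ => (hι φ).toL1
      map_add' := by
        intro φ ψ
        rw [← Integrable.toL1_add]
        simp only [map_add]
      map_smul' := by
        intro c φ
        rw [RingHom.id_apply, ← Integrable.toL1_smul]
        simp only [map_smul]
        rfl }
  have hJ : ∀ φ, (J φ : X → ℝ) =ᵐ[μ] ι φ := fun φ => (hι φ).coeFn_toL1
  -- The extension takes place in V × L¹, starting from V × 0, and not from the range of `J`. This
  -- way ℓ need not be shown to factor through `J`: the sublinear bound `N` sees only J φ + F, and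
  -- the extension inherits this.
  let f : (V × (X →₁[μ] ℝ)) →ₗ.[ℝ] ℝ :=
    { domain := Submodule.prod ⊤ ⊥
      toFun := (ℓ ∘ₗ LinearMap.fst ℝ V (X →₁[μ] ℝ)) ∘ₗ (Submodule.subtype _) }
  let N : V × (X →₁[μ] ℝ) → ℝ := fun p => ∫ x, max ((J p.1 + p.2 : X →₁[μ] ℝ) x) 0 ∂μ
  have hNint : ∀ F : X →₁[μ] ℝ, Integrable (fun x => max (F x) 0) μ := fun F =>
    (L1.integrable_coeFn F).pos_part
  obtain ⟨g, hg1, hg2⟩ := exists_extension_of_le_sublinear f N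
    (by
      rintro c hc ⟨φ, F⟩
      simp only [N, Prod.smul_mk, map_smul, ← smul_add, ← integral_const_mul]
      refine integral_congr_ae ?_
      filter_upwards [Lp.coeFn_smul c (J φ + F)] with x hx
      rw [hx, Pi.smul_apply, smul_eq_mul, mul_max_of_nonneg _ _ hc.le, mul_zero])
    (by
      rintro ⟨φ, F⟩ ⟨ψ, G⟩
      simp only [N, Prod.mk_add_mk, map_add]
      rw [← integral_add (hNint _) (hNint _)]
      refine integral_mono_ae (hNint _) ((hNint _).add (hNint _)) ?_
      have : J φ + J ψ + (F + G) = (J φ + F) + (J ψ + G) := by abel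
      filter_upwards [Lp.coeFn_add (J φ + F) (J ψ + G)] with x hx
      rw [this, hx, Pi.add_apply]
      exact max_le (add_le_add (le_max_left _ _) (le_max_left _ _))
        (add_nonneg (le_max_right _ _) (le_max_right _ _)))
    (by
      rintro ⟨⟨φ, F⟩, hF⟩
      have hF0 : F = 0 := by simpa [f] using hF
      subst hF0
      change ℓ φ ≤ N (φ, 0)
      refine (h φ).trans (le_of_eq ?_)
      simp only [N, add_zero]
      refine integral_congr_ae ?_
      filter_upwards [hJ φ] with x hx
      rw [hx])
  have hgℓ : ∀ φ, g (φ, 0) = ℓ φ := fun φ => hg1 ⟨(φ, 0), by simp [f]⟩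
  -- `N` vanishes at (φ, -J φ). Applied to φ and to -φ, this forces g(φ, 0) = g(0, J φ), so the
  -- restriction of g to L¹ represents ℓ.
  have hker : ∀ φ, g (φ, -J φ) ≤ 0 := by
    intro φ
    refine (hg2 _).trans (le_of_eq ?_)
    simp only [N, add_neg_cancel]
    rw [← integral_zero X ℝ (μ := μ)]
    refine integral_congr_ae ?_
    filter_upwards [Lp.coeFn_zero ℝ 1 μ] with x hx
    rw [hx]; simp
  have hgJ : ∀ φ, g (0, J φ) = ℓ φ := by
    intro φ
    have h1 := hker φ
    have h2 := hker (-φ)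
    have e1 : ((φ, -J φ) : V × (X →₁[μ] ℝ)) = (φ, 0) - (0, J φ) := by simp
    have e2 : ((-φ, -J (-φ)) : V × (X →₁[μ] ℝ)) = (0, J φ) - (φ, 0) := by simp
    rw [e1, map_sub, hgℓ] at h1
    rw [e2, map_sub, hgℓ] at h2
    linarith
  obtain ⟨w, hw1, hw2, hw3⟩ := exists_weight_of_functional_le μ
    (g ∘ₗ LinearMap.inr ℝ V (X →₁[μ] ℝ)) (by
      intro F
      have := hg2 (0, F)
      simpa [N] using this)
  refine ⟨w, hw1, hw2, fun φ => ?_⟩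
  have h1 := hw3 (J φ)
  change g (0, J φ) = _ at h1
  rw [hgJ] at h1
  rw [h1]
  refine integral_congr_ae ?_
  filter_upwards [hJ φ] with x hx
  rw [hx]

/-- Duality for a pair of measure spaces. -/
theorem exists_weights_of_le_integral_posPart {X Y : Type*} [MeasurableSpace X]
    [MeasurableSpace Y] (μ : Measure X) [IsFiniteMeasure μ] (ν : Measure Y) [IsFiniteMeasure ν]
    {V : Type*} [AddCommGroup V] [Module ℝ V] (ι : V →ₗ[ℝ] (X → ℝ)) (κ : V →ₗ[ℝ] (Y → ℝ))
    (hι : ∀ φ, Integrable (ι φ) μ) (hκ : ∀ φ, Integrable (κ φ) ν) (ℓ : V →ₗ[ℝ] ℝ)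
    (h : ∀ φ, ℓ φ ≤ ∫ x, max (ι φ x) 0 ∂μ + ∫ y, max (κ φ y) 0 ∂ν) :
    ∃ (w : X → ℝ) (u : Y → ℝ), Measurable w ∧ (∀ x, w x ∈ Icc (0 : ℝ) 1) ∧
      Measurable u ∧ (∀ y, u y ∈ Icc (0 : ℝ) 1) ∧
      ∀ φ, ℓ φ = ∫ x, w x * ι φ x ∂μ + ∫ y, u y * κ φ y ∂ν := by
  have hl : MeasurableEmbedding (Sum.inl : X → X ⊕ Y) :=
    ⟨Sum.inl_injective, measurable_inl, fun {_} hs => hs.inl_image⟩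
  have hr : MeasurableEmbedding (Sum.inr : Y → X ⊕ Y) :=
    ⟨Sum.inr_injective, measurable_inr, fun {_} hs => hs.inr_image⟩
  -- On the disjoint union the two integrals become one, and a single weight restricts to the two
  -- wanted.
  let m : Measure (X ⊕ Y) := μ.map Sum.inl + ν.map Sum.inr
  let I : V →ₗ[ℝ] (X ⊕ Y → ℝ) :=
    { toFun := fun φ => Sum.elim (ι φ) (κ φ)
      map_add' := by
        intro φ ψ
        ext z
        cases z <;> simp
      map_smul' := by
        intro c φ
        ext z
        cases z <;> simp }
  have hint : ∀ {F : X ⊕ Y → ℝ}, Integrable (F ∘ Sum.inl) μ → Integrable (F ∘ Sum.inr) ν →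
      Integrable F m := by
    intro F h1 h2
    exact (hl.integrable_map_iff.2 h1).add_measure (hr.integrable_map_iff.2 h2)
  have hintegral : ∀ {F : X ⊕ Y → ℝ}, Integrable (F ∘ Sum.inl) μ → Integrable (F ∘ Sum.inr) ν →
      ∫ z, F z ∂m = ∫ x, F (Sum.inl x) ∂μ + ∫ y, F (Sum.inr y) ∂ν := by
    intro F h1 h2
    rw [integral_add_measure (hl.integrable_map_iff.2 h1) (hr.integrable_map_iff.2 h2),
      hl.integral_map, hr.integral_map]
  obtain ⟨w, hw1, hw2, hw3⟩ := exists_weight_of_le_integral_posPart m I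
    (fun φ => hint (hι φ) (hκ φ)) ℓ (by
      intro φ
      rw [hintegral (F := fun z => max (I φ z) 0) (hι φ).pos_part (hκ φ).pos_part]
      exact h φ)
  refine ⟨w ∘ Sum.inl, w ∘ Sum.inr, hw1.comp measurable_inl, fun x => hw2 _,
    hw1.comp measurable_inr, fun y => hw2 _, fun φ => ?_⟩
  have e := hintegral (F := fun z => w z * I φ z)
    ((hι φ).bdd_mul (c := 1) (hw1.comp measurable_inl).aestronglyMeasurable
      (ae_of_all _ fun x => by
        rw [Real.norm_eq_abs, abs_of_nonneg (hw2 _).1]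
        exact (hw2 _).2))
    ((hκ φ).bdd_mul (c := 1) (hw1.comp measurable_inr).aestronglyMeasurable
      (ae_of_all _ fun x => by
        rw [Real.norm_eq_abs, abs_of_nonneg (hw2 _).1]
        exact (hw2 _).2))
  rw [hw3 φ, e]
  rfl

/-! ### Weak derivatives in one time variable. -/

/-- The primitive of a smooth function of one variable is smooth. -/
theorem contDiff_primitive {η : ℝ → ℝ} (hη : ContDiff ℝ ∞ η) (c : ℝ) :
    ContDiff ℝ ∞ (fun τ => ∫ x in c..τ, η x) ∧
      deriv (fun τ => ∫ x in c..τ, η x) = η := by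
  have hd : ∀ τ, HasDerivAt (fun τ => ∫ x in c..τ, η x) (η τ) τ := fun τ =>
    intervalIntegral.integral_hasDerivAt_right (hη.continuous.intervalIntegrable _ _)
      hη.continuous.stronglyMeasurable.stronglyMeasurableAtFilter hη.continuous.continuousAt
  have hd' : deriv (fun τ => ∫ x in c..τ, η x) = η := funext fun τ => (hd τ).deriv
  refine ⟨contDiff_infty_iff_deriv.2 ⟨fun τ => (hd τ).differentiableAt, ?_⟩, hd'⟩
  rwa [hd']

/-- Integration by parts of a smooth function against a primitive of an integrable one. -/
theorem integral_mul_eq_sub_integral_deriv_mul {a b : ℝ} {G θ : ℝ → ℝ}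
    (hG : IntervalIntegrable G volume a b) (hθ : ContDiff ℝ ∞ θ) :
    ∫ τ in a..b, θ τ * G τ
      = θ b * (∫ x in a..b, G x) - ∫ τ in a..b, deriv θ τ * ∫ x in a..τ, G x := by
  have hac := hG.absolutelyContinuousOnInterval_intervalIntegral (c := a) left_mem_uIcc
  have hθac : AbsolutelyContinuousOnInterval θ a b :=
    (hθ.of_le (by exact_mod_cast le_top)).contDiffOn.absolutelyContinuousOnInterval
  have h := hθac.integral_mul_deriv_eq_deriv_mul hac
  simp only [intervalIntegral.integral_same, mul_zero, sub_zero] at h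
  rw [← h]
  refine intervalIntegral.integral_congr_ae ?_
  filter_upwards [hG.ae_hasDerivAt_integral] with x hx hx'
  rw [(hx (uIoc_subset_uIcc hx') a left_mem_uIcc).deriv]

theorem intervalIntegrable_mul_primitive {a b : ℝ} {G η : ℝ → ℝ}
    (hG : IntervalIntegrable G volume a b) (hη : Continuous η) :
    IntervalIntegrable (fun τ => η τ * ∫ x in a..τ, G x) volume a b := by
  refine ContinuousOn.intervalIntegrable (hη.continuousOn.mul ?_)
  exact (hG.absolutelyContinuousOnInterval_intervalIntegral (c := a) left_mem_uIcc).continuousOn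

/-- A weak formulation in time with initial value `c`, tested with functions vanishing at the
final time, identifies `f` with `c` plus a primitive of `G`. -/
theorem ae_eq_add_integral_of_forall_initial {a b c : ℝ} (hab : a ≤ b) {f G : ℝ → ℝ}
    (hf : IntervalIntegrable f volume a b) (hG : IntervalIntegrable G volume a b)
    (h : ∀ θ : ℝ → ℝ, ContDiff ℝ ∞ θ → θ b = 0 →
      ∫ τ in a..b, (deriv θ τ * f τ + θ τ * G τ) = -(θ a * c)) :
    ∀ᵐ τ ∂volume.restrict (Ioc a b), f τ = c + ∫ x in a..τ, G x := by
  have hI : IntervalIntegrable (fun τ => ∫ x in a..τ, G x) volume a b := by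
    simpa using intervalIntegrable_mul_primitive hG (continuous_const (y := (1 : ℝ)))
  have key := ae_eq_zero_of_integral_contDiff_smul_eq_zero (E := ℝ)
    (μ := volume.restrict (Ioc a b)) (f := fun τ => f τ - (c + ∫ x in a..τ, G x))
    (((hf.sub ((_root_.intervalIntegrable_const (c := c)).add hI)).1).locallyIntegrable) (by
      intro η hη _
      -- The primitive of η based at b vanishes at the final time, hence is admissible, and its
      -- value at a is minus the integral of η; this produces the constant c.
      obtain ⟨hθ, hθ'⟩ := contDiff_primitive hη b
      have h1 := h _ hθ (by simp)
      have hηf : IntervalIntegrable (fun τ => η τ * f τ) volume a b :=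
        hf.continuousOn_mul hη.continuous.continuousOn
      have hθG : IntervalIntegrable (fun τ => (∫ x in b..τ, η x) * G τ) volume a b :=
        hG.continuousOn_mul hθ.continuous.continuousOn
      have h2 := integral_mul_eq_sub_integral_deriv_mul hG hθ
      rw [hθ'] at h1 h2
      rw [intervalIntegral.integral_add hηf hθG, h2, intervalIntegral.integral_symm a b] at h1
      simp only [intervalIntegral.integral_same, zero_mul, zero_sub] at h1
      rw [← intervalIntegral.integral_of_le hab]
      have e : ∀ τ, η τ • (f τ - (c + ∫ x in a..τ, G x))
          = η τ * f τ - (η τ * c + η τ * ∫ x in a..τ, G x) := by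
        intro τ
        rw [smul_eq_mul]
        ring
      simp_rw [e]
      rw [intervalIntegral.integral_sub hηf
        (((hη.continuous.intervalIntegrable _ _).mul_const c).add
          (intervalIntegrable_mul_primitive hG hη.continuous)),
        intervalIntegral.integral_add ((hη.continuous.intervalIntegrable _ _).mul_const c)
          (intervalIntegrable_mul_primitive hG hη.continuous),
        intervalIntegral.integral_mul_const]
      linarith)
  filter_upwards [key] with τ hτ
  linarith

theorem exists_Icc_subset_of_isCompact {a b : ℝ} {S : Set ℝ} (hS : IsCompact S)
    (hne : S.Nonempty) (hSU : S ⊆ Ioo a b) : ∃ c d, a < c ∧ d < b ∧ S ⊆ Icc c d := by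
  obtain ⟨c, hc⟩ := hS.exists_isLeast hne
  obtain ⟨d, hd⟩ := hS.exists_isGreatest hne
  exact ⟨c, d, (hSU hc.1).1, (hSU hd.1).2, fun x hx => ⟨hc.2 hx, hd.2 hx⟩⟩

/-- If `f' = G` in the sense of distributions on `(a, b)`, then `f` is a constant plus a primitive
of `G`. -/
theorem exists_ae_eq_add_integral_of_forall_compactSupport {a b : ℝ} (hab : a < b) {f G : ℝ → ℝ}
    (hf : IntervalIntegrable f volume a b) (hG : IntervalIntegrable G volume a b)
    (h : ∀ θ : ℝ → ℝ, ContDiff ℝ ∞ θ → HasCompactSupport θ → tsupport θ ⊆ Ioo a b →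
      ∫ τ in a..b, (deriv θ τ * f τ + θ τ * G τ) = 0) :
    ∃ c, ∀ᵐ τ ∂volume, τ ∈ Ioo a b → f τ = c + ∫ x in a..τ, G x := by
  have hI : IntervalIntegrable (fun τ => ∫ x in a..τ, G x) volume a b := by
    simpa using intervalIntegrable_mul_primitive hG (continuous_const (y := (1 : ℝ)))
  let bump : ContDiffBump ((a + b) / 2) := ⟨(b - a) / 8, (b - a) / 4, by linarith, by linarith⟩
  let η₀ : ℝ → ℝ := bump.normed volume
  have hη₀ : ContDiff ℝ ∞ η₀ := bump.contDiff_normed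
  have hη₀s : tsupport η₀ ⊆ Ioo a b := by
    rw [show η₀ = bump.normed volume from rfl, bump.tsupport_normed_eq, Real.closedBall_eq_Icc]
    intro x hx
    simp only [mem_Icc] at hx
    change (a + b) / 2 - (b - a) / 4 ≤ x ∧ x ≤ (a + b) / 2 + (b - a) / 4 at hx
    constructor <;> linarith [hx.1, hx.2]
  have hη₀c : HasCompactSupport η₀ := bump.hasCompactSupport_normed
  have hη₀ne : (tsupport η₀).Nonempty := by
    rw [show η₀ = bump.normed volume from rfl, bump.tsupport_normed_eq]
    exact ⟨_, Metric.mem_closedBall_self bump.rOut_pos.le⟩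
  let g : ℝ → ℝ := fun τ => f τ - ∫ x in a..τ, G x
  have hg : IntervalIntegrable g volume a b := hf.sub hI
  let c : ℝ := ∫ τ in a..b, η₀ τ * g τ
  refine ⟨c, ?_⟩
  have full : ∀ {η : ℝ → ℝ}, tsupport η ⊆ Ioo a b → ∀ k : ℝ → ℝ,
      ∫ τ in a..b, η τ * k τ = ∫ τ, η τ * k τ := by
    intro η hη k
    rw [intervalIntegral.integral_of_le hab.le]
    refine setIntegral_eq_integral_of_forall_compl_eq_zero fun x hx => ?_
    rw [image_eq_zero_of_notMem_tsupport fun hx' => hx (Ioo_subset_Ioc_self (hη hx')), zero_mul]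
  have hη₀1 : ∫ τ in a..b, η₀ τ = 1 := by
    have := full hη₀s fun _ => 1
    simp only [mul_one] at this
    rw [this]
    exact bump.integral_normed
  have key := isOpen_Ioo.ae_eq_zero_of_integral_contDiff_smul_eq_zero (E := ℝ) (μ := volume)
    (U := Ioo a b) (f := fun τ => g τ - c)
    (((hg.sub (_root_.intervalIntegrable_const (c := c))).1.mono_set
      Ioo_subset_Ioc_self).locallyIntegrableOn) (by
      intro η hη hηc hηs
      -- The du Bois-Reymond argument: subtracting a multiple of the unit-mass bump makes the
      -- integral zero, so the primitive of ζ has compact support in (a, b) and may be used as test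
      -- function.
      let m : ℝ := ∫ τ in a..b, η τ
      let ζ : ℝ → ℝ := fun τ => η τ - m * η₀ τ
      have hζ : ContDiff ℝ ∞ ζ := hη.sub (contDiff_const.mul hη₀)
      obtain ⟨hθ, hθ'⟩ := contDiff_primitive hζ a
      obtain ⟨p, q, hap, hqb, hpq⟩ := exists_Icc_subset_of_isCompact
        (hηc.isCompact.union hη₀c.isCompact) (hη₀ne.mono subset_union_right)
        (union_subset hηs hη₀s)
      have hζ0 : ∀ x, x ∉ Icc p q → ζ x = 0 := by
        intro x hx
        have h1 : η x = 0 := image_eq_zero_of_notMem_tsupport fun h => hx (hpq (Or.inl h))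
        have h2 : η₀ x = 0 := image_eq_zero_of_notMem_tsupport fun h => hx (hpq (Or.inr h))
        simp [ζ, h1, h2]
      have hii : ∀ {k : ℝ → ℝ}, Continuous k → ∀ u v, IntervalIntegrable k volume u v :=
        fun hk u v => hk.intervalIntegrable u v
      have hζtot : ∫ x in a..b, ζ x = 0 := by
        simp only [ζ]
        rw [intervalIntegral.integral_sub (hii hη.continuous _ _)
          ((hii hη₀.continuous _ _).const_mul m), intervalIntegral.integral_const_mul,
          hη₀1, mul_one, sub_self]
      have hpq' : p ≤ q := by
        obtain ⟨x, hx⟩ := hη₀ne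
        exact (hpq (Or.inr hx)).1.trans (hpq (Or.inr hx)).2
      have hsupp : Function.support (fun τ => ∫ x in a..τ, ζ x) ⊆ Icc p q := by
        intro τ hτ
        by_contra hτ'
        refine hτ ?_
        rw [mem_Icc, not_and_or, not_le, not_le] at hτ'
        rcases hτ' with hτ' | hτ'
        · refine intervalIntegral.integral_zero_ae (ae_of_all _ fun x hx => hζ0 x fun hx' => ?_)
          have := hx.2
          have h3 : max a τ < p := max_lt hap hτ'
          linarith [hx'.1]
        · have h4 : ∫ x in τ..b, ζ x = 0 := by
            refine intervalIntegral.integral_zero_ae (ae_of_all _ fun x hx =>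
              hζ0 x fun hx' => ?_)
            have := hx.1
            have h3 : q < min τ b := lt_min hτ' hqb
            linarith [hx'.2]
          have h5 := intervalIntegral.integral_add_adjacent_intervals
            (hii hζ.continuous a τ) (hii hζ.continuous τ b)
          change ∫ x in a..τ, ζ x = 0
          linarith
      have hts : tsupport (fun τ => ∫ x in a..τ, ζ x) ⊆ Icc p q :=
        closure_minimal hsupp isClosed_Icc
      have h1 := h _ hθ (HasCompactSupport.of_support_subset_isCompact isCompact_Icc hsupp)
        (hts.trans fun x hx => ⟨hap.trans_le hx.1, hx.2.trans_lt hqb⟩)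
      have h2 := integral_mul_eq_sub_integral_deriv_mul hG hθ
      rw [hθ'] at h1 h2
      have hmul : ∀ {k l : ℝ → ℝ}, Continuous k → IntervalIntegrable l volume a b →
          IntervalIntegrable (fun τ => k τ * l τ) volume a b := fun hk hl =>
        hl.continuousOn_mul hk.continuousOn
      rw [intervalIntegral.integral_add (hmul hζ.continuous hf) (hmul hθ.continuous hG), h2,
        hζtot, zero_mul, zero_sub, ← sub_eq_add_neg,
        ← intervalIntegral.integral_sub (hmul hζ.continuous hf) (hmul hζ.continuous hI)] at h1
      have h3 : ∫ τ in a..b, ζ τ * g τ = 0 := by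
        rw [← h1]
        refine intervalIntegral.integral_congr fun τ _ => ?_
        simp only [g]
        ring
      have h4 : ∫ τ in a..b, ζ τ * g τ = (∫ τ in a..b, η τ * g τ) - m * c := by
        have : ∀ τ, ζ τ * g τ = η τ * g τ - m * (η₀ τ * g τ) := fun τ => by
          simp only [ζ]
          ring
        simp_rw [this]
        rw [intervalIntegral.integral_sub (hmul hη.continuous hg)
          ((hmul hη₀.continuous hg).const_mul m), intervalIntegral.integral_const_mul]
      simp only [smul_eq_mul]
      rw [← full hηs]
      simp_rw [mul_sub]
      rw [intervalIntegral.integral_sub (hmul hη.continuous hg)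
        ((hii hη.continuous _ _).mul_const c), intervalIntegral.integral_mul_const]
      change _ - m * c = 0
      linarith)
  filter_upwards [key] with τ hτ hτ'
  have := hτ hτ'
  simp only [g] at this
  linarith

/-! ### Flows on a compact set. -/

/-- The derivative `∂_t φ + v · ∇_x φ` of `φ` along the field `v`. -/
noncomputable def materialDeriv (v : ℝ → E d → E d) (φ : ℝ × E d → ℝ) (z : ℝ × E d) : ℝ :=
  fderiv ℝ φ z ((1 : ℝ), v z.1 z.2)

/-- Nonnegative bounded densities `ρ_t` on `K`, `t ∈ [a, b]`, solving the continuity equation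
against all smooth test functions, with boundary terms in time. -/
structure IsFlowOn (v : ℝ → E d → E d) (K : Set (E d)) (a b : ℝ) (ρ : ℝ → E d → ℝ) : Prop where
  measurable : AEStronglyMeasurable (fun z : ℝ × E d => ρ z.1 z.2)
    (volume.restrict (Ioo a b ×ˢ K))
  measurable_slice : ∀ t ∈ Icc a b, AEStronglyMeasurable (ρ t) (volume.restrict K)
  nonneg : ∀ t ∈ Icc a b, ∀ᵐ x ∂(volume.restrict K), 0 ≤ ρ t x
  bounded : ∃ C : ℝ, ∀ t ∈ Icc a b, ∀ᵐ x ∂(volume.restrict K), ρ t x ≤ C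
  equation : ∀ φ : ℝ × E d → ℝ, ContDiff ℝ ∞ φ → ∀ s t, a ≤ s → s ≤ t → t ≤ b →
    (∫ x in K, φ (t, x) * ρ t x) - ∫ x in K, φ (s, x) * ρ s x
      = ∫ z in Ioo s t ×ˢ K, ρ z.1 z.2 * materialDeriv v φ z

theorem volume_restrict_prod (I : Set ℝ) (K : Set (E d)) :
    (volume : Measure (ℝ × E d)).restrict (I ×ˢ K)
      = (volume.restrict I).prod (volume.restrict K) := by
  rw [Measure.prod_restrict, Measure.volume_eq_prod]

/-- A pointwise inequality that holds almost everywhere on almost every time slice holds almost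
everywhere in space-time. -/
theorem ae_le_of_forall_slice {I : Set ℝ} {K : Set (E d)} {f g : ℝ × E d → ℝ}
    (hf : AEStronglyMeasurable f (volume.restrict (I ×ˢ K)))
    (hg : AEStronglyMeasurable g (volume.restrict (I ×ˢ K)))
    (h : ∀ᵐ t ∂(volume.restrict I), ∀ᵐ x ∂(volume.restrict K), f (t, x) ≤ g (t, x)) :
    ∀ᵐ z ∂(volume.restrict (I ×ˢ K)), f z ≤ g z := by
  rw [volume_restrict_prod] at hf hg ⊢
  have hs : MeasurableSet {z | hf.mk f z ≤ hg.mk g z} :=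
    measurableSet_le hf.stronglyMeasurable_mk.measurable hg.stronglyMeasurable_mk.measurable
  have key : ∀ᵐ z ∂((volume.restrict I).prod (volume.restrict K)),
      z ∈ {z | hf.mk f z ≤ hg.mk g z} := by
    refine (Measure.ae_prod_mem_iff_ae_ae_mem hs).2 ?_
    filter_upwards [Measure.ae_ae_of_ae_prod hf.ae_eq_mk, Measure.ae_ae_of_ae_prod hg.ae_eq_mk, h]
      with t h1 h2 h3
    filter_upwards [h1, h2, h3] with x h1 h2 h3
    rw [← h1, ← h2]
    exact h3
  filter_upwards [hf.ae_eq_mk, hg.ae_eq_mk, key] with z h1 h2 h3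
  rw [h1, h2]
  exact h3

theorem ae_mem_of_forall_Icc {a b : ℝ} {p : ℝ → Prop} (h : ∀ t ∈ Icc a b, p t) :
    ∀ᵐ t ∂(volume.restrict (Ioo a b)), p t := by
  filter_upwards [ae_restrict_mem measurableSet_Ioo] with t ht
  exact h t (Ioo_subset_Icc_self ht)

/-- The differential of φ is bounded by some B on the compact set [a, b] × K, so the material
derivative is dominated by B (1 + ‖v‖). Neither a bound on the field nor compact support of φ is
needed. -/
theorem integrableOn_materialDeriv {v : ℝ → E d → E d} {K : Set (E d)} {a b : ℝ}
    (hK : IsCompact K) (hv : IntegrableOn (fun z : ℝ × E d => v z.1 z.2) (Ioo a b ×ˢ K))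
    {φ : ℝ × E d → ℝ} (hφ : ContDiff ℝ ∞ φ) :
    IntegrableOn (materialDeriv v φ) (Ioo a b ×ˢ K) := by
  have hcont : Continuous (fderiv ℝ φ) := hφ.continuous_fderiv (by simp)
  obtain ⟨B, hB⟩ := (isCompact_Icc (a := a) (b := b)).prod hK |>.exists_bound_of_continuousOn
    hcont.continuousOn
  have hfin : (volume : Measure (ℝ × E d)) (Ioo a b ×ˢ K) < ⊤ := by
    rw [Measure.volume_eq_prod, Measure.prod_prod]
    exact ENNReal.mul_lt_top measure_Ioo_lt_top hK.measure_lt_top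
  have hone : IntegrableOn (fun _ : ℝ × E d => (1 : ℝ)) (Ioo a b ×ˢ K) :=
    integrableOn_const hfin.ne
  have hm : MeasurableSet (Ioo a b ×ˢ K) := measurableSet_Ioo.prod hK.measurableSet
  refine Integrable.mono' ((hone.add hv.norm).const_mul B) ?_ ?_
  · have h1 : AEStronglyMeasurable (fun z : ℝ × E d => (fderiv ℝ φ z, ((1 : ℝ), v z.1 z.2)))
        (volume.restrict (Ioo a b ×ˢ K)) :=
      hcont.aestronglyMeasurable.prodMk (aestronglyMeasurable_const.prodMk hv.1)
    exact isBoundedBilinearMap_apply.continuous.comp_aestronglyMeasurable h1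
  · filter_upwards [ae_restrict_mem hm] with z hz
    refine ((fderiv ℝ φ z).le_opNorm _).trans ?_
    have h1 := hB z ⟨Ioo_subset_Icc_self hz.1, hz.2⟩
    have h2 : ‖((1 : ℝ), v z.1 z.2)‖ ≤ 1 + ‖v z.1 z.2‖ := by
      rw [Prod.norm_mk, norm_one]
      exact max_le (by linarith [norm_nonneg (v z.1 z.2)]) (by linarith)
    exact mul_le_mul h1 h2 (norm_nonneg _) ((norm_nonneg _).trans h1)

/-- Fubini on space-time cylinders, in terms of an interval integral. -/
theorem integral_Ioo_prod_eq {K : Set (E d)} {a b s t : ℝ} (hs : a ≤ s) (hst : s ≤ t) (ht : t ≤ b)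
    {h : ℝ × E d → ℝ} (hh : IntegrableOn h (Ioo a b ×ˢ K)) :
    ∫ z in Ioo s t ×ˢ K, h z = ∫ τ in s..t, ∫ x in K, h (τ, x) := by
  rw [intervalIntegral.integral_of_le hst, integral_Ioc_eq_integral_Ioo,
    Measure.volume_eq_prod, setIntegral_prod]
  rw [← Measure.volume_eq_prod]
  exact hh.mono_set (prod_mono_left (Ioo_subset_Ioo hs ht))

theorem intervalIntegrable_slice {K : Set (E d)} {a b : ℝ} (hab : a ≤ b)
    {h : ℝ × E d → ℝ} (hh : IntegrableOn h (Ioo a b ×ˢ K)) :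
    IntervalIntegrable (fun τ => ∫ x in K, h (τ, x)) volume a b := by
  rw [intervalIntegrable_iff_integrableOn_Ioo_of_le hab]
  have : Integrable h ((volume.restrict (Ioo a b)).prod (volume.restrict K)) := by
    rw [← volume_restrict_prod]
    exact hh
  exact this.integral_prod_left

/-- The integral over `(a, t) × K` depends continuously on `t`. -/
theorem continuousOn_integral_Ioo_prod {K : Set (E d)} {a b : ℝ} (hab : a ≤ b)
    {h : ℝ × E d → ℝ} (hh : IntegrableOn h (Ioo a b ×ˢ K)) :
    ContinuousOn (fun t => ∫ z in Ioo a t ×ˢ K, h z) (Icc a b) := by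
  have h1 := ((intervalIntegrable_slice hab hh).absolutelyContinuousOnInterval_intervalIntegral
    (c := a) left_mem_uIcc).continuousOn
  rw [uIcc_of_le hab] at h1
  exact h1.congr fun t ht => integral_Ioo_prod_eq le_rfl ht.1 ht.2 hh

theorem abs_le_of_nonneg_of_le {μ : Measure (E d)} {f : E d → ℝ} {C : ℝ}
    (h0 : ∀ᵐ x ∂μ, 0 ≤ f x) (hC : ∀ᵐ x ∂μ, f x ≤ C) : ∀ᵐ x ∂μ, ‖f x‖ ≤ C := by
  filter_upwards [h0, hC] with x h1 h2
  rwa [Real.norm_eq_abs, abs_of_nonneg h1]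

/-- Weak* continuity of a bounded family passes to time-dependent continuous test functions. -/
theorem continuousOn_integral_mul_of_weakStar {K : Set (E d)} (hK : IsCompact K) {a b C : ℝ}
    {ρ : ℝ → E d → ℝ}
    (hm : ∀ t ∈ Icc a b, AEStronglyMeasurable (ρ t) (volume.restrict K))
    (hC : ∀ t ∈ Icc a b, ∀ᵐ x ∂(volume.restrict K), ‖ρ t x‖ ≤ C)
    (hw : ∀ g : E d → ℝ, IntegrableOn g K →
      ContinuousOn (fun t => ∫ x in K, g x * ρ t x) (Icc a b))
    {φ : ℝ × E d → ℝ} (hφ : Continuous φ) :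
    ContinuousOn (fun t => ∫ x in K, φ (t, x) * ρ t x) (Icc a b) := by
  have hint : ∀ t, IntegrableOn (fun x => φ (t, x)) K := fun t =>
    (hφ.comp (by fun_prop : Continuous fun x : E d => (t, x))).continuousOn.integrableOn_compact hK
  have hmul : ∀ {g : E d → ℝ}, IntegrableOn g K → ∀ t ∈ Icc a b,
      IntegrableOn (fun x => g x * ρ t x) K := fun hg t ht =>
    hg.mul_bdd (hm t ht) (hC t ht)
  intro t₀ ht₀
  have hD : Continuous fun t => C * ∫ x in K, ‖φ (t, x) - φ (t₀, x)‖ := by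
    refine continuous_const.mul (continuous_parametric_integral_of_continuous ?_ hK)
    exact ((hφ.comp (by fun_prop : Continuous fun p : ℝ × E d => (p.1, p.2))).sub
      (hφ.comp (by fun_prop : Continuous fun p : ℝ × E d => (t₀, p.2)))).norm
  have hD0 : Tendsto (fun t => C * ∫ x in K, ‖φ (t, x) - φ (t₀, x)‖) (𝓝[Icc a b] t₀) (𝓝 0) := by
    have := (hD.tendsto t₀).mono_left (nhdsWithin_le_nhds (s := Icc a b))
    simpa using this
  -- Continuity splits into two effects: the test function moves, which costs at most C times an L¹
  -- distance, and the density moves against the frozen function φ(t₀, ·), which is weak*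
  -- continuity.
  have hdiff : Tendsto (fun t => ∫ x in K, (φ (t, x) - φ (t₀, x)) * ρ t x) (𝓝[Icc a b] t₀)
      (𝓝 0) := by
    refine squeeze_zero_norm' ?_ hD0
    filter_upwards [self_mem_nhdsWithin] with t ht
    rw [← integral_const_mul]
    refine (norm_integral_le_integral_norm _).trans (integral_mono_ae
      (hmul ((hint t).sub (hint t₀)) t ht).norm (((hint t).sub (hint t₀)).norm.const_mul C) ?_)
    filter_upwards [hC t ht] with x hx
    simp only [norm_mul]
    rw [mul_comm]
    exact mul_le_mul_of_nonneg_right hx (norm_nonneg _)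
  have hsum := hdiff.add (hw _ (hint t₀) t₀ ht₀)
  rw [zero_add] at hsum
  refine hsum.congr' ?_
  filter_upwards [self_mem_nhdsWithin] with t ht
  refine (integral_add (hmul ((hint t).sub (hint t₀)) t ht) (hmul (hint t₀) t ht)).symm.trans ?_
  refine integral_congr_ae (ae_of_all _ fun x => ?_)
  simp only [Pi.sub_apply]
  ring

namespace IsFlowOn

variable {v : ℝ → E d → E d} {K : Set (E d)} {a b : ℝ} {ρ σ : ℝ → E d → ℝ}

theorem exists_bound (h : IsFlowOn v K a b ρ) :
    ∃ C : ℝ, 0 ≤ C ∧ ∀ t ∈ Icc a b, ∀ᵐ x ∂(volume.restrict K), ‖ρ t x‖ ≤ C := by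
  obtain ⟨C, hC⟩ := h.bounded
  refine ⟨max C 0, le_max_right _ _, fun t ht => ?_⟩
  filter_upwards [h.nonneg t ht, hC t ht] with x h1 h2
  rw [Real.norm_eq_abs, abs_of_nonneg h1]
  exact h2.trans (le_max_left _ _)

theorem ae_nonneg (h : IsFlowOn v K a b ρ) :
    ∀ᵐ z ∂(volume.restrict (Ioo a b ×ˢ K)), 0 ≤ ρ z.1 z.2 :=
  ae_le_of_forall_slice (f := fun _ => 0) aestronglyMeasurable_const h.measurable
    (ae_mem_of_forall_Icc h.nonneg)

theorem exists_ae_bound (h : IsFlowOn v K a b ρ) :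
    ∃ C : ℝ, ∀ᵐ z ∂(volume.restrict (Ioo a b ×ˢ K)), ‖ρ z.1 z.2‖ ≤ C := by
  obtain ⟨C, hC⟩ := h.bounded
  have := ae_le_of_forall_slice (g := fun _ => C) h.measurable aestronglyMeasurable_const
    (ae_mem_of_forall_Icc hC)
  refine ⟨C, ?_⟩
  filter_upwards [h.ae_nonneg, this] with z h1 h2
  rwa [Real.norm_eq_abs, abs_of_nonneg h1]

theorem ae_le (hσ : IsFlowOn v K a b σ) (hρ : IsFlowOn v K a b ρ)
    (h : ∀ t ∈ Icc a b, ∀ᵐ x ∂(volume.restrict K), σ t x ≤ ρ t x) :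
    ∀ᵐ z ∂(volume.restrict (Ioo a b ×ˢ K)), σ z.1 z.2 ≤ ρ z.1 z.2 :=
  ae_le_of_forall_slice hσ.measurable hρ.measurable (ae_mem_of_forall_Icc h)

theorem integrableOn_mul_slice (h : IsFlowOn v K a b ρ) {g : E d → ℝ} (hg : IntegrableOn g K)
    {t : ℝ} (ht : t ∈ Icc a b) : IntegrableOn (fun x => g x * ρ t x) K := by
  obtain ⟨C, -, hC⟩ := h.exists_bound
  exact hg.mul_bdd (h.measurable_slice t ht) (hC t ht)

theorem integrableOn_continuous_mul_slice (h : IsFlowOn v K a b ρ) (hK : IsCompact K)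
    {φ : ℝ × E d → ℝ} (hφ : Continuous φ) (s : ℝ) {t : ℝ} (ht : t ∈ Icc a b) :
    IntegrableOn (fun x => φ (s, x) * ρ t x) K :=
  h.integrableOn_mul_slice
    ((hφ.comp (by fun_prop : Continuous fun x : E d => (s, x))).continuousOn.integrableOn_compact
      hK) ht

theorem integrableOn_slice (h : IsFlowOn v K a b ρ) (hK : IsCompact K)
    {t : ℝ} (ht : t ∈ Icc a b) : IntegrableOn (ρ t) K := by
  simpa using h.integrableOn_continuous_mul_slice hK (continuous_const (y := (1 : ℝ))) 0 ht

theorem integrableOn_mul (h : IsFlowOn v K a b ρ) {f : ℝ × E d → ℝ}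
    (hf : IntegrableOn f (Ioo a b ×ˢ K)) :
    IntegrableOn (fun z => ρ z.1 z.2 * f z) (Ioo a b ×ˢ K) := by
  obtain ⟨C, hC⟩ := h.exists_ae_bound
  exact hf.bdd_mul h.measurable hC

theorem restrict (h : IsFlowOn v K a b ρ) {s t : ℝ} (hs : a ≤ s) (ht : t ≤ b) :
    IsFlowOn v K s t ρ where
  measurable := h.measurable.mono_measure
    (Measure.restrict_mono (prod_mono_left (Ioo_subset_Ioo hs ht)) le_rfl)
  measurable_slice τ hτ := h.measurable_slice τ ⟨hs.trans hτ.1, hτ.2.trans ht⟩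
  nonneg τ hτ := h.nonneg τ ⟨hs.trans hτ.1, hτ.2.trans ht⟩
  bounded := by
    obtain ⟨C, hC⟩ := h.bounded
    exact ⟨C, fun τ hτ => hC τ ⟨hs.trans hτ.1, hτ.2.trans ht⟩⟩
  equation φ hφ p q hp hpq hq := h.equation φ hφ p q (hs.trans hp) hpq (hq.trans ht)

/-- The equation is linear, and the ordering σ ≤ ρ is what keeps the difference nonnegative. The
remainder after a piece has been split off is thus again a flow. -/
theorem sub (hρ : IsFlowOn v K a b ρ) (hσ : IsFlowOn v K a b σ) (hK : IsCompact K)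
    (hv : IntegrableOn (fun z : ℝ × E d => v z.1 z.2) (Ioo a b ×ˢ K))
    (hle : ∀ t ∈ Icc a b, ∀ᵐ x ∂(volume.restrict K), σ t x ≤ ρ t x) :
    IsFlowOn v K a b (fun t x => ρ t x - σ t x) where
  measurable := hρ.measurable.sub hσ.measurable
  measurable_slice t ht := (hρ.measurable_slice t ht).sub (hσ.measurable_slice t ht)
  nonneg t ht := by
    filter_upwards [hle t ht] with x hx
    exact sub_nonneg.2 hx
  bounded := by
    obtain ⟨C, hC⟩ := hρ.bounded
    refine ⟨C, fun t ht => ?_⟩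
    filter_upwards [hC t ht, hσ.nonneg t ht] with x h1 h2
    linarith
  equation φ hφ s t hs hst ht := by
    have hs' : s ∈ Icc a b := ⟨hs, hst.trans ht⟩
    have ht' : t ∈ Icc a b := ⟨hs.trans hst, ht⟩
    have hsub : Ioo s t ×ˢ K ⊆ Ioo a b ×ˢ K := prod_mono_left (Ioo_subset_Ioo hs ht)
    have hL := integrableOn_materialDeriv hK hv hφ
    simp_rw [mul_sub, sub_mul]
    rw [integral_sub (hρ.integrableOn_continuous_mul_slice hK hφ.continuous t ht')
        (hσ.integrableOn_continuous_mul_slice hK hφ.continuous t ht'),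
      integral_sub (hρ.integrableOn_continuous_mul_slice hK hφ.continuous s hs')
        (hσ.integrableOn_continuous_mul_slice hK hφ.continuous s hs'),
      integral_sub ((hρ.integrableOn_mul hL).mono_set hsub)
        ((hσ.integrableOn_mul hL).mono_set hsub),
      ← hρ.equation φ hφ s t hs hst ht, ← hσ.equation φ hφ s t hs hst ht]
    ring

/-- Conservation of mass. -/
theorem integral_eq (h : IsFlowOn v K a b ρ) {s t : ℝ} (hs : a ≤ s) (hst : s ≤ t) (ht : t ≤ b) :
    ∫ x in K, ρ t x = ∫ x in K, ρ s x := by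
  have := h.equation (fun _ => 1) contDiff_const s t hs hst ht
  simp only [one_mul, materialDeriv, fderiv_fun_const, Pi.zero_apply,
    zero_apply, mul_zero, integral_zero] at this
  linarith

/-- Weak* continuity. -/
theorem continuousOn_integral (h : IsFlowOn v K a b ρ) (hK : IsCompact K) (hab : a ≤ b)
    (hv : IntegrableOn (fun z : ℝ × E d => v z.1 z.2) (Ioo a b ×ˢ K))
    {g : E d → ℝ} (hg : IntegrableOn g K) :
    ContinuousOn (fun t => ∫ x in K, g x * ρ t x) (Icc a b) := by
  obtain ⟨C, hC0, hC⟩ := h.exists_bound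
  have : IsFiniteMeasure (volume.restrict K) := ⟨by simpa using hK.measure_lt_top⟩
  refine continuousOn_of_uniform_approx_of_continuousOn fun u hu => ?_
  obtain ⟨ε, hε, hεu⟩ := Metric.mem_uniformity_dist.1 hu
  have hδ : 0 < ε / (2 * (C + 1)) := by positivity
  -- For smooth ψ the equation itself gives continuity in time. As the densities are bounded by C
  -- uniformly in time, L¹-approximation of g by such ψ is a uniform approximation; the summand 1 in
  -- C + 1 covers C = 0.
  obtain ⟨ψ, -, hψ, hψg⟩ := (memLp_one_iff_integrable.2 hg).exist_eLpNorm_sub_le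
    ENNReal.one_ne_top le_rfl hδ
  have hψi : IntegrableOn ψ K := hψ.continuous.continuousOn.integrableOn_compact hK
  have hsmall : ∫ x in K, ‖g x - ψ x‖ ≤ ε / (2 * (C + 1)) := by
    rw [eLpNorm_one_eq_lintegral_enorm] at hψg
    have e := integral_norm_eq_lintegral_enorm (hg.sub hψi).1
    simp only [Pi.sub_apply] at e hψg
    rw [e]
    exact ENNReal.toReal_le_of_le_ofReal hδ.le hψg
  refine ⟨fun t => ∫ x in K, ψ x * ρ t x, ?_, fun t ht => hεu ?_⟩
  · have hφ : ContDiff ℝ ∞ (fun z : ℝ × E d => ψ z.2) := hψ.comp contDiff_snd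
    have h1 := continuousOn_integral_Ioo_prod hab
      (h.integrableOn_mul (integrableOn_materialDeriv hK hv hφ))
    refine (h1.add (continuousOn_const (c := ∫ x in K, ψ x * ρ a x))).congr fun t ht => ?_
    have := h.equation _ hφ a t le_rfl ht.1 ht.2
    simp only [Pi.add_apply] at this ⊢
    linarith
  · rw [dist_eq_norm, ← integral_sub (h.integrableOn_mul_slice hg ht)
      (h.integrableOn_mul_slice hψi ht)]
    have h1 : ‖∫ x in K, (g x * ρ t x - ψ x * ρ t x)‖ ≤ ∫ x in K, C * ‖g x - ψ x‖ := by
      refine norm_integral_le_of_norm_le ((hg.sub hψi).norm.const_mul C) ?_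
      filter_upwards [hC t ht] with x hx
      rw [← sub_mul, norm_mul, mul_comm]
      exact mul_le_mul_of_nonneg_right hx (norm_nonneg _)
    rw [integral_const_mul] at h1
    have h2 : C * ∫ x in K, ‖g x - ψ x‖ ≤ C * (ε / (2 * (C + 1))) :=
      mul_le_mul_of_nonneg_left hsmall hC0
    have h3 : C * (ε / (2 * (C + 1))) < ε := by
      rw [mul_div_assoc', div_lt_iff₀ (by positivity)]
      nlinarith
    linarith

theorem continuousOn_integral_continuous (h : IsFlowOn v K a b ρ) (hK : IsCompact K) (hab : a ≤ b)
    (hv : IntegrableOn (fun z : ℝ × E d => v z.1 z.2) (Ioo a b ×ˢ K))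
    {φ : ℝ × E d → ℝ} (hφ : Continuous φ) :
    ContinuousOn (fun t => ∫ x in K, φ (t, x) * ρ t x) (Icc a b) := by
  obtain ⟨C, -, hC⟩ := h.exists_bound
  exact continuousOn_integral_mul_of_weakStar hK h.measurable_slice hC
    (fun g hg => h.continuousOn_integral hK hab hv hg) hφ

end IsFlowOn

/-! ### Calculus of the material derivative and spaces of test functions. -/

theorem materialDeriv_mul (v : ℝ → E d → E d) {φ ψ : ℝ × E d → ℝ} (hφ : ContDiff ℝ ∞ φ)
    (hψ : ContDiff ℝ ∞ ψ) (z : ℝ × E d) :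
    materialDeriv v (fun z => φ z * ψ z) z
      = φ z * materialDeriv v ψ z + ψ z * materialDeriv v φ z := by
  simp only [materialDeriv]
  rw [fderiv_fun_mul (hφ.differentiable (by simp) z) (hψ.differentiable (by simp) z)]
  simp

theorem materialDeriv_add (v : ℝ → E d → E d) {φ ψ : ℝ × E d → ℝ} (hφ : ContDiff ℝ ∞ φ)
    (hψ : ContDiff ℝ ∞ ψ) (z : ℝ × E d) :
    materialDeriv v (φ + ψ) z = materialDeriv v φ z + materialDeriv v ψ z := by
  simp only [materialDeriv]
  rw [fderiv_add (hφ.differentiable (by simp) z) (hψ.differentiable (by simp) z)]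
  simp

theorem materialDeriv_smul (v : ℝ → E d → E d) {φ : ℝ × E d → ℝ} (hφ : ContDiff ℝ ∞ φ) (c : ℝ)
    (z : ℝ × E d) : materialDeriv v (c • φ) z = c * materialDeriv v φ z := by
  simp only [materialDeriv]
  rw [fderiv_const_smul (hφ.differentiable (by simp) z)]
  simp

theorem materialDeriv_comp (v : ℝ → E d → E d) {φ : ℝ × E d → ℝ} (hφ : ContDiff ℝ ∞ φ)
    {β : ℝ → ℝ} (hβ : ContDiff ℝ ∞ β) (z : ℝ × E d) :
    materialDeriv v (fun z => β (φ z)) z = deriv β (φ z) * materialDeriv v φ z := by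
  have h := ((hβ.differentiable (by simp) (φ z)).hasDerivAt.comp_hasFDerivAt z
    (hφ.differentiable (by simp) z).hasFDerivAt).fderiv
  simp only [materialDeriv]
  change fderiv ℝ (β ∘ φ) z _ = _
  rw [h]
  simp

theorem materialDeriv_time (v : ℝ → E d → E d) {θ : ℝ → ℝ} (hθ : ContDiff ℝ ∞ θ)
    (z : ℝ × E d) : materialDeriv v (fun z => θ z.1) z = deriv θ z.1 := by
  rw [materialDeriv_comp v contDiff_fst hθ]
  simp [materialDeriv, fderiv_fst]

/-- The smooth functions on space-time, as a vector space. -/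
def smoothFunctions (d : ℕ) : Submodule ℝ (ℝ × E d → ℝ) where
  carrier := {φ | ContDiff ℝ ∞ φ}
  zero_mem' := by
    simp only [mem_ofPred_eq]
    exact contDiff_const
  add_mem' := by
    intro φ ψ h1 h2
    simp only [mem_ofPred_eq] at *
    exact h1.add h2
  smul_mem' := by
    intro c φ h
    simp only [mem_ofPred_eq] at *
    exact contDiff_const.smul h

theorem smoothFunctions.contDiff (φ : smoothFunctions d) : ContDiff ℝ ∞ φ.1 := by
  have h := φ.2
  simpa only [smoothFunctions, Submodule.mem_mk, AddSubmonoid.mem_mk, AddSubsemigroup.mem_mk,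
    mem_ofPred_eq] using h

/-- A countable family of smooth functions separates the bounded functions on a compact set. -/
theorem exists_countable_separating {K : Set (E d)} (hK : IsCompact K) :
    ∃ D : Set (E d → ℝ), D.Countable ∧ (∀ ψ ∈ D, ContDiff ℝ ∞ ψ) ∧
      ∀ f : E d → ℝ, AEStronglyMeasurable f (volume.restrict K) →
        (∃ C : ℝ, ∀ᵐ x ∂(volume.restrict K), ‖f x‖ ≤ C) →
        (∀ ψ ∈ D, ∫ x in K, ψ x * f x = 0) → ∀ᵐ x ∂(volume.restrict K), f x = 0 := by
  have : IsFiniteMeasure (volume.restrict K) := ⟨by simpa using hK.measure_lt_top⟩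
  have hdense := Lp.dense_hasCompactSupport_contDiff (E := E d) (F := ℝ)
    (μ := volume.restrict K) (p := 1) ENNReal.one_ne_top
  have : Fact ((1 : ENNReal) ≠ ⊤) := ⟨ENNReal.one_ne_top⟩
  obtain ⟨S, hSsub, hScount, hSdense⟩ := hdense.exists_countable_dense_subset
  choose! G hG1 hG2 hG3 using fun F (hF : F ∈ S) => hSsub hF
  refine ⟨G '' S, hScount.image G, by rintro _ ⟨F, hF, rfl⟩; exact hG3 F hF, ?_⟩
  rintro f hf ⟨C, hC⟩ h0
  have hfi : Integrable f (volume.restrict K) := Integrable.of_bound hf C hC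
  have hff : Integrable (fun x => f x * f x) (volume.restrict K) := hfi.mul_bdd hf hC
  -- A bounded f orthogonal to a family dense in L¹ is orthogonal to itself: replacing one factor f
  -- by a nearby member of the family changes the integral by at most |C| times the L¹ distance.
  have hzero : ∫ x in K, f x * f x = 0 := by
    refine le_antisymm (le_of_forall_pos_le_add fun ε hε => ?_)
      (integral_nonneg fun x => mul_self_nonneg _)
    have hδ : 0 < ε / (|C| + 1) := by positivity
    obtain ⟨F, hFS, hF⟩ := hSdense.exists_dist_lt hfi.toL1 hδ
    have hGi : Integrable (G F) (volume.restrict K) :=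
      (hG3 F hFS).continuous.continuousOn.integrableOn_compact hK
    have h1 : ∫ x in K, ‖f x - G F x‖ < ε / (|C| + 1) := by
      rw [dist_eq_norm, L1.norm_eq_integral_norm] at hF
      refine lt_of_eq_of_lt (integral_congr_ae ?_) hF
      filter_upwards [hG1 F hFS, hfi.coeFn_toL1, Lp.coeFn_sub hfi.toL1 F] with x h1 h2 h3
      rw [h3, Pi.sub_apply, h2, h1]
    have h2 : ∫ x in K, f x * f x = ∫ x in K, (f x - G F x) * f x := by
      simp_rw [sub_mul]
      rw [integral_sub hff (hGi.mul_bdd hf hC), h0 _ ⟨F, hFS, rfl⟩, sub_zero]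
    have h3 : ∫ x in K, (f x - G F x) * f x ≤ ∫ x in K, ‖f x - G F x‖ * |C| := by
      refine integral_mono_ae ((hfi.sub hGi).mul_bdd hf hC) ((hfi.sub hGi).norm.mul_const _) ?_
      filter_upwards [hC] with x hx
      refine (Real.le_norm_self _).trans ?_
      rw [norm_mul]
      exact mul_le_mul_of_nonneg_left (hx.trans (le_abs_self C)) (norm_nonneg _)
    rw [integral_mul_const] at h3
    have h4 : (∫ x in K, ‖f x - G F x‖) * |C| ≤ ε / (|C| + 1) * |C| :=
      mul_le_mul_of_nonneg_right h1.le (abs_nonneg _)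
    have h5 : ε / (|C| + 1) * |C| ≤ ε := by
      rw [div_mul_eq_mul_div, div_le_iff₀ (by positivity)]
      nlinarith [abs_nonneg C]
    linarith
  rw [integral_eq_zero_iff_of_nonneg (fun x => mul_self_nonneg _) hff] at hzero
  filter_upwards [hzero] with x hx
  simpa using hx

/-! ### From a weight to a flow. -/

namespace IsFlowOn

variable {v : ℝ → E d → E d} {K : Set (E d)} {a b : ℝ} {ρ σ : ℝ → E d → ℝ}

/-- A flow that vanishes off `S` almost everywhere in space-time vanishes off `S` at all times. -/
theorem ae_eq_zero_of_ae_prod (h : IsFlowOn v K a b ρ) (hK : IsCompact K) (hab : a < b)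
    (hv : IntegrableOn (fun z : ℝ × E d => v z.1 z.2) (Ioo a b ×ˢ K))
    {S : Set (E d)} (hS : MeasurableSet S)
    (h0 : ∀ᵐ z ∂(volume.restrict (Ioo a b ×ˢ K)), z.2 ∉ S → ρ z.1 z.2 = 0) :
    ∀ t ∈ Icc a b, ∀ᵐ x ∂(volume.restrict K), x ∉ S → ρ t x = 0 := by
  have : IsFiniteMeasure (volume.restrict K) := ⟨by simpa using hK.measure_lt_top⟩
  have hg : IntegrableOn (Sᶜ.indicator fun _ : E d => (1 : ℝ)) K :=
    (integrable_const 1).indicator hS.compl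
  have hc := h.continuousOn_integral hK hab.le hv hg
  -- The mass off S vanishes at almost every time and is continuous in time, hence vanishes at every
  -- time.
  have hae : (fun t => ∫ x in K, Sᶜ.indicator (fun _ : E d => (1 : ℝ)) x * ρ t x)
      =ᵐ[volume.restrict (Icc a b)] fun _ => 0 := by
    rw [volume_restrict_prod] at h0
    rw [Measure.restrict_congr_set Ioo_ae_eq_Icc.symm]
    filter_upwards [Measure.ae_ae_of_ae_prod h0] with t ht
    rw [← integral_zero (E d) ℝ (μ := volume.restrict K)]
    refine integral_congr_ae ?_
    filter_upwards [ht] with x hx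
    by_cases hxS : x ∈ S
    · simp [hxS]
    · simp [hx hxS]
  have heq := Measure.eqOn_Icc_of_ae_eq volume hab.ne hae hc continuousOn_const
  intro t ht
  have h1 := heq ht
  rw [integral_eq_zero_iff_of_nonneg_ae _ (h.integrableOn_mul_slice hg ht)] at h1
  · filter_upwards [h1] with x hx hxS
    simpa [hxS] using hx
  · filter_upwards [h.nonneg t ht] with x hx
    exact mul_nonneg (indicator_nonneg (fun _ _ => zero_le_one) _) hx

/-- **Representation.** If a weight `W` with values in `[0, 1]` and an initial datum `g ≤ ρ_a` are
such that `W ρ` solves the continuity equation with initial datum `g`, tested with functions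
vanishing at the final time, then `W ρ` has a representative which is a flow below `ρ`. -/
theorem exists_flow_of_weight (h : IsFlowOn v K a b ρ) (hK : IsCompact K) (hab : a < b)
    (hv : IntegrableOn (fun z : ℝ × E d => v z.1 z.2) (Ioo a b ×ˢ K))
    {W : ℝ × E d → ℝ} (hWm : Measurable W) (hW : ∀ z, W z ∈ Icc (0 : ℝ) 1)
    {g : E d → ℝ} (hgm : AEStronglyMeasurable g (volume.restrict K))
    (hg0 : ∀ᵐ x ∂(volume.restrict K), 0 ≤ g x) (hgρ : ∀ᵐ x ∂(volume.restrict K), g x ≤ ρ a x)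
    (heq : ∀ φ : ℝ × E d → ℝ, ContDiff ℝ ∞ φ → (∀ x, φ (b, x) = 0) →
      ∫ z in Ioo a b ×ˢ K, W z * (ρ z.1 z.2 * materialDeriv v φ z)
        = -∫ x in K, φ (a, x) * g x) :
    ∃ σ : ℝ → E d → ℝ, IsFlowOn v K a b σ ∧
      (∀ t ∈ Icc a b, ∀ᵐ x ∂(volume.restrict K), σ t x ≤ ρ t x) ∧
      (∀ᵐ x ∂(volume.restrict K), σ a x = g x) ∧
      ∀ᵐ z ∂(volume.restrict (Ioo a b ×ˢ K)), σ z.1 z.2 = W z * ρ z.1 z.2 := by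
  have : IsFiniteMeasure (volume.restrict K) := ⟨by simpa using hK.measure_lt_top⟩
  obtain ⟨C, hC0, hC⟩ := h.exists_bound
  have haI : a ∈ Icc a b := left_mem_Icc.2 hab.le
  have hWn : ∀ z, ‖W z‖ ≤ 1 := fun z => by
    rw [Real.norm_eq_abs, abs_of_nonneg (hW z).1]
    exact (hW z).2
  have hWint : ∀ {f : ℝ × E d → ℝ}, IntegrableOn f (Ioo a b ×ˢ K) →
      IntegrableOn (fun z => W z * (ρ z.1 z.2 * f z)) (Ioo a b ×ˢ K) := fun hf =>
    (h.integrableOn_mul hf).bdd_mul hWm.aestronglyMeasurable (ae_of_all _ hWn)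
  have hcontint : ∀ {φ : ℝ × E d → ℝ}, Continuous φ → IntegrableOn φ (Ioo a b ×ˢ K) :=
    fun {φ} hφ => (hφ.continuousOn.integrableOn_compact (isCompact_Icc.prod hK)).mono_set
      (prod_mono_left (Ioo_subset_Icc_self (a := a) (b := b)))
  have hgint : ∀ {φ : ℝ × E d → ℝ}, Continuous φ → ∀ s,
      IntegrableOn (fun x => φ (s, x) * g x) K := by
    intro φ hφ s
    refine ((hφ.comp (by fun_prop : Continuous fun x : E d =>
      (s, x))).continuousOn.integrableOn_compact hK).mul_bdd hgm (c := C) ?_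
    filter_upwards [hg0, hgρ, hC a haI] with x h1 h2 h3
    rw [Real.norm_eq_abs, abs_of_nonneg h1]
    exact h2.trans ((Real.le_norm_self _).trans h3)
  have hWslice : ∀ t, AEStronglyMeasurable (fun x => W (t, x)) (volume.restrict K) := fun t =>
    (hWm.comp measurable_prodMk_left).aestronglyMeasurable
  -- This is the value that the integral of φ(t, ·) σ_t must have if σ solves the equation with
  -- datum g. It makes sense for every t, whereas W ρ is meaningful only for almost every time.
  let Λ : ℝ → (ℝ × E d → ℝ) → ℝ := fun t φ =>
    (∫ x in K, φ (a, x) * g x)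
      + ∫ z in Ioo a t ×ˢ K, W z * (ρ z.1 z.2 * materialDeriv v φ z)
  have hΛcont : ∀ φ : ℝ × E d → ℝ, ContDiff ℝ ∞ φ → ContinuousOn (fun t => Λ t φ) (Icc a b) :=
    fun φ hφ => continuousOn_const.add
      (continuousOn_integral_Ioo_prod hab.le (hWint (integrableOn_materialDeriv hK hv hφ)))
  have hΛae : ∀ φ : ℝ × E d → ℝ, ContDiff ℝ ∞ φ → ∀ᵐ τ ∂(volume.restrict (Ioc a b)),
      ∫ x in K, W (τ, x) * (ρ τ x * φ (τ, x)) = Λ τ φ := by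
    intro φ hφ
    have hL := hWint (integrableOn_materialDeriv hK hv hφ)
    have hφi := hWint (hcontint hφ.continuous)
    have key := ae_eq_add_integral_of_forall_initial (c := ∫ x in K, φ (a, x) * g x) hab.le
      (intervalIntegrable_slice hab.le hφi) (intervalIntegrable_slice hab.le hL) (by
        intro θ hθ hθb
        have hθs : ContDiff ℝ ∞ (fun z : ℝ × E d => θ z.1) := hθ.comp contDiff_fst
        have hθ' : Continuous (deriv θ) := hθ.continuous_deriv (by simp)
        -- Factors θ(t) with θ(b) = 0 are admissible and localize the weak formulation in time.
        have e := heq (fun z => θ z.1 * φ z) (hθs.mul hφ) (fun x => by simp [hθb])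
        have hθ'i : IntegrableOn (fun z : ℝ × E d => W z * (ρ z.1 z.2 * (deriv θ z.1 * φ z)))
            (Ioo a b ×ˢ K) := hWint (hcontint ((hθ'.comp continuous_fst).mul hφ.continuous))
        have hθLi : IntegrableOn
            (fun z : ℝ × E d => W z * (ρ z.1 z.2 * (θ z.1 * materialDeriv v φ z)))
            (Ioo a b ×ˢ K) := by
          refine hWint ?_
          obtain ⟨B, hB⟩ := isCompact_Icc.exists_bound_of_continuousOn
            (hθ.continuous.continuousOn (s := Icc a b))
          refine (integrableOn_materialDeriv hK hv hφ).bdd_mul (c := B)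
            hθs.continuous.aestronglyMeasurable ?_
          filter_upwards [ae_restrict_mem (measurableSet_Ioo.prod hK.measurableSet)] with z hz
          exact hB _ (Ioo_subset_Icc_self hz.1)
        have e2 : ∀ z : ℝ × E d,
            W z * (ρ z.1 z.2 * materialDeriv v (fun z => θ z.1 * φ z) z)
              = W z * (ρ z.1 z.2 * (deriv θ z.1 * φ z))
                + W z * (ρ z.1 z.2 * (θ z.1 * materialDeriv v φ z)) := by
          intro z
          rw [materialDeriv_mul v hθs hφ, materialDeriv_time v hθ]
          ring
        simp_rw [e2] at e
        rw [integral_add hθ'i hθLi, integral_Ioo_prod_eq le_rfl hab.le le_rfl hθ'i,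
          integral_Ioo_prod_eq le_rfl hab.le le_rfl hθLi,
          ← intervalIntegral.integral_add (intervalIntegrable_slice hab.le hθ'i)
            (intervalIntegrable_slice hab.le hθLi)] at e
        have e3 : ∫ x in K, θ a * φ (a, x) * g x = θ a * ∫ x in K, φ (a, x) * g x := by
          rw [← integral_const_mul]
          simp_rw [mul_assoc]
        rw [← e3, ← e]
        refine intervalIntegral.integral_congr fun τ _ => ?_
        simp only
        rw [← integral_const_mul, ← integral_const_mul]
        congr 1
        · refine integral_congr_ae (ae_of_all _ fun x => ?_)
          simp only
          ring
        · refine integral_congr_ae (ae_of_all _ fun x => ?_)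
          simp only
          ring)
    filter_upwards [key, ae_restrict_mem measurableSet_Ioc] with τ hτ hτ'
    simp only [Λ]
    rw [integral_Ioo_prod_eq le_rfl hτ'.1.le hτ'.2 hL]
    exact hτ
  have hΛle : ∀ t ∈ Icc a b, ∀ φ : ℝ × E d → ℝ, ContDiff ℝ ∞ φ →
      Λ t φ ≤ ∫ x in K, max (φ (t, x)) 0 * ρ t x := by
    intro t ht φ hφ
    have hpos : Continuous fun z => max (φ z) 0 := hφ.continuous.max continuous_const
    have hFc := h.continuousOn_integral_continuous hK hab.le hv hpos
    -- The positive part encodes the inequality as the vanishing of a continuous function, which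
    -- passes from almost every time to every time.
    have hD : ContinuousOn (fun t => max (Λ t φ - ∫ x in K, max (φ (t, x)) 0 * ρ t x) 0)
        (Icc a b) := ContinuousOn.sup ((hΛcont φ hφ).sub hFc) continuousOn_const
    have hae : (fun t => max (Λ t φ - ∫ x in K, max (φ (t, x)) 0 * ρ t x) 0)
        =ᵐ[volume.restrict (Icc a b)] fun _ => 0 := by
      rw [Measure.restrict_congr_set Ioc_ae_eq_Icc.symm]
      filter_upwards [hΛae φ hφ, ae_restrict_mem measurableSet_Ioc] with τ hτ hτ'
      have hτI : τ ∈ Icc a b := Ioc_subset_Icc_self hτ'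
      refine max_eq_right (sub_nonpos.2 ?_)
      rw [← hτ]
      have hi := h.integrableOn_continuous_mul_slice hK hφ.continuous τ hτI
      refine integral_mono_ae ?_ (h.integrableOn_continuous_mul_slice hK hpos τ hτI) ?_
      · simp_rw [mul_comm (ρ τ _)]
        exact hi.bdd_mul (hWslice τ) (ae_of_all _ fun x => hWn (τ, x))
      · filter_upwards [h.nonneg τ hτI] with x hx
        calc W (τ, x) * (ρ τ x * φ (τ, x)) ≤ W (τ, x) * (ρ τ x * max (φ (τ, x)) 0) :=
              mul_le_mul_of_nonneg_left (mul_le_mul_of_nonneg_left (le_max_left _ _) hx)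
                (hW _).1
          _ ≤ 1 * (ρ τ x * max (φ (τ, x)) 0) :=
              mul_le_mul_of_nonneg_right (hW _).2 (mul_nonneg hx (le_max_right _ _))
          _ = max (φ (τ, x)) 0 * ρ τ x := by ring
    have := Measure.eqOn_Icc_of_ae_eq volume hab.ne hae hD continuousOn_const ht
    exact sub_nonpos.1 (max_eq_right_iff.1 this)
  have hrep : ∀ t, t ∈ Icc a b → ∃ w : E d → ℝ, Measurable w ∧ (∀ x, w x ∈ Icc (0 : ℝ) 1) ∧
      ∀ φ : ℝ × E d → ℝ, ContDiff ℝ ∞ φ → Λ t φ = ∫ x in K, w x * (φ (t, x) * ρ t x) := by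
    intro t ht
    have hsub : Ioo a t ×ˢ K ⊆ Ioo a b ×ˢ K := prod_mono_left (Ioo_subset_Ioo_right ht.2)
    -- At fixed t the bound on `Λ t` is exactly the domination required by duality, with φ(t, ·) ρ_t
    -- as the integrable function. It yields a weight `w t` for each time separately.
    let ι : smoothFunctions d →ₗ[ℝ] (E d → ℝ) :=
      { toFun := fun φ x => φ.1 (t, x) * ρ t x
        map_add' := fun φ ψ => by
          ext x
          simp [add_mul]
        map_smul' := fun c φ => by
          ext x
          simp [mul_assoc] }
    let ℓ : smoothFunctions d →ₗ[ℝ] ℝ :=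
      { toFun := fun φ => Λ t φ.1
        map_add' := fun φ ψ => by
          have e1 : ∫ x in K, (φ + ψ).1 (a, x) * g x
              = (∫ x in K, φ.1 (a, x) * g x) + ∫ x in K, ψ.1 (a, x) * g x := by
            rw [← integral_add (hgint (smoothFunctions.contDiff φ).continuous a) (hgint (smoothFunctions.contDiff ψ).continuous a)]
            refine integral_congr_ae (ae_of_all _ fun x => ?_)
            simp [add_mul]
          have e2 : ∫ z in Ioo a t ×ˢ K, W z * (ρ z.1 z.2 * materialDeriv v (φ + ψ).1 z)
              = (∫ z in Ioo a t ×ˢ K, W z * (ρ z.1 z.2 * materialDeriv v φ.1 z))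
                + ∫ z in Ioo a t ×ˢ K, W z * (ρ z.1 z.2 * materialDeriv v ψ.1 z) := by
            rw [← integral_add ((hWint (integrableOn_materialDeriv hK hv (smoothFunctions.contDiff φ))).mono_set hsub)
              ((hWint (integrableOn_materialDeriv hK hv (smoothFunctions.contDiff ψ))).mono_set hsub)]
            refine integral_congr_ae (ae_of_all _ fun z => ?_)
            simp only [Submodule.coe_add]
            rw [materialDeriv_add v (smoothFunctions.contDiff φ) (smoothFunctions.contDiff ψ)]
            ring
          simp only [Λ]
          rw [e1, e2]
          ring
        map_smul' := fun c φ => by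
          have e1 : ∫ x in K, (c • φ).1 (a, x) * g x = c * ∫ x in K, φ.1 (a, x) * g x := by
            rw [← integral_const_mul]
            refine integral_congr_ae (ae_of_all _ fun x => ?_)
            simp [mul_assoc]
          have e2 : ∫ z in Ioo a t ×ˢ K, W z * (ρ z.1 z.2 * materialDeriv v (c • φ).1 z)
              = c * ∫ z in Ioo a t ×ˢ K, W z * (ρ z.1 z.2 * materialDeriv v φ.1 z) := by
            rw [← integral_const_mul]
            refine integral_congr_ae (ae_of_all _ fun z => ?_)
            simp only [Submodule.coe_smul]
            rw [materialDeriv_smul v (smoothFunctions.contDiff φ)]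
            ring
          simp only [Λ, RingHom.id_apply, smul_eq_mul]
          rw [e1, e2]
          ring }
    obtain ⟨w, hw1, hw2, hw3⟩ := exists_weight_of_le_integral_posPart (volume.restrict K) ι
      (fun φ => h.integrableOn_continuous_mul_slice hK (smoothFunctions.contDiff φ).continuous t ht) ℓ (by
        intro φ
        refine (hΛle t ht φ.1 (smoothFunctions.contDiff φ)).trans (le_of_eq (integral_congr_ae ?_))
        filter_upwards [h.nonneg t ht] with x hx
        change max (φ.1 (t, x)) 0 * ρ t x = max (φ.1 (t, x) * ρ t x) 0
        rw [max_mul_of_nonneg _ _ hx, zero_mul])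
    exact ⟨w, hw1, hw2, fun φ hφ => hw3 ⟨φ, hφ⟩⟩
  choose! w hwm hw01 hwΛ using hrep
  have hwn : ∀ t ∈ Icc a b, ∀ x, ‖w t x‖ ≤ 1 := fun t ht x => by
    rw [Real.norm_eq_abs, abs_of_nonneg (hw01 t ht x).1]
    exact (hw01 t ht x).2
  -- Countability gives one null set of times outside which the identity with `Λ` holds for all
  -- members of `D` at once, and hence `w τ` ρ_τ equals W(τ, ·) ρ_τ.
  obtain ⟨D, hDcount, hDsmooth, hDsep⟩ := exists_countable_separating hK
  have hgood : ∀ᵐ τ ∂(volume.restrict (Ioo a b)), τ ∈ Icc a b ∧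
      ∀ᵐ x ∂(volume.restrict K), w τ x * ρ τ x = W (τ, x) * ρ τ x := by
    have h1 : ∀ᵐ τ ∂(volume.restrict (Ioo a b)), ∀ ψ ∈ D,
        ∫ x in K, W (τ, x) * (ρ τ x * ψ x) = Λ τ (fun z => ψ z.2) := by
      refine (ae_ball_iff hDcount).2 fun ψ hψ => ?_
      exact ae_restrict_of_ae_restrict_of_subset Ioo_subset_Ioc_self
        (hΛae (fun z => ψ z.2) ((hDsmooth ψ hψ).comp contDiff_snd))
    filter_upwards [h1, ae_restrict_mem measurableSet_Ioo] with τ hτ hτ'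
    have hτI : τ ∈ Icc a b := Ioo_subset_Icc_self hτ'
    refine ⟨hτI, ?_⟩
    have := hDsep (fun x => w τ x * ρ τ x - W (τ, x) * ρ τ x)
      (((hwm τ hτI).aestronglyMeasurable.mul (h.measurable_slice τ hτI)).sub
        ((hWslice τ).mul (h.measurable_slice τ hτI))) ⟨C + C, by
          filter_upwards [hC τ hτI] with x hx
          refine (norm_sub_le _ _).trans (add_le_add ?_ ?_)
          · rw [norm_mul]
            exact (mul_le_of_le_one_left (norm_nonneg _) (hwn τ hτI x)).trans hx
          · rw [norm_mul]
            exact (mul_le_of_le_one_left (norm_nonneg _) (hWn (τ, x))).trans hx⟩ (by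
        intro ψ hψ
        have e1 := hτ ψ hψ
        rw [hwΛ τ hτI (fun z => ψ z.2) ((hDsmooth ψ hψ).comp contDiff_snd)] at e1
        have hi := h.integrableOn_mul_slice
          ((hDsmooth ψ hψ).continuous.continuousOn.integrableOn_compact hK) hτI
        have i1 : IntegrableOn (fun x => w τ x * (ψ x * ρ τ x)) K :=
          hi.bdd_mul (hwm τ hτI).aestronglyMeasurable (ae_of_all _ (hwn τ hτI))
        have i2 : IntegrableOn (fun x => W (τ, x) * (ψ x * ρ τ x)) K :=
          hi.bdd_mul (hWslice τ) (ae_of_all _ fun x => hWn (τ, x))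
        have e2 : ∀ x, ψ x * (w τ x * ρ τ x - W (τ, x) * ρ τ x)
            = w τ x * (ψ x * ρ τ x) - W (τ, x) * (ψ x * ρ τ x) := fun x => by ring
        simp_rw [e2]
        rw [integral_sub i1 i2, ← e1, sub_eq_zero]
        refine integral_congr_ae (ae_of_all _ fun x => ?_)
        simp only
        ring)
    filter_upwards [this] with x hx
    linarith
  classical
  -- The weights `w t` are chosen time by time and need not be jointly measurable. At good times σ
  -- is therefore defined by W itself, and `w t` serves only on the remaining null set of times.
  let σ : ℝ → E d → ℝ := fun t x =>
    if t ∈ Icc a b ∧ ∀ᵐ x ∂(volume.restrict K), w t x * ρ t x = W (t, x) * ρ t x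
    then W (t, x) * ρ t x else w t x * ρ t x
  have hσw : ∀ t ∈ Icc a b, ∀ᵐ x ∂(volume.restrict K), σ t x = w t x * ρ t x := by
    intro t ht
    by_cases hg : t ∈ Icc a b ∧
      ∀ᵐ x ∂(volume.restrict K), w t x * ρ t x = W (t, x) * ρ t x
    · filter_upwards [hg.2] with x hx
      simp only [σ, if_pos hg, hx]
    · exact ae_of_all _ fun x => by simp only [σ, if_neg hg]
  have hσW : ∀ᵐ z ∂(volume.restrict (Ioo a b ×ˢ K)), σ z.1 z.2 = W z * ρ z.1 z.2 := by
    rw [volume_restrict_prod]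
    have := (Measure.quasiMeasurePreserving_fst (μ := volume.restrict (Ioo a b))
      (ν := volume.restrict K)).ae hgood
    filter_upwards [this] with z hz
    simp only [σ, if_pos hz]
  have hσΛ : ∀ t ∈ Icc a b, ∀ φ : ℝ × E d → ℝ, ContDiff ℝ ∞ φ →
      ∫ x in K, φ (t, x) * σ t x = Λ t φ := by
    intro t ht φ hφ
    rw [hwΛ t ht φ hφ]
    refine integral_congr_ae ?_
    filter_upwards [hσw t ht] with x hx
    rw [hx]
    ring
  have hσm : ∀ t ∈ Icc a b, AEStronglyMeasurable (σ t) (volume.restrict K) := fun t ht =>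
    ((hwm t ht).aestronglyMeasurable.mul (h.measurable_slice t ht)).congr
      ((hσw t ht).mono fun x hx => hx.symm)
  have hσle : ∀ t ∈ Icc a b, ∀ᵐ x ∂(volume.restrict K), σ t x ≤ ρ t x := by
    intro t ht
    filter_upwards [hσw t ht, h.nonneg t ht] with x h1 h2
    rw [h1]
    exact mul_le_of_le_one_left h2 (hw01 t ht x).2
  have hσ0 : ∀ t ∈ Icc a b, ∀ᵐ x ∂(volume.restrict K), 0 ≤ σ t x := by
    intro t ht
    filter_upwards [hσw t ht, h.nonneg t ht] with x h1 h2
    rw [h1]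
    exact mul_nonneg (hw01 t ht x).1 h2
  refine ⟨σ, ⟨?_, hσm, hσ0, ⟨C, fun t ht => ?_⟩, ?_⟩, hσle, ?_, hσW⟩
  · exact (hWm.aestronglyMeasurable.mul h.measurable).congr (hσW.mono fun z hz => hz.symm)
  · filter_upwards [hσle t ht, hC t ht] with x h1 h2
    exact h1.trans ((Real.le_norm_self _).trans h2)
  · intro φ hφ s t hs hst ht
    have hL := hWint (integrableOn_materialDeriv hK hv hφ)
    have hii := intervalIntegrable_slice hab.le hL
    have hsub : ∀ {p q}, a ≤ p → p ≤ q → q ≤ b → IntervalIntegrable (fun τ => ∫ x in K,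
        W (τ, x) * (ρ τ x * materialDeriv v φ (τ, x))) volume p q := by
      intro p q h1 h2 h3
      refine hii.mono_set ?_
      rw [uIcc_of_le h2, uIcc_of_le hab.le]
      exact Icc_subset_Icc h1 h3
    rw [hσΛ t ⟨hs.trans hst, ht⟩ φ hφ, hσΛ s ⟨hs, hst.trans ht⟩ φ hφ]
    have e1 : ∫ z in Ioo s t ×ˢ K, σ z.1 z.2 * materialDeriv v φ z
        = ∫ z in Ioo s t ×ˢ K, W z * (ρ z.1 z.2 * materialDeriv v φ z) := by
      refine integral_congr_ae ?_
      filter_upwards [ae_restrict_of_ae_restrict_of_subset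
        (prod_mono_left (Ioo_subset_Ioo hs ht)) hσW] with z hz
      rw [hz, mul_assoc]
    rw [e1]
    simp only [Λ]
    rw [integral_Ioo_prod_eq le_rfl (hs.trans hst) ht hL,
      integral_Ioo_prod_eq le_rfl hs (hst.trans ht) hL, integral_Ioo_prod_eq hs hst ht hL,
      ← intervalIntegral.integral_add_adjacent_intervals (hsub le_rfl hs (hst.trans ht))
        (hsub hs hst ht)]
    ring
  · have := hDsep (fun x => σ a x - g x) ((hσm a haI).sub hgm) ⟨C, by
      filter_upwards [hσ0 a haI, hσle a haI, hg0, hgρ, hC a haI] with x h1 h2 h3 h4 h5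
      have h6 := (Real.le_norm_self _).trans h5
      rw [Real.norm_eq_abs, abs_le]
      constructor <;> linarith⟩ (by
      intro ψ hψ
      have hψs : ContDiff ℝ ∞ (fun z : ℝ × E d => ψ z.2) := (hDsmooth ψ hψ).comp contDiff_snd
      have e := hσΛ a haI _ hψs
      simp only [Λ, Ioo_self, empty_prod, Measure.restrict_empty, integral_zero_measure,
        add_zero] at e
      have i1 : IntegrableOn (fun x => ψ x * σ a x) K :=
        (((hDsmooth ψ hψ).continuous.continuousOn.integrableOn_compact hK).mul_bdd (c := C)
          (hσm a haI) (by
            filter_upwards [hσ0 a haI, hσle a haI, hC a haI] with x h1 h2 h5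
            rw [Real.norm_eq_abs, abs_of_nonneg h1]
            exact h2.trans ((Real.le_norm_self _).trans h5)))
      simp_rw [mul_sub]
      rw [integral_sub i1 (hgint hψs.continuous a), e, sub_self])
    filter_upwards [this] with x hx
    linarith

end IsFlowOn

/-! ### The smoothed absolute value, and selection of flows with a given datum. -/

/-- The smooth function `s ↦ √(s² + ε²)` approximating `|s|`. -/
noncomputable def smoothAbs (ε s : ℝ) : ℝ := √(s ^ 2 + ε ^ 2)

theorem smoothAbs_pos {ε : ℝ} (hε : 0 < ε) (s : ℝ) : 0 < smoothAbs ε s :=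
  Real.sqrt_pos.2 (by positivity)

theorem sq_smoothAbs (ε s : ℝ) : smoothAbs ε s ^ 2 = s ^ 2 + ε ^ 2 :=
  Real.sq_sqrt (by positivity)

theorem abs_le_smoothAbs (ε s : ℝ) : |s| ≤ smoothAbs ε s :=
  Real.abs_le_sqrt (by nlinarith [sq_nonneg ε])

theorem smoothAbs_le {ε : ℝ} (hε : 0 < ε) (s : ℝ) : smoothAbs ε s ≤ |s| + ε := by
  refine (Real.sqrt_le_left (by positivity)).2 ?_
  nlinarith [sq_abs s, abs_nonneg s]

theorem contDiff_smoothAbs {ε : ℝ} (hε : 0 < ε) : ContDiff ℝ ∞ (smoothAbs ε) := by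
  unfold smoothAbs
  exact ContDiff.sqrt (by fun_prop) fun s => by positivity

theorem hasDerivAt_smoothAbs {ε : ℝ} (hε : 0 < ε) (s : ℝ) :
    HasDerivAt (smoothAbs ε) (s / smoothAbs ε s) s := by
  have h := ((hasDerivAt_pow 2 s).add_const (ε ^ 2)).sqrt (by positivity)
  have e : s / smoothAbs ε s = ((2 : ℕ) : ℝ) * s ^ (2 - 1) / (2 * √(s ^ 2 + ε ^ 2)) := by
    simp only [smoothAbs, Nat.cast_ofNat, Nat.add_one_sub_one, pow_one]
    rw [mul_div_mul_left _ _ two_ne_zero]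
  rw [e]
  exact h

theorem abs_div_smoothAbs_le {ε : ℝ} (hε : 0 < ε) (s : ℝ) : |s / smoothAbs ε s| ≤ 1 := by
  rw [abs_div, abs_of_pos (smoothAbs_pos hε s), div_le_one (smoothAbs_pos hε s)]
  exact abs_le_smoothAbs ε s

/-- The function is the derivative of `smoothAbs`, so this is its convexity. It makes the smooth
truncation nondecreasing. -/
theorem monotone_div_smoothAbs {ε : ℝ} (hε : 0 < ε) : Monotone fun s => s / smoothAbs ε s := by
  intro t s hts
  have hs := smoothAbs_pos hε s
  have ht := smoothAbs_pos hε t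
  simp only
  rw [div_le_div_iff₀ ht hs]
  have es := sq_smoothAbs ε s
  have et := sq_smoothAbs ε t
  rcases le_total 0 t with h0 | h0
  · refine le_of_sq_le_sq ?_ (by nlinarith)
    rw [mul_pow, mul_pow, es, et]
    nlinarith [mul_le_mul hts hts h0 (h0.trans hts), sq_nonneg ε]
  · rcases le_total 0 s with h1 | h1
    · nlinarith
    · have : (-s) * smoothAbs ε t ≤ (-t) * smoothAbs ε s := by
        refine le_of_sq_le_sq ?_ (by nlinarith)
        rw [mul_pow, mul_pow, es, et]
        nlinarith [mul_le_mul (neg_le_neg hts) (neg_le_neg hts) (neg_nonneg.2 h1)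
          (neg_nonneg.2 h0), sq_nonneg ε]
      linarith

theorem isFiniteMeasure_restrict_Ioo_prod {K : Set (E d)} (hK : IsCompact K) (a b : ℝ) :
    IsFiniteMeasure ((volume : Measure (ℝ × E d)).restrict (Ioo a b ×ˢ K)) := by
  refine ⟨?_⟩
  rw [Measure.restrict_apply_univ, Measure.volume_eq_prod, Measure.prod_prod]
  exact ENNReal.mul_lt_top measure_Ioo_lt_top hK.measure_lt_top

/-- The smooth functions on space-time that vanish at time `b`. -/
def smoothFunctionsVanishingAt (d : ℕ) (b : ℝ) : Submodule ℝ (ℝ × E d → ℝ) :=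
  smoothFunctions d ⊓ LinearMap.ker (LinearMap.funLeft ℝ ℝ fun x : E d => (b, x))

theorem mem_smoothFunctionsVanishingAt {b : ℝ} {φ : ℝ × E d → ℝ} :
    φ ∈ smoothFunctionsVanishingAt d b ↔ ContDiff ℝ ∞ φ ∧ ∀ x, φ (b, x) = 0 := by
  constructor
  · rintro ⟨h1, h2⟩
    exact ⟨smoothFunctions.contDiff ⟨φ, h1⟩, fun x => congrFun (LinearMap.mem_ker.1 h2) x⟩
  · rintro ⟨h1, h2⟩
    refine ⟨?_, LinearMap.mem_ker.2 (funext h2)⟩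
    simpa only [smoothFunctions, Submodule.mem_mk, AddSubmonoid.mem_mk, AddSubsemigroup.mem_mk,
      mem_ofPred_eq, SetLike.mem_coe] using h1

/-- The map `φ ↦ w * (∂_t φ + v · ∇φ)` on smooth functions vanishing at time `b`. -/
noncomputable def weightedMaterialDeriv (v : ℝ → E d → E d) (b : ℝ) (w : ℝ × E d → ℝ) :
    smoothFunctionsVanishingAt d b →ₗ[ℝ] (ℝ × E d → ℝ) where
  toFun φ z := w z * materialDeriv v φ.1 z
  map_add' φ ψ := by
    ext z
    have h1 := (mem_smoothFunctionsVanishingAt.1 φ.2).1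
    have h2 := (mem_smoothFunctionsVanishingAt.1 ψ.2).1
    simp only [Submodule.coe_add, Pi.add_apply]
    rw [materialDeriv_add v h1 h2, mul_add]
  map_smul' c φ := by
    ext z
    have h1 := (mem_smoothFunctionsVanishingAt.1 φ.2).1
    simp only [Submodule.coe_smul, Pi.smul_apply, RingHom.id_apply, smul_eq_mul]
    rw [materialDeriv_smul v h1]
    ring

namespace IsFlowOn

variable {v : ℝ → E d → E d} {K : Set (E d)} {a b : ℝ} {ρ σ : ℝ → E d → ℝ}

/-- The zero flow. -/
theorem zero : IsFlowOn v K a b (fun _ _ => 0) where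
  measurable := aestronglyMeasurable_const
  measurable_slice _ _ := aestronglyMeasurable_const
  nonneg _ _ := ae_of_all _ fun _ => le_rfl
  bounded := ⟨0, fun _ _ => ae_of_all _ fun _ => le_rfl⟩
  equation _ _ _ _ _ _ _ := by simp

/-- Formally, the equation is tested with min(φ, 0): it vanishes at time b, equals -φ⁻ at time a,
and its derivative along the field is at most the positive part of that of φ. This is the domination
from which the weight in the selection theorem is obtained. -/
theorem integral_negPart_le (h : IsFlowOn v K a b ρ) (hK : IsCompact K) (hab : a ≤ b)
    (hv : IntegrableOn (fun z : ℝ × E d => v z.1 z.2) (Ioo a b ×ˢ K))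
    {φ : ℝ × E d → ℝ} (hφ : ContDiff ℝ ∞ φ) (hφb : ∀ x, φ (b, x) = 0) :
    ∫ x in K, max (-φ (a, x)) 0 * ρ a x
      ≤ ∫ z in Ioo a b ×ˢ K, max (ρ z.1 z.2 * materialDeriv v φ z) 0 := by
  have haI : a ∈ Icc a b := left_mem_Icc.2 hab
  have hbI : b ∈ Icc a b := right_mem_Icc.2 hab
  have hm0 : 0 ≤ ∫ x in K, ρ b x := integral_nonneg_of_ae (h.nonneg b hbI)
  refine le_of_forall_pos_le_add fun δ hδ => ?_
  obtain ⟨ε, hε, hεδ⟩ : ∃ ε : ℝ, 0 < ε ∧ ε / 2 * ∫ x in K, ρ b x ≤ δ := by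
    refine ⟨δ / ((∫ x in K, ρ b x) + 1), by positivity, ?_⟩
    rw [div_div, div_mul_eq_mul_div, div_le_iff₀ (by positivity)]
    nlinarith
  -- A smooth version of min(s, 0) with slope in [0, 1]. It takes the value -ε/2 at 0, and
  -- conservation of mass turns this into a total error absorbed by δ.
  let β : ℝ → ℝ := fun s => (s - smoothAbs ε s) / 2
  have hβ : ContDiff ℝ ∞ β := (contDiff_id.sub (contDiff_smoothAbs hε)).div_const 2
  have hβ' : ∀ s, deriv β s ∈ Icc (0 : ℝ) 1 := by
    intro s
    have h1 : deriv β s = (1 - s / smoothAbs ε s) / 2 :=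
      (((hasDerivAt_id s).sub (hasDerivAt_smoothAbs hε s)).div_const 2).deriv
    have h2 := abs_le.1 (abs_div_smoothAbs_le hε s)
    rw [h1]
    constructor <;> linarith [h2.1, h2.2]
  have hβφ : ContDiff ℝ ∞ fun z => β (φ z) := hβ.comp hφ
  have e := h.equation _ hβφ a b le_rfl hab le_rfl
  have hL := h.integrableOn_mul (integrableOn_materialDeriv hK hv hφ)
  have hLβ := h.integrableOn_mul (integrableOn_materialDeriv hK hv hβφ)
  have e1 : ∫ x in K, β (φ (b, x)) * ρ b x = -(ε / 2) * ∫ x in K, ρ b x := by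
    rw [← integral_const_mul]
    refine integral_congr_ae (ae_of_all _ fun x => ?_)
    simp only [β, hφb, smoothAbs]
    rw [zero_pow two_ne_zero, zero_add, Real.sqrt_sq hε.le]
    ring
  have e2 : ∫ z in Ioo a b ×ˢ K, ρ z.1 z.2 * materialDeriv v (fun z => β (φ z)) z
      ≤ ∫ z in Ioo a b ×ˢ K, max (ρ z.1 z.2 * materialDeriv v φ z) 0 := by
    refine integral_mono hLβ hL.pos_part fun z => ?_
    simp only
    rw [materialDeriv_comp v hφ hβ, mul_left_comm]
    refine (mul_le_mul_of_nonneg_left (le_max_left _ 0) (hβ' _).1).trans ?_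
    exact mul_le_of_le_one_left (le_max_right _ _) (hβ' _).2
  have e3 : ∫ x in K, max (-φ (a, x)) 0 * ρ a x ≤ ∫ x in K, -(β (φ (a, x)) * ρ a x) := by
    refine integral_mono_ae
      (h.integrableOn_continuous_mul_slice hK (hφ.continuous.neg.max continuous_const) a haI)
      (h.integrableOn_continuous_mul_slice hK hβφ.continuous a haI).neg ?_
    filter_upwards [h.nonneg a haI] with x hx
    rw [← neg_mul]
    refine mul_le_mul_of_nonneg_right ?_ hx
    have h1 := abs_le_smoothAbs ε (φ (a, x))
    have h2 := neg_le_abs (φ (a, x))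
    have h3 := le_abs_self (φ (a, x))
    simp only [β]
    exact max_le (by linarith) (by linarith)
  rw [integral_neg] at e3
  linarith

/-- **Selection.** Every datum `g ≤ ρ_a` is the initial datum of a flow below `ρ`. -/
theorem exists_flow_with_initial (h : IsFlowOn v K a b ρ) (hK : IsCompact K) (hab : a < b)
    (hv : IntegrableOn (fun z : ℝ × E d => v z.1 z.2) (Ioo a b ×ˢ K))
    {g : E d → ℝ} (hgm : AEStronglyMeasurable g (volume.restrict K))
    (hg0 : ∀ᵐ x ∂(volume.restrict K), 0 ≤ g x) (hgρ : ∀ᵐ x ∂(volume.restrict K), g x ≤ ρ a x) :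
    ∃ σ : ℝ → E d → ℝ, IsFlowOn v K a b σ ∧
      (∀ t ∈ Icc a b, ∀ᵐ x ∂(volume.restrict K), σ t x ≤ ρ t x) ∧
      ∀ᵐ x ∂(volume.restrict K), σ a x = g x := by
  have := isFiniteMeasure_restrict_Ioo_prod hK a b
  have haI : a ∈ Icc a b := left_mem_Icc.2 hab.le
  obtain ⟨C, hC0, hC⟩ := h.exists_bound
  have hgint : ∀ {φ : ℝ × E d → ℝ}, Continuous φ → IntegrableOn (fun x => φ (a, x) * g x) K := by
    intro φ hφ
    refine ((hφ.comp (by fun_prop : Continuous fun x : E d =>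
      (a, x))).continuousOn.integrableOn_compact hK).mul_bdd hgm (c := C) ?_
    filter_upwards [hg0, hgρ, hC a haI] with x h1 h2 h3
    rw [Real.norm_eq_abs, abs_of_nonneg h1]
    exact h2.trans ((Real.le_norm_self _).trans h3)
  have hsm : ∀ φ : smoothFunctionsVanishingAt d b, ContDiff ℝ ∞ φ.1 := fun φ =>
    (mem_smoothFunctionsVanishingAt.1 φ.2).1
  let ℓ : smoothFunctionsVanishingAt d b →ₗ[ℝ] ℝ :=
    { toFun := fun φ => -∫ x in K, φ.1 (a, x) * g x
      map_add' := fun φ ψ => by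
        rw [← neg_add, ← integral_add (hgint (hsm φ).continuous) (hgint (hsm ψ).continuous)]
        congr 1
        refine integral_congr_ae (ae_of_all _ fun x => ?_)
        simp [add_mul]
      map_smul' := fun c φ => by
        rw [RingHom.id_apply, smul_eq_mul, mul_neg, ← integral_const_mul]
        congr 1
        refine integral_congr_ae (ae_of_all _ fun x => ?_)
        simp [mul_assoc] }
  -- Since 0 ≤ g ≤ ρ_a, the functional -∫ φ(a, ·) g is at most ∫ φ(a, ·)⁻ ρ_a, and the estimate
  -- above applies. The identity obtained says that W ρ solves the equation with datum g.
  obtain ⟨W, hW1, hW2, hW3⟩ := exists_weight_of_le_integral_posPart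
    (volume.restrict (Ioo a b ×ˢ K)) (weightedMaterialDeriv v b fun z => ρ z.1 z.2)
    (fun φ => h.integrableOn_mul (integrableOn_materialDeriv hK hv (hsm φ))) ℓ (by
      intro φ
      refine le_trans ?_ (h.integral_negPart_le hK hab.le hv (hsm φ)
        (mem_smoothFunctionsVanishingAt.1 φ.2).2)
      change -∫ x in K, φ.1 (a, x) * g x ≤ _
      rw [← integral_neg]
      refine integral_mono_ae (hgint (hsm φ).continuous).neg
        (h.integrableOn_continuous_mul_slice hK
          ((hsm φ).continuous.neg.max continuous_const) a haI) ?_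
      filter_upwards [hg0, hgρ] with x h1 h2
      rw [← neg_mul]
      exact (mul_le_mul_of_nonneg_right (le_max_left _ 0) h1).trans
        (mul_le_mul_of_nonneg_left h2 (le_max_right _ _)))
  obtain ⟨σ, hσ1, hσ2, hσ3, -⟩ := h.exists_flow_of_weight hK hab hv hW1 hW2 hgm hg0 hgρ
    (fun φ hφ hφb => (hW3 ⟨φ, mem_smoothFunctionsVanishingAt.2 ⟨hφ, hφb⟩⟩).symm)
  exact ⟨σ, hσ1, hσ2, hσ3⟩

end IsFlowOn

/-! ### Smooth truncations and confinement by barriers. -/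

/-- A smooth approximation of the truncation `s ↦ min (max s 0) l`. -/
noncomputable def smoothTrunc (ε l s : ℝ) : ℝ := (smoothAbs ε s - smoothAbs ε (s - l) + l) / 2

theorem contDiff_smoothTrunc {ε : ℝ} (hε : 0 < ε) (l : ℝ) :
    ContDiff ℝ ∞ (smoothTrunc ε l) := by
  have h := contDiff_smoothAbs hε
  exact ((h.sub (h.comp (contDiff_id.sub contDiff_const))).add contDiff_const).div_const 2

theorem deriv_smoothTrunc_mem {ε l : ℝ} (hε : 0 < ε) (hl : 0 ≤ l) (s : ℝ) :
    deriv (smoothTrunc ε l) s ∈ Icc (0 : ℝ) 1 := by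
  have h1 : deriv (smoothTrunc ε l) s
      = (s / smoothAbs ε s - (s - l) / smoothAbs ε (s - l)) / 2 := by
    have h2 : HasDerivAt (fun s => smoothAbs ε (s - l)) ((s - l) / smoothAbs ε (s - l)) s := by
      simpa using (hasDerivAt_smoothAbs hε (s - l)).comp_sub_const s l
    exact (((hasDerivAt_smoothAbs hε s).sub h2).add_const l |>.div_const 2).deriv
  have h2 := monotone_div_smoothAbs hε (show s - l ≤ s by linarith)
  have h3 := abs_le.1 (abs_div_smoothAbs_le hε s)
  have h4 := abs_le.1 (abs_div_smoothAbs_le hε (s - l))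
  simp only at h2
  rw [h1]
  constructor <;> linarith [h3.1, h3.2, h4.1, h4.2]

/-- The smoothed absolute value is 1-Lipschitz. Hence `smoothTrunc` lies in [0, l] exactly and not
just up to ε. -/
theorem abs_smoothAbs_sub_le {ε l : ℝ} (hε : 0 < ε) (hl : 0 ≤ l) (s : ℝ) :
    |smoothAbs ε s - smoothAbs ε (s - l)| ≤ l := by
  have h1 : ∀ u w : ℝ, smoothAbs ε u ≤ smoothAbs ε w + |u - w| := by
    intro u w
    have hw := smoothAbs_pos hε w
    refine (Real.sqrt_le_left (by positivity)).2 ?_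
    have e := sq_smoothAbs ε w
    have h2 := abs_le_smoothAbs ε w
    have h3 : w * (u - w) ≤ smoothAbs ε w * |u - w| := by
      refine (le_abs_self _).trans ?_
      rw [abs_mul]
      exact mul_le_mul_of_nonneg_right h2 (abs_nonneg _)
    nlinarith [sq_abs (u - w)]
  have h2 := h1 s (s - l)
  have h3 := h1 (s - l) s
  rw [sub_sub_cancel, abs_of_nonneg hl] at h2
  rw [sub_sub_cancel_left, abs_neg, abs_of_nonneg hl] at h3
  rw [abs_le]
  constructor <;> linarith

theorem smoothTrunc_nonneg {ε l : ℝ} (hε : 0 < ε) (hl : 0 ≤ l) (s : ℝ) :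
    0 ≤ smoothTrunc ε l s := by
  have := (abs_le.1 (abs_smoothAbs_sub_le hε hl s)).1
  simp only [smoothTrunc]
  linarith

theorem smoothTrunc_le {ε l : ℝ} (hε : 0 < ε) (hl : 0 ≤ l) (s : ℝ) :
    smoothTrunc ε l s ≤ l := by
  have := (abs_le.1 (abs_smoothAbs_sub_le hε hl s)).2
  simp only [smoothTrunc]
  linarith

theorem smoothTrunc_le_max {ε : ℝ} (hε : 0 < ε) (l s : ℝ) :
    smoothTrunc ε l s ≤ max s 0 + ε / 2 := by
  have h1 := smoothAbs_le hε s
  have h2 := abs_le_smoothAbs ε (s - l)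
  have h3 := neg_le_abs (s - l)
  simp only [smoothTrunc]
  rcases le_total 0 s with h | h
  · rw [abs_of_nonneg h] at h1
    rw [max_eq_left h]
    linarith
  · rw [abs_of_nonpos h] at h1
    rw [max_eq_right h]
    linarith

theorem le_smoothTrunc_self {ε l : ℝ} (hε : 0 < ε) (hl : 0 ≤ l) :
    l - ε / 2 ≤ smoothTrunc ε l l := by
  have h1 := abs_le_smoothAbs ε l
  rw [abs_of_nonneg hl] at h1
  have h2 : smoothAbs ε 0 = ε := by
    simp only [smoothAbs]
    rw [zero_pow two_ne_zero, zero_add, Real.sqrt_sq hε.le]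
  simp only [smoothTrunc, sub_self, h2]
  linarith


/-- The smooth functions on space-time that vanish at time `b`, evaluated at time `a`. -/
noncomputable def weightedInitialValue (a b : ℝ) (f : E d → ℝ) :
    smoothFunctionsVanishingAt d b × ℝ →ₗ[ℝ] (E d → ℝ) where
  toFun p x := (p.2 + p.1.1 (a, x)) * f x
  map_add' p q := by
    ext x
    simp only [Prod.fst_add, Prod.snd_add, Submodule.coe_add, Pi.add_apply]
    ring
  map_smul' c p := by
    ext x
    simp only [Prod.smul_fst, Prod.smul_snd, Submodule.coe_smul, Pi.smul_apply, smul_eq_mul,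
      RingHom.id_apply]
    ring

namespace IsFlowOn

variable {v : ℝ → E d → E d} {K : Set (E d)} {a b : ℝ} {ρ σ : ℝ → E d → ℝ}

/-- The estimate dual to the existence of a flow below `ρ` that stays in `S`: `θ₁` is a barrier
which vanishes off `S`. -/
theorem mul_integral_le_of_barrier (h : IsFlowOn v K a b ρ) (hK : IsCompact K) (hab : a ≤ b)
    (hv : IntegrableOn (fun z : ℝ × E d => v z.1 z.2) (Ioo a b ×ˢ K))
    {S : Set (E d)} (hS : MeasurableSet S) {θ : ℝ × E d → ℝ} (hθ : ContDiff ℝ ∞ θ)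
    (hθ01 : ∀ z, θ z ∈ Icc (0 : ℝ) 1) (hθS : ∀ z : ℝ × E d, z.1 ∈ Icc a b → z.2 ∉ S → θ z = 0)
    {q : ℝ × E d → ℝ} (hq : IntegrableOn q (Ioo a b ×ˢ K)) (hq0 : ∀ z, 0 ≤ q z)
    (hθq : ∀ z : ℝ × E d, z.1 ∈ Icc a b → materialDeriv v θ z ≤ q z)
    {φ : ℝ × E d → ℝ} (hφ : ContDiff ℝ ∞ φ) (hφb : ∀ x, φ (b, x) = 0) {l : ℝ} (hl : 0 ≤ l) :
    l * ∫ x in K, θ (b, x) * ρ b x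
      ≤ (∫ x in K, max ((l + φ (a, x)) * ρ a x) 0)
        + (∫ z in Ioo a b ×ˢ K,
            max ((S.indicator (fun _ => 1) z.2 * ρ z.1 z.2) * materialDeriv v φ z) 0)
        + l * ∫ z in Ioo a b ×ˢ K, ρ z.1 z.2 * q z := by
  have haI : a ∈ Icc a b := left_mem_Icc.2 hab
  have hbI : b ∈ Icc a b := right_mem_Icc.2 hab
  have hm0 : 0 ≤ ∫ x in K, ρ a x := integral_nonneg_of_ae (h.nonneg a haI)
  have hmab : ∫ x in K, ρ b x = ∫ x in K, ρ a x := h.integral_eq le_rfl hab le_rfl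
  refine le_of_forall_pos_le_add fun δ hδ => ?_
  -- Smoothing costs ε/2 times the mass at time a and again at time b. The mass is conserved, so the
  -- two errors add up to at most δ; the summand 1 in the choice of ε covers zero mass.
  obtain ⟨ε, hε, hεδ⟩ : ∃ ε : ℝ, 0 < ε ∧ ε * ∫ x in K, ρ a x ≤ δ := by
    refine ⟨δ / ((∫ x in K, ρ a x) + 1), by positivity, ?_⟩
    rw [div_mul_eq_mul_div, div_le_iff₀ (by positivity)]
    nlinarith
  -- The test function is θ times the truncation of ψ to [0, l]. At time b, ψ = l. Along the field,
  -- the derivative falling on ψ contributes only over S, where θ may be nonzero, and with a factor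
  -- in [0, 1]; the one falling on θ contributes at most l q because the truncation does not exceed
  -- l.
  let ψ : ℝ × E d → ℝ := fun z => l + φ z
  have hψ : ContDiff ℝ ∞ ψ := contDiff_const.add hφ
  have hψL : ∀ z, materialDeriv v ψ z = materialDeriv v φ z := by
    intro z
    simp only [materialDeriv, ψ, fderiv_const_add]
  have hβ := contDiff_smoothTrunc hε l
  have hβψ : ContDiff ℝ ∞ fun z => smoothTrunc ε l (ψ z) := hβ.comp hψ
  have hχ : ContDiff ℝ ∞ fun z => θ z * smoothTrunc ε l (ψ z) := hθ.mul hβψ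
  have e := h.equation _ hχ a b le_rfl hab le_rfl
  have hθi : ∀ t ∈ Icc a b, IntegrableOn (fun x => θ (t, x) * ρ t x) K := fun t ht =>
    h.integrableOn_continuous_mul_slice hK hθ.continuous t ht
  have hρi := fun t ht => h.integrableOn_slice hK (t := t) ht
  have e1 : (l - ε / 2) * ∫ x in K, θ (b, x) * ρ b x
      ≤ ∫ x in K, θ (b, x) * smoothTrunc ε l (ψ (b, x)) * ρ b x := by
    rw [← integral_const_mul]
    refine integral_mono_ae ((hθi b hbI).const_mul _)
      (h.integrableOn_continuous_mul_slice hK hχ.continuous b hbI) ?_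
    filter_upwards [h.nonneg b hbI] with x hx
    have h1 := le_smoothTrunc_self hε hl
    have h2 : 0 ≤ θ (b, x) * ρ b x := mul_nonneg (hθ01 _).1 hx
    simp only [ψ, hφb, add_zero]
    nlinarith
  have e2 : ∫ x in K, θ (b, x) * ρ b x ≤ ∫ x in K, ρ a x := by
    rw [← hmab]
    refine integral_mono_ae (hθi b hbI) (hρi b hbI) ?_
    filter_upwards [h.nonneg b hbI] with x hx
    exact mul_le_of_le_one_left hx (hθ01 _).2
  have e3 : ∫ x in K, θ (a, x) * smoothTrunc ε l (ψ (a, x)) * ρ a x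
      ≤ (∫ x in K, max ((l + φ (a, x)) * ρ a x) 0) + ε / 2 * ∫ x in K, ρ a x := by
    have i1 : IntegrableOn (fun x => max ((l + φ (a, x)) * ρ a x) 0) K :=
      (h.integrableOn_continuous_mul_slice hK hψ.continuous a haI).pos_part
    rw [← integral_const_mul, ← integral_add i1 ((hρi a haI).const_mul _)]
    refine integral_mono_ae (h.integrableOn_continuous_mul_slice hK hχ.continuous a haI)
      (i1.add ((hρi a haI).const_mul _)) ?_
    filter_upwards [h.nonneg a haI] with x hx
    have h1 := smoothTrunc_le_max hε l (ψ (a, x))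
    have h2 := smoothTrunc_nonneg hε hl (ψ (a, x))
    have h3 : θ (a, x) * smoothTrunc ε l (ψ (a, x)) ≤ max (ψ (a, x)) 0 + ε / 2 :=
      (mul_le_of_le_one_left h2 (hθ01 _).2).trans h1
    have h4 : max ((l + φ (a, x)) * ρ a x) 0 = max (ψ (a, x)) 0 * ρ a x := by
      rw [max_mul_of_nonneg _ _ hx, zero_mul]
    simp only [h4]
    rw [← add_mul]
    exact mul_le_mul_of_nonneg_right h3 hx
  have e4 : ∫ z in Ioo a b ×ˢ K,
        ρ z.1 z.2 * materialDeriv v (fun z => θ z * smoothTrunc ε l (ψ z)) z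
      ≤ (∫ z in Ioo a b ×ˢ K,
          max ((S.indicator (fun _ => 1) z.2 * ρ z.1 z.2) * materialDeriv v φ z) 0)
        + l * ∫ z in Ioo a b ×ˢ K, ρ z.1 z.2 * q z := by
    have hLφ := h.integrableOn_mul (integrableOn_materialDeriv hK hv hφ)
    have i1 : IntegrableOn (fun z : ℝ × E d =>
        max ((S.indicator (fun _ => 1) z.2 * ρ z.1 z.2) * materialDeriv v φ z) 0)
        (Ioo a b ×ˢ K) := by
      refine Integrable.pos_part ?_
      simp_rw [mul_assoc]
      refine hLφ.bdd_mul (c := 1)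
        ((measurable_const.indicator hS).comp measurable_snd).aestronglyMeasurable
        (ae_of_all _ fun z => ?_)
      by_cases hz : z.2 ∈ S <;> simp [hz]
    have i2 := (h.integrableOn_mul hq).const_mul l
    rw [← integral_const_mul, ← integral_add i1 i2]
    refine integral_mono_ae (h.integrableOn_mul (integrableOn_materialDeriv hK hv hχ))
      (i1.add i2) ?_
    filter_upwards [h.ae_nonneg, ae_restrict_mem (measurableSet_Ioo.prod hK.measurableSet)]
      with z hz hz'
    have hzI : z.1 ∈ Icc a b := Ioo_subset_Icc_self hz'.1
    rw [materialDeriv_mul v hθ hβψ, materialDeriv_comp v hψ hβ, hψL, mul_add]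
    refine add_le_add ?_ ?_
    · by_cases hzS : z.2 ∈ S
      · rw [indicator_of_mem hzS, one_mul]
        have h1 := deriv_smoothTrunc_mem hε hl (ψ z)
        have h2 : 0 ≤ θ z * deriv (smoothTrunc ε l) (ψ z) := mul_nonneg (hθ01 z).1 h1.1
        have h3 : θ z * deriv (smoothTrunc ε l) (ψ z) ≤ 1 := mul_le_one₀ (hθ01 z).2 h1.1 h1.2
        calc ρ z.1 z.2 * (θ z * (deriv (smoothTrunc ε l) (ψ z) * materialDeriv v φ z))
            = (θ z * deriv (smoothTrunc ε l) (ψ z)) * (ρ z.1 z.2 * materialDeriv v φ z) := by ring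
          _ ≤ (θ z * deriv (smoothTrunc ε l) (ψ z))
              * max (ρ z.1 z.2 * materialDeriv v φ z) 0 :=
              mul_le_mul_of_nonneg_left (le_max_left _ _) h2
          _ ≤ _ := mul_le_of_le_one_left (le_max_right _ _) h3
      · rw [hθS z hzI hzS]
        simp
    · have h1 := smoothTrunc_nonneg hε hl (ψ z)
      have h2 := smoothTrunc_le hε hl (ψ z)
      have h3 := hθq z hzI
      have h4 : smoothTrunc ε l (ψ z) * materialDeriv v θ z ≤ l * q z :=
        (mul_le_mul_of_nonneg_left h3 h1).trans (mul_le_mul_of_nonneg_right h2 (hq0 z))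
      calc ρ z.1 z.2 * (smoothTrunc ε l (ψ z) * materialDeriv v θ z)
          ≤ ρ z.1 z.2 * (l * q z) := mul_le_mul_of_nonneg_left h4 hz
        _ = l * (ρ z.1 z.2 * q z) := by ring
  have e5 : ε / 2 * ∫ x in K, θ (b, x) * ρ b x ≤ ε / 2 * ∫ x in K, ρ a x :=
    mul_le_mul_of_nonneg_left e2 (by positivity)
  linarith

/-- **Confinement.** Given a barrier `θ₁` which vanishes off `S` and a barrier `θ₂` equal to `1`
on the initial datum, below `θ₁` at the final time, whose derivatives along the field are
controlled by `q`, all but `2 ∫ ρ q` of the mass of `ρ` stays in `S`. -/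
theorem exists_flow_of_barriers (h : IsFlowOn v K a b ρ) (hK : IsCompact K) (hab : a < b)
    (hv : IntegrableOn (fun z : ℝ × E d => v z.1 z.2) (Ioo a b ×ˢ K))
    {S : Set (E d)} (hS : MeasurableSet S) {θ₁ θ₂ : ℝ × E d → ℝ} (hθ₁ : ContDiff ℝ ∞ θ₁)
    (hθ₁01 : ∀ z, θ₁ z ∈ Icc (0 : ℝ) 1)
    (hθ₁S : ∀ z : ℝ × E d, z.1 ∈ Icc a b → z.2 ∉ S → θ₁ z = 0)
    {q : ℝ × E d → ℝ} (hq : IntegrableOn q (Ioo a b ×ˢ K)) (hq0 : ∀ z, 0 ≤ q z)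
    (hθ₁q : ∀ z : ℝ × E d, z.1 ∈ Icc a b → materialDeriv v θ₁ z ≤ q z)
    (hθ₂ : ContDiff ℝ ∞ θ₂) (hθ₂q : ∀ z : ℝ × E d, z.1 ∈ Icc a b → -q z ≤ materialDeriv v θ₂ z)
    (hθ₂a : ∀ᵐ x ∂(volume.restrict K), θ₂ (a, x) * ρ a x = ρ a x)
    (hθ₂₁ : ∀ x, θ₂ (b, x) ≤ θ₁ (b, x)) :
    ∃ σ : ℝ → E d → ℝ, IsFlowOn v K a b σ ∧
      (∀ t ∈ Icc a b, ∀ᵐ x ∂(volume.restrict K), σ t x ≤ ρ t x) ∧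
      (∀ t ∈ Icc a b, ∀ᵐ x ∂(volume.restrict K), x ∉ S → σ t x = 0) ∧
      (∫ x in K, ρ a x) - 2 * ∫ z in Ioo a b ×ˢ K, ρ z.1 z.2 * q z ≤ ∫ x in K, σ a x := by
  have haI : a ∈ Icc a b := left_mem_Icc.2 hab.le
  have hbI : b ∈ Icc a b := right_mem_Icc.2 hab.le
  let c : ℝ := (∫ x in K, ρ a x) - 2 * ∫ z in Ioo a b ×ˢ K, ρ z.1 z.2 * q z
  -- For c < 0 the zero flow is enough. Otherwise c ≥ 0, which settles the domination below for l ≤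
  -- 0.
  rcases lt_or_ge c 0 with hc | hc
  · exact ⟨fun _ _ => 0, zero, h.nonneg, fun _ _ => ae_of_all _ fun _ _ => rfl,
      by simpa [c] using hc.le⟩
  have : IsFiniteMeasure (volume.restrict K) := ⟨by simpa using hK.measure_lt_top⟩
  have := isFiniteMeasure_restrict_Ioo_prod hK a b
  have hsm : ∀ φ : smoothFunctionsVanishingAt d b, ContDiff ℝ ∞ φ.1 := fun φ =>
    (mem_smoothFunctionsVanishingAt.1 φ.2).1
  -- Testing with θ₂ shows that at time b all but ∫ ρ q of the mass lies under θ₁. The second ∫ ρ q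
  -- in c comes from the estimate for θ₁.
  have hθ₂mass : (∫ x in K, ρ a x) - ∫ z in Ioo a b ×ˢ K, ρ z.1 z.2 * q z
      ≤ ∫ x in K, θ₁ (b, x) * ρ b x := by
    have e := h.equation θ₂ hθ₂ a b le_rfl hab.le le_rfl
    rw [integral_congr_ae hθ₂a] at e
    have e1 : ∫ x in K, θ₂ (b, x) * ρ b x ≤ ∫ x in K, θ₁ (b, x) * ρ b x := by
      refine integral_mono_ae
        (h.integrableOn_continuous_mul_slice hK hθ₂.continuous b hbI)
        (h.integrableOn_continuous_mul_slice hK hθ₁.continuous b hbI) ?_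
      filter_upwards [h.nonneg b hbI] with x hx
      exact mul_le_mul_of_nonneg_right (hθ₂₁ x) hx
    have e2 : ∫ z in Ioo a b ×ˢ K, -(ρ z.1 z.2 * q z)
        ≤ ∫ z in Ioo a b ×ˢ K, ρ z.1 z.2 * materialDeriv v θ₂ z := by
      refine integral_mono_ae (h.integrableOn_mul hq).neg
        (h.integrableOn_mul (integrableOn_materialDeriv hK hv hθ₂)) ?_
      filter_upwards [h.ae_nonneg, ae_restrict_mem (measurableSet_Ioo.prod hK.measurableSet)]
        with z hz hz'
      rw [← mul_neg]
      exact mul_le_mul_of_nonneg_left (hθ₂q z (Ioo_subset_Icc_self hz'.1)) hz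
    rw [integral_neg] at e2
    linarith
  -- The scalar l is the multiplier of the constraint on the initial mass. The identity at (φ, 0)
  -- will be the continuity equation, and the identity at (0, 1) will say that the initial mass of
  -- the new flow is c.
  let ι : smoothFunctionsVanishingAt d b × ℝ →ₗ[ℝ] (E d → ℝ) := weightedInitialValue a b (ρ a)
  let κ : smoothFunctionsVanishingAt d b × ℝ →ₗ[ℝ] (ℝ × E d → ℝ) :=
    weightedMaterialDeriv v b (fun z => S.indicator (fun _ => 1) z.2 * ρ z.1 z.2) ∘ₗ
      LinearMap.fst ℝ _ ℝ
  obtain ⟨w, u, hw1, hw2, hu1, hu2, hwu⟩ := exists_weights_of_le_integral_posPart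
    (volume.restrict K) (volume.restrict (Ioo a b ×ˢ K)) ι κ
    (fun p => h.integrableOn_continuous_mul_slice hK
      ((continuous_const (y := p.2)).add (hsm p.1).continuous) a haI)
    (fun p => by
      change Integrable (fun z : ℝ × E d =>
        S.indicator (fun _ => (1 : ℝ)) z.2 * ρ z.1 z.2 * materialDeriv v p.1.1 z) _
      simp_rw [mul_assoc]
      refine (h.integrableOn_mul (integrableOn_materialDeriv hK hv (hsm p.1))).bdd_mul (c := 1)
        ((measurable_const.indicator hS).comp measurable_snd).aestronglyMeasurable
        (ae_of_all _ fun z => ?_)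
      by_cases hz : z.2 ∈ S <;> simp [hz])
    (c • LinearMap.snd ℝ (smoothFunctionsVanishingAt d b) ℝ) (by
      rintro ⟨φ, l⟩
      change c * l ≤ (∫ x in K, max ((l + φ.1 (a, x)) * ρ a x) 0)
        + ∫ z in Ioo a b ×ˢ K,
          max ((S.indicator (fun _ => 1) z.2 * ρ z.1 z.2) * materialDeriv v φ.1 z) 0
      rcases le_total l 0 with hl | hl
      · have h1 : 0 ≤ ∫ x in K, max ((l + φ.1 (a, x)) * ρ a x) 0 :=
          integral_nonneg fun x => le_max_right _ _
        have h2 : 0 ≤ ∫ z in Ioo a b ×ˢ K,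
            max ((S.indicator (fun _ => 1) z.2 * ρ z.1 z.2) * materialDeriv v φ.1 z) 0 :=
          integral_nonneg fun x => le_max_right _ _
        have h3 := mul_nonpos_of_nonneg_of_nonpos hc hl
        linarith
      · have h1 := h.mul_integral_le_of_barrier hK hab.le hv hS hθ₁ hθ₁01 hθ₁S hq hq0 hθ₁q
          (hsm φ) (mem_smoothFunctionsVanishingAt.1 φ.2).2 hl
        have h2 := mul_le_mul_of_nonneg_left hθ₂mass hl
        have h3 : c * l = l * ((∫ x in K, ρ a x) - ∫ z in Ioo a b ×ˢ K, ρ z.1 z.2 * q z)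
            - l * ∫ z in Ioo a b ×ˢ K, ρ z.1 z.2 * q z := by
          simp only [c]
          ring
        linarith)
  -- The indicator of S is built into the space-time weight, so the flow can carry mass only in S.
  let W : ℝ × E d → ℝ := fun z => u z * S.indicator (fun _ => 1) z.2
  have hWm : Measurable W := hu1.mul ((measurable_const.indicator hS).comp measurable_snd)
  have hW01 : ∀ z, W z ∈ Icc (0 : ℝ) 1 := by
    intro z
    by_cases hz : z.2 ∈ S
    · simpa [W, hz] using hu2 z
    · simp [W, hz]
  obtain ⟨σ, hσ1, hσ2, hσ3, hσ4⟩ := h.exists_flow_of_weight hK hab hv hWm hW01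
    (g := fun x => w x * ρ a x)
    (hw1.aestronglyMeasurable.mul (h.measurable_slice a haI))
    (by
      filter_upwards [h.nonneg a haI] with x hx
      exact mul_nonneg (hw2 x).1 hx)
    (by
      filter_upwards [h.nonneg a haI] with x hx
      exact mul_le_of_le_one_left hx (hw2 x).2)
    (by
      intro φ hφ hφb
      have e : c * (0 : ℝ) = (∫ x in K, w x * ((0 + φ (a, x)) * ρ a x))
          + ∫ z in Ioo a b ×ˢ K,
            u z * ((S.indicator (fun _ => 1) z.2 * ρ z.1 z.2) * materialDeriv v φ z) :=
        hwu (⟨φ, mem_smoothFunctionsVanishingAt.2 ⟨hφ, hφb⟩⟩, 0)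
      have e1 : ∀ x, w x * ((0 + φ (a, x)) * ρ a x) = φ (a, x) * (w x * ρ a x) := fun x => by
        ring
      have e2 : ∀ z : ℝ × E d,
          u z * ((S.indicator (fun _ => 1) z.2 * ρ z.1 z.2) * materialDeriv v φ z)
            = W z * (ρ z.1 z.2 * materialDeriv v φ z) := fun z => by
        simp only [W]
        ring
      simp_rw [e1, e2] at e
      linarith)
  refine ⟨σ, hσ1, hσ2, hσ1.ae_eq_zero_of_ae_prod hK hab hv hS ?_, ?_⟩
  · filter_upwards [hσ4] with z hz hzS
    rw [hz]
    simp [W, hzS]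
  · have e : c * (1 : ℝ) = (∫ x in K, w x * ((1 + 0) * ρ a x))
        + ∫ z in Ioo a b ×ˢ K, u z * ((S.indicator (fun _ => 1) z.2 * ρ z.1 z.2)
          * materialDeriv v (fun _ => (0 : ℝ)) z) := hwu (0, 1)
    simp only [mul_one, add_zero, one_mul, materialDeriv, fderiv_fun_const, Pi.zero_apply,
      zero_apply, mul_zero, integral_zero] at e
    rw [integral_congr_ae hσ3, ← e]

end IsFlowOn

/-! ### Confinement to balls over a short time. -/

/-- A smooth nonincreasing cutoff, equal to `1` on `(-∞, 1]` and to `0` on `[2, ∞)`. -/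
noncomputable def cutoff (y : ℝ) : ℝ := Real.smoothTransition (2 - y)

theorem contDiff_cutoff : ContDiff ℝ ∞ cutoff :=
  Real.smoothTransition.contDiff.comp (contDiff_const.sub contDiff_id)

theorem cutoff_mem (y : ℝ) : cutoff y ∈ Icc (0 : ℝ) 1 :=
  ⟨Real.smoothTransition.nonneg _, Real.smoothTransition.le_one _⟩

theorem cutoff_of_le_one {y : ℝ} (h : y ≤ 1) : cutoff y = 1 :=
  Real.smoothTransition.one_of_one_le (by linarith)

theorem cutoff_of_two_le {y : ℝ} (h : 2 ≤ y) : cutoff y = 0 :=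
  Real.smoothTransition.zero_of_nonpos (by linarith)

theorem antitone_cutoff : Antitone cutoff := fun _ _ h =>
  Real.smoothTransition.monotone (by linarith)

theorem deriv_cutoff_of_two_lt {y : ℝ} (h : 2 < y) : deriv cutoff y = 0 := by
  have : cutoff =ᶠ[𝓝 y] fun _ => 0 := by
    filter_upwards [lt_mem_nhds h] with z hz
    exact cutoff_of_two_le hz.le
  rw [this.deriv_eq, deriv_const]

theorem deriv_cutoff_of_lt_one {y : ℝ} (h : y < 1) : deriv cutoff y = 0 := by
  have : cutoff =ᶠ[𝓝 y] fun _ => 1 := by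
    filter_upwards [gt_mem_nhds h] with z hz
    exact cutoff_of_le_one hz.le
  rw [this.deriv_eq, deriv_const]

theorem exists_deriv_cutoff_bound : ∃ C : ℝ, 0 ≤ C ∧ ∀ y, deriv cutoff y ∈ Icc (-C) 0 := by
  obtain ⟨C, hC⟩ := (isCompact_Icc (a := (1 : ℝ)) (b := 2)).exists_bound_of_continuousOn
    (contDiff_cutoff.continuous_deriv (by simp)).continuousOn
  have hC0 : 0 ≤ C := (norm_nonneg _).trans (hC 1 ⟨le_rfl, by norm_num⟩)
  refine ⟨C, hC0, fun y => ⟨?_, antitone_cutoff.deriv_nonpos⟩⟩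
  rcases lt_or_ge y 1 with h1 | h1
  · rw [deriv_cutoff_of_lt_one h1]
    linarith
  rcases lt_or_ge 2 y with h2 | h2
  · rw [deriv_cutoff_of_two_lt h2]
    linarith
  exact (abs_le.1 (hC y ⟨h1, h2⟩)).1

/-- Uniqueness, at the final time, of the flows that stay in the ball of radius `R` around `y`. -/
def UniqueInBall (v : ℝ → E d → E d) (K : Set (E d)) (a b : ℝ)
    (y : E d) (R : ℝ) : Prop :=
  ∀ σ τ : ℝ → E d → ℝ, IsFlowOn v K a b σ → IsFlowOn v K a b τ →
    (∀ t ∈ Icc a b, ∀ᵐ x ∂(volume.restrict K), x ∉ Metric.closedBall y R → σ t x = 0) →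
    (∀ t ∈ Icc a b, ∀ᵐ x ∂(volume.restrict K), x ∉ Metric.closedBall y R → τ t x = 0) →
    (∀ᵐ x ∂(volume.restrict K), σ a x = τ a x) →
    ∀ᵐ x ∂(volume.restrict K), σ b x = τ b x

/-- The paraboloid `‖x - x₀‖² / r² + A (t - s)`. -/
noncomputable def paraboloid (x₀ : E d) (r A s : ℝ) (z : ℝ × E d) : ℝ :=
  ‖z.2 - x₀‖ ^ 2 / r ^ 2 + A * (z.1 - s)

theorem contDiff_paraboloid (x₀ : E d) (r A s : ℝ) : ContDiff ℝ ∞ (paraboloid x₀ r A s) := by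
  unfold paraboloid
  exact (((contDiff_snd.sub contDiff_const).norm_sq ℝ).div_const _).add
    (contDiff_const.mul (contDiff_fst.sub contDiff_const))

theorem materialDeriv_paraboloid (v : ℝ → E d → E d) (x₀ : E d) (r A s : ℝ) (z : ℝ × E d) :
    materialDeriv v (paraboloid x₀ r A s) z
      = 2 * inner ℝ (z.2 - x₀) (v z.1 z.2) / r ^ 2 + A := by
  have h1 : HasFDerivAt (fun z : ℝ × E d => ‖z.2 - x₀‖ ^ 2)
      (2 • (innerSL ℝ (z.2 - x₀)).comp (ContinuousLinearMap.snd ℝ ℝ (E d))) z :=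
    (hasFDerivAt_snd.sub_const x₀).norm_sq
  have h2 : HasFDerivAt (fun z : ℝ × E d => A * (z.1 - s))
      (A • ContinuousLinearMap.fst ℝ ℝ (E d)) z := (hasFDerivAt_fst.sub_const s).const_mul A
  have h3 := (h1.mul_const (r ^ 2)⁻¹).add h2
  have h4 : HasFDerivAt (paraboloid x₀ r A s) _ z := h3
  simp only [materialDeriv]
  rw [h4.fderiv]
  simp only [add_apply, smul_apply, ContinuousLinearMap.comp_apply,
    ContinuousLinearMap.coe_snd', ContinuousLinearMap.coe_fst', innerSL_apply_apply, smul_eq_mul,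
    nsmul_eq_mul, Nat.cast_ofNat, mul_one]
  ring

theorem abs_two_mul_inner_div_le {x w : E d} {r R : ℝ} (hr : 0 < r) (hx : ‖x‖ ≤ R * r) :
    |2 * inner ℝ x w / r ^ 2| ≤ 2 * R / r * ‖w‖ := by
  rw [abs_div, abs_mul, abs_of_pos (show (0 : ℝ) < r ^ 2 by positivity),
    abs_of_pos (show (0 : ℝ) < 2 by norm_num), div_le_iff₀ (by positivity)]
  have h1 := abs_real_inner_le_norm x w
  have h2 : ‖x‖ * ‖w‖ ≤ R * r * ‖w‖ := mul_le_mul_of_nonneg_right hx (norm_nonneg _)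
  have h3 : 2 * R / r * ‖w‖ * r ^ 2 = 2 * (R * r * ‖w‖) := by
    field_simp
  linarith

/-- The excess of the speed `‖v‖` over the level `M`. -/
noncomputable def speedExcess (v : ℝ → E d → E d) (M : ℝ) (z : ℝ × E d) : ℝ :=
  max (‖v z.1 z.2‖ - M) 0

theorem speedExcess_nonneg (v : ℝ → E d → E d) (M : ℝ) (z : ℝ × E d) : 0 ≤ speedExcess v M z :=
  le_max_right _ _

theorem integrableOn_speedExcess {v : ℝ → E d → E d} {K : Set (E d)} (hK : IsCompact K) {a b : ℝ}
    (hv : IntegrableOn (fun z : ℝ × E d => v z.1 z.2) (Ioo a b ×ˢ K)) (M : ℝ) :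
    IntegrableOn (speedExcess v M) (Ioo a b ×ˢ K) := by
  have := isFiniteMeasure_restrict_Ioo_prod hK a b
  exact (hv.norm.sub (integrable_const M)).pos_part

namespace IsFlowOn

variable {v : ℝ → E d → E d} {K : Set (E d)} {a b : ℝ} {ρ σ τ : ℝ → E d → ℝ}

/-- Over a short time, all of the mass that starts in a ball of radius `r` stays in the ball of
radius `3 r`, up to an error controlled by the excess of the speed over `M`. -/
theorem exists_flow_in_closedBall (h : IsFlowOn v K a b ρ) (hK : IsCompact K) (hab : a < b)
    (hv : IntegrableOn (fun z : ℝ × E d => v z.1 z.2) (Ioo a b ×ˢ K))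
    {C : ℝ} (hC0 : 0 ≤ C) (hC : ∀ y, deriv cutoff y ∈ Icc (-C) 0) {x₀ : E d} {r M : ℝ}
    (hr : 0 < r) (hM : 0 ≤ M) (hMab : 6 * M / r * (b - a) ≤ 1)
    (hρ : ∀ᵐ x ∂(volume.restrict K), x ∉ Metric.closedBall x₀ r → ρ a x = 0) :
    ∃ σ : ℝ → E d → ℝ, IsFlowOn v K a b σ ∧
      (∀ t ∈ Icc a b, ∀ᵐ x ∂(volume.restrict K), σ t x ≤ ρ t x) ∧
      (∀ t ∈ Icc a b, ∀ᵐ x ∂(volume.restrict K),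
        x ∉ Metric.closedBall x₀ (3 * r) → σ t x = 0) ∧
      (∫ x in K, ρ a x)
          - 2 * ∫ z in Ioo a b ×ˢ K, ρ z.1 z.2 * (C * (6 / r) * speedExcess v M z)
        ≤ ∫ x in K, σ a x := by
  -- On the ball of radius 3r the field changes ‖x - x₀‖²/r² at rate at most (6/r) ‖v‖. The slope A
  -- = 6M/r absorbs speeds up to M, so only the excess of the speed remains in q.
  let A : ℝ := 6 * M / r
  have hA : 0 ≤ A := by positivity
  have hAt : ∀ {t}, t ∈ Icc a b → 0 ≤ A * (t - a) ∧ A * (t - a) ≤ 1 := fun {t} ht =>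
    ⟨mul_nonneg hA (by linarith [ht.1]),
      (mul_le_mul_of_nonneg_left (by linarith [ht.2]) hA).trans hMab⟩
  -- With D = ‖x - x₀‖²/r² and 0 ≤ A (t - a) ≤ 1, the barrier `cutoff (p₁ z)` vanishes once D ≥ 5,
  -- well inside D ≤ 9, and `cutoff (p₂ z)` is 1 at time a where D ≤ 1. The shift by 3 places the
  -- two transitions on opposite sides of D = 3 at time b.
  let p₁ : ℝ × E d → ℝ := fun z => paraboloid x₀ r A a z - 3
  let p₂ : ℝ × E d → ℝ := paraboloid x₀ r (-A) a
  have hp₁ : ContDiff ℝ ∞ p₁ := (contDiff_paraboloid x₀ r A a).sub contDiff_const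
  have hp₂ : ContDiff ℝ ∞ p₂ := contDiff_paraboloid x₀ r (-A) a
  have hp₁L : ∀ z, materialDeriv v p₁ z = 2 * inner ℝ (z.2 - x₀) (v z.1 z.2) / r ^ 2 + A := by
    intro z
    rw [← materialDeriv_paraboloid v x₀ r A a z]
    simp only [materialDeriv, p₁, fderiv_sub_const]
  have hp₂L : ∀ z, materialDeriv v p₂ z = 2 * inner ℝ (z.2 - x₀) (v z.1 z.2) / r ^ 2 + -A :=
    fun z => materialDeriv_paraboloid v x₀ r (-A) a z
  have hsq : ∀ {x : E d}, ‖x - x₀‖ ^ 2 / r ^ 2 ≤ 9 → ‖x - x₀‖ ≤ 3 * r := by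
    intro x hx
    rw [div_le_iff₀ (by positivity)] at hx
    refine le_of_sq_le_sq ?_ (by positivity)
    nlinarith
  have hspeed : ∀ {z : ℝ × E d}, ‖z.2 - x₀‖ ^ 2 / r ^ 2 ≤ 9 →
      |2 * inner ℝ (z.2 - x₀) (v z.1 z.2) / r ^ 2| - A ≤ 6 / r * speedExcess v M z := by
    intro z hz
    have h1 := abs_two_mul_inner_div_le (w := v z.1 z.2) hr (hsq hz)
    have h2 : 6 / r * (‖v z.1 z.2‖ - M) ≤ 6 / r * speedExcess v M z :=
      mul_le_mul_of_nonneg_left (le_max_left _ _) (by positivity)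
    have h3 : 6 / r * (‖v z.1 z.2‖ - M) = 2 * 3 / r * ‖v z.1 z.2‖ - A := by
      simp only [A]
      ring
    linarith
  have hq0 : ∀ z, 0 ≤ 6 / r * speedExcess v M z := fun z =>
    mul_nonneg (by positivity) (speedExcess_nonneg v M z)
  refine h.exists_flow_of_barriers hK hab hv (S := Metric.closedBall x₀ (3 * r))
    Metric.isClosed_closedBall.measurableSet (θ₁ := fun z => cutoff (p₁ z))
    (θ₂ := fun z => cutoff (p₂ z)) (q := fun z => C * (6 / r) * speedExcess v M z)
    (contDiff_cutoff.comp hp₁) (fun z => cutoff_mem _) ?_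
    ((integrableOn_speedExcess hK hv M).const_mul _)
    (fun z => by rw [mul_assoc]; exact mul_nonneg hC0 (hq0 z)) ?_
    (contDiff_cutoff.comp hp₂) ?_ ?_ ?_
  · intro z hz hzS
    refine cutoff_of_two_le ?_
    by_contra hlt
    refine hzS ?_
    rw [mem_closedBall_iff_norm]
    refine hsq ?_
    have := (hAt hz).1
    simp only [p₁, paraboloid] at hlt
    linarith
  · intro z hz
    rw [materialDeriv_comp v hp₁ contDiff_cutoff, hp₁L, mul_assoc]
    rcases lt_or_ge 2 (p₁ z) with h2 | h2
    · rw [deriv_cutoff_of_two_lt h2, zero_mul]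
      exact mul_nonneg hC0 (hq0 z)
    · have h3 : ‖z.2 - x₀‖ ^ 2 / r ^ 2 ≤ 9 := by
        have := (hAt hz).1
        simp only [p₁, paraboloid] at h2
        linarith
      have h4 := hspeed h3
      have h5 := hC (p₁ z)
      have h6 := neg_abs_le (2 * inner ℝ (z.2 - x₀) (v z.1 z.2) / r ^ 2)
      have h7 := hq0 z
      have h8 : -deriv cutoff (p₁ z) * -(2 * inner ℝ (z.2 - x₀) (v z.1 z.2) / r ^ 2 + A)
          ≤ -deriv cutoff (p₁ z) * (6 / r * speedExcess v M z) :=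
        mul_le_mul_of_nonneg_left (by linarith) (by linarith [h5.2])
      have h9 : -deriv cutoff (p₁ z) * (6 / r * speedExcess v M z)
          ≤ C * (6 / r * speedExcess v M z) :=
        mul_le_mul_of_nonneg_right (by linarith [h5.1]) h7
      linarith
  · intro z hz
    rw [materialDeriv_comp v hp₂ contDiff_cutoff, hp₂L, mul_assoc]
    rcases lt_or_ge 2 (p₂ z) with h2 | h2
    · rw [deriv_cutoff_of_two_lt h2, zero_mul]
      exact neg_nonpos.2 (mul_nonneg hC0 (hq0 z))
    · have h3 : ‖z.2 - x₀‖ ^ 2 / r ^ 2 ≤ 9 := by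
        have := (hAt hz).2
        simp only [p₂, paraboloid] at h2
        linarith
      have h4 := hspeed h3
      have h5 := hC (p₂ z)
      have h6 := le_abs_self (2 * inner ℝ (z.2 - x₀) (v z.1 z.2) / r ^ 2)
      have h7 := hq0 z
      have h8 : -deriv cutoff (p₂ z) * (2 * inner ℝ (z.2 - x₀) (v z.1 z.2) / r ^ 2 + -A)
          ≤ -deriv cutoff (p₂ z) * (6 / r * speedExcess v M z) :=
        mul_le_mul_of_nonneg_left (by linarith) (by linarith [h5.2])
      have h9 : -deriv cutoff (p₂ z) * (6 / r * speedExcess v M z)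
          ≤ C * (6 / r * speedExcess v M z) :=
        mul_le_mul_of_nonneg_right (by linarith [h5.1]) h7
      linarith
  · filter_upwards [hρ] with x hx
    by_cases hxr : x ∈ Metric.closedBall x₀ r
    · rw [mem_closedBall_iff_norm] at hxr
      have h1 : ‖x - x₀‖ ^ 2 / r ^ 2 ≤ 1 := by
        rw [div_le_one (by positivity)]
        exact pow_le_pow_left₀ (norm_nonneg _) hxr 2
      rw [cutoff_of_le_one, one_mul]
      simpa [p₂, paraboloid] using h1
    · rw [hx hxr, mul_zero]
  -- At time b the first barrier is 1 where D ≤ 3 and the second is 0 where D ≥ 3, so the second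
  -- lies below the first.
  · intro x
    have hb := hAt (right_mem_Icc.2 hab.le)
    rcases le_total (‖x - x₀‖ ^ 2 / r ^ 2) 3 with h1 | h1
    · have h2 : cutoff (p₁ (b, x)) = 1 := by
        refine cutoff_of_le_one ?_
        simp only [p₁, paraboloid]
        linarith [hb.2]
      rw [h2]
      exact (cutoff_mem _).2
    · have h2 : cutoff (p₂ (b, x)) = 0 := by
        refine cutoff_of_two_le ?_
        simp only [p₂, paraboloid]
        linarith [hb.2]
      rw [h2]
      exact (cutoff_mem _).1

/-! ### Mass shared by two flows after a short time. -/

/-- Two flows with the same initial datum, concentrated in a small ball, share most of their mass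
at the final time. -/
theorem exists_common_mass_of_closedBall (hσ : IsFlowOn v K a b σ) (hτ : IsFlowOn v K a b τ)
    (hK : IsCompact K) (hab : a < b)
    (hv : IntegrableOn (fun z : ℝ × E d => v z.1 z.2) (Ioo a b ×ˢ K))
    {C : ℝ} (hC0 : 0 ≤ C) (hC : ∀ y, deriv cutoff y ∈ Icc (-C) 0) {y : E d} {r M : ℝ}
    (hr : 0 < r) (hM : 0 ≤ M) (hMab : 6 * M / r * (b - a) ≤ 1)
    (hU : UniqueInBall v K a b y (3 * r))
    (hστ : ∀ᵐ x ∂(volume.restrict K), σ a x = τ a x)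
    (hσy : ∀ᵐ x ∂(volume.restrict K), x ∉ Metric.closedBall y r → σ a x = 0) :
    ∃ f : E d → ℝ, AEStronglyMeasurable f (volume.restrict K) ∧
      (∀ᵐ x ∂(volume.restrict K), 0 ≤ f x) ∧ (∀ᵐ x ∂(volume.restrict K), f x ≤ σ b x) ∧
      (∀ᵐ x ∂(volume.restrict K), f x ≤ τ b x) ∧
      (∫ x in K, σ a x)
          - 2 * ((∫ z in Ioo a b ×ˢ K, σ z.1 z.2 * (C * (6 / r) * speedExcess v M z))
            + ∫ z in Ioo a b ×ˢ K, τ z.1 z.2 * (C * (6 / r) * speedExcess v M z))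
        ≤ ∫ x in K, f x := by
  have haI : a ∈ Icc a b := left_mem_Icc.2 hab.le
  have hbI : b ∈ Icc a b := right_mem_Icc.2 hab.le
  have hτy : ∀ᵐ x ∂(volume.restrict K), x ∉ Metric.closedBall y r → τ a x = 0 := by
    filter_upwards [hστ, hσy] with x h1 h2 h3
    rw [← h1, h2 h3]
  obtain ⟨σ₁, hσ₁, hσ₁σ, hσ₁y, hσ₁m⟩ :=
    hσ.exists_flow_in_closedBall hK hab hv hC0 hC hr hM hMab hσy
  obtain ⟨τ₁, hτ₁, hτ₁τ, hτ₁y, hτ₁m⟩ :=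
    hτ.exists_flow_in_closedBall hK hab hv hC0 hC hr hM hMab hτy
  -- The confined flows may start from different data. Their minimum is admissible for both, and the
  -- flows selected from it stay in the ball, where uniqueness identifies them at time b.
  let g : E d → ℝ := fun x => min (σ₁ a x) (τ₁ a x)
  have hgm : AEStronglyMeasurable g (volume.restrict K) :=
    (hσ₁.measurable_slice a haI).inf (hτ₁.measurable_slice a haI)
  have hg0 : ∀ᵐ x ∂(volume.restrict K), 0 ≤ g x := by
    filter_upwards [hσ₁.nonneg a haI, hτ₁.nonneg a haI] with x h1 h2
    exact le_min h1 h2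
  obtain ⟨σ₂, hσ₂, hσ₂σ, hσ₂g⟩ := hσ₁.exists_flow_with_initial hK hab hv hgm hg0
    (ae_of_all _ fun x => min_le_left _ _)
  obtain ⟨τ₂, hτ₂, hτ₂τ, hτ₂g⟩ := hτ₁.exists_flow_with_initial hK hab hv hgm hg0
    (ae_of_all _ fun x => min_le_right _ _)
  have heq : ∀ᵐ x ∂(volume.restrict K), σ₂ b x = τ₂ b x := by
    refine hU σ₂ τ₂ hσ₂ hτ₂ (fun t ht => ?_) (fun t ht => ?_) ?_
    · filter_upwards [hσ₂.nonneg t ht, hσ₂σ t ht, hσ₁y t ht] with x h1 h2 h3 h4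
      exact le_antisymm (h2.trans (h3 h4).le) h1
    · filter_upwards [hτ₂.nonneg t ht, hτ₂τ t ht, hτ₁y t ht] with x h1 h2 h3 h4
      exact le_antisymm (h2.trans (h3 h4).le) h1
    · filter_upwards [hσ₂g, hτ₂g] with x h1 h2
      rw [h1, h2]
  refine ⟨σ₂ b, hσ₂.measurable_slice b hbI, hσ₂.nonneg b hbI, ?_, ?_, ?_⟩
  · filter_upwards [hσ₂σ b hbI, hσ₁σ b hbI] with x h1 h2
    exact h1.trans h2
  · filter_upwards [heq, hτ₂τ b hbI, hτ₁τ b hbI] with x h0 h1 h2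
    rw [h0]
    exact h1.trans h2
  · rw [hσ₂.integral_eq le_rfl hab.le le_rfl, integral_congr_ae hσ₂g]
    have hgi : IntegrableOn g K := (hσ₂.integrableOn_slice hK haI).congr hσ₂g
    -- Both σ₁ and τ₁ start below the common datum σ_a, so their minimum is at least σ₁ + τ₁ - σ_a:
    -- the losses of the two confinements add.
    have h1 : ∫ x in K, (σ₁ a x + τ₁ a x - σ a x) ≤ ∫ x in K, g x := by
      refine integral_mono_ae (((hσ₁.integrableOn_slice hK haI).add
        (hτ₁.integrableOn_slice hK haI)).sub (hσ.integrableOn_slice hK haI)) hgi ?_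
      filter_upwards [hσ₁σ a haI, hτ₁τ a haI, hστ] with x h1 h2 h3
      simp only [g]
      exact le_min (by linarith) (by linarith)
    have h2 : ∫ x in K, (σ₁ a x + τ₁ a x - σ a x)
        = (∫ x in K, σ₁ a x) + (∫ x in K, τ₁ a x) - ∫ x in K, σ a x := by
      rw [← integral_add (hσ₁.integrableOn_slice hK haI) (hτ₁.integrableOn_slice hK haI)]
      exact integral_sub ((hσ₁.integrableOn_slice hK haI).add (hτ₁.integrableOn_slice hK haI))
        (hσ.integrableOn_slice hK haI)
    have h3 : ∫ x in K, τ a x = ∫ x in K, σ a x :=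
      integral_congr_ae (hστ.mono fun x hx => hx.symm)
    rw [h3] at hτ₁m
    linarith

/-- Two flows with the same initial datum share, after a short time, all of their mass up to an
error controlled by the excess of the speed over `M`. -/
theorem exists_common_mass (hK : IsCompact K) (hab : a < b)
    (hv : IntegrableOn (fun z : ℝ × E d => v z.1 z.2) (Ioo a b ×ˢ K))
    {C : ℝ} (hC0 : 0 ≤ C) (hC : ∀ y, deriv cutoff y ∈ Icc (-C) 0) {r M : ℝ}
    (hr : 0 < r) (hM : 0 ≤ M) (hMab : 6 * M / r * (b - a) ≤ 1) (J : Finset (E d))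
    (hU : ∀ y ∈ J, UniqueInBall v K a b y (3 * r)) :
    ∀ σ τ : ℝ → E d → ℝ, IsFlowOn v K a b σ → IsFlowOn v K a b τ →
      (∀ᵐ x ∂(volume.restrict K), σ a x = τ a x) →
      (∀ᵐ x ∂(volume.restrict K), (∀ y ∈ J, x ∉ Metric.closedBall y r) → σ a x = 0) →
      ∃ f : E d → ℝ, AEStronglyMeasurable f (volume.restrict K) ∧
        (∀ᵐ x ∂(volume.restrict K), 0 ≤ f x) ∧ (∀ᵐ x ∂(volume.restrict K), f x ≤ σ b x) ∧
        (∀ᵐ x ∂(volume.restrict K), f x ≤ τ b x) ∧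
        (∫ x in K, σ a x)
            - 2 * ((∫ z in Ioo a b ×ˢ K, σ z.1 z.2 * (C * (6 / r) * speedExcess v M z))
              + ∫ z in Ioo a b ×ˢ K, τ z.1 z.2 * (C * (6 / r) * speedExcess v M z))
          ≤ ∫ x in K, f x := by
  classical
  have haI : a ∈ Icc a b := left_mem_Icc.2 hab.le
  have hbI : b ∈ Icc a b := right_mem_Icc.2 hab.le
  have hq : IntegrableOn (fun z => C * (6 / r) * speedExcess v M z) (Ioo a b ×ˢ K) :=
    (integrableOn_speedExcess hK hv M).const_mul _
  have hq0 : ∀ z, 0 ≤ C * (6 / r) * speedExcess v M z := fun z =>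
    mul_nonneg (by positivity) (speedExcess_nonneg v M z)
  have hbad : ∀ {ρ : ℝ → E d → ℝ}, IsFlowOn v K a b ρ →
      0 ≤ ∫ z in Ioo a b ×ˢ K, ρ z.1 z.2 * (C * (6 / r) * speedExcess v M z) := fun hρ =>
    integral_nonneg_of_ae (hρ.ae_nonneg.mono fun z hz => mul_nonneg hz (hq0 z))
  induction J using Finset.induction_on with
  | empty =>
    intro σ τ hσ hτ hστ h0
    refine ⟨fun _ => 0, aestronglyMeasurable_const, ae_of_all _ fun _ => le_rfl,
      hσ.nonneg b hbI, hτ.nonneg b hbI, ?_⟩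
    have h1 : ∫ x in K, σ a x = 0 := by
      rw [← integral_zero (E d) ℝ (μ := volume.restrict K)]
      refine integral_congr_ae ?_
      filter_upwards [h0] with x hx
      exact hx (by simp)
    rw [h1, integral_zero]
    linarith [hbad hσ, hbad hτ]
  | insert y J hyJ ih =>
    intro σ τ hσ hτ hστ h0
    let B : Set (E d) := Metric.closedBall y r
    have hB : MeasurableSet B := Metric.isClosed_closedBall.measurableSet
    -- The part of the datum in the ball around y is split off and the remainders go to the
    -- induction. Each flow is the sum of its two pieces, so the error integrals add up to those of
    -- σ and τ, independently of the number of balls.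
    let g : E d → ℝ := B.indicator (σ a)
    have hgm : AEStronglyMeasurable g (volume.restrict K) :=
      (hσ.measurable_slice a haI).indicator hB
    have hg0 : ∀ᵐ x ∂(volume.restrict K), 0 ≤ g x := by
      filter_upwards [hσ.nonneg a haI] with x hx
      by_cases hxB : x ∈ B <;> simp [g, hxB, hx]
    have hgσ : ∀ᵐ x ∂(volume.restrict K), g x ≤ σ a x := by
      filter_upwards [hσ.nonneg a haI] with x hx
      by_cases hxB : x ∈ B <;> simp [g, hxB, hx]
    have hgτ : ∀ᵐ x ∂(volume.restrict K), g x ≤ τ a x := by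
      filter_upwards [hgσ, hστ] with x h1 h2
      rwa [← h2]
    obtain ⟨σ₁, hσ₁, hσ₁σ, hσ₁g⟩ := hσ.exists_flow_with_initial hK hab hv hgm hg0 hgσ
    obtain ⟨τ₁, hτ₁, hτ₁τ, hτ₁g⟩ := hτ.exists_flow_with_initial hK hab hv hgm hg0 hgτ
    have hσ₂ := hσ.sub hσ₁ hK hv hσ₁σ
    have hτ₂ := hτ.sub hτ₁ hK hv hτ₁τ
    obtain ⟨f₁, hf₁m, hf₁0, hf₁σ, hf₁τ, hf₁⟩ := hσ₁.exists_common_mass_of_closedBall hτ₁ hK hab hv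
      hC0 hC hr hM hMab (hU y (Finset.mem_insert_self y J))
      (by
        filter_upwards [hσ₁g, hτ₁g] with x h1 h2
        rw [h1, h2])
      (by
        filter_upwards [hσ₁g] with x h1 h2
        rw [h1]
        simp only [g]
        rw [indicator_of_notMem h2])
    obtain ⟨f₂, hf₂m, hf₂0, hf₂σ, hf₂τ, hf₂⟩ := ih
      (fun z hz => hU z (Finset.mem_insert_of_mem hz)) _ _ hσ₂ hτ₂
      (by
        filter_upwards [hσ₁g, hτ₁g, hστ] with x h1 h2 h3
        rw [h1, h2, h3])
      (by
        filter_upwards [hσ₁g, h0] with x h1 h2 h3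
        rw [h1]
        by_cases hxB : x ∈ B
        · simp [g, hxB]
        · rw [h2]
          · simp [g, hxB]
          · intro z hz
            rcases Finset.mem_insert.1 hz with rfl | hz
            · exact hxB
            · exact h3 z hz)
    have hfi : ∀ {f : E d → ℝ} {ρ : ℝ → E d → ℝ}, IsFlowOn v K a b ρ →
        AEStronglyMeasurable f (volume.restrict K) → (∀ᵐ x ∂(volume.restrict K), 0 ≤ f x) →
        (∀ᵐ x ∂(volume.restrict K), f x ≤ ρ b x) → IntegrableOn f K := by
      intro f ρ hρ h1 h2 h3
      refine (hρ.integrableOn_slice hK hbI).mono' h1 ?_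
      filter_upwards [h2, h3] with x h2 h3
      rwa [Real.norm_eq_abs, abs_of_nonneg h2]
    refine ⟨fun x => f₁ x + f₂ x, hf₁m.add hf₂m, ?_, ?_, ?_, ?_⟩
    · filter_upwards [hf₁0, hf₂0] with x h1 h2
      exact add_nonneg h1 h2
    · filter_upwards [hf₁σ, hf₂σ] with x h1 h2
      linarith
    · filter_upwards [hf₁τ, hf₂τ] with x h1 h2
      linarith
    · rw [integral_add (hfi hσ₁ hf₁m hf₁0 hf₁σ) (hfi hσ₂ hf₂m hf₂0 hf₂σ)]
      simp_rw [sub_mul] at hf₂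
      rw [integral_sub (hσ.integrableOn_slice hK haI) (hσ₁.integrableOn_slice hK haI),
        integral_sub (hσ.integrableOn_mul hq) (hσ₁.integrableOn_mul hq),
        integral_sub (hτ.integrableOn_mul hq) (hτ₁.integrableOn_mul hq)] at hf₂
      linarith

end IsFlowOn

/-! ### Passage between solutions and flows. -/

/-- The cutoff is 1 on a neighbourhood of each point of K, not just on K, so that multiplying by it
leaves derivatives on K unchanged. -/
theorem exists_contDiff_cutoff {K Ω : Set (E d)} (hK : IsCompact K) (hΩ : IsOpen Ω) (hKΩ : K ⊆ Ω) :
    ∃ χ : E d → ℝ, ContDiff ℝ ∞ χ ∧ HasCompactSupport χ ∧ tsupport χ ⊆ Ω ∧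
      ∀ x ∈ K, χ =ᶠ[𝓝 x] fun _ => 1 := by
  obtain ⟨L, hL, hKL, hLΩ⟩ := exists_compact_between hK hΩ hKΩ
  obtain ⟨χ, h1, h2, -⟩ := exists_contMDiffMap_one_nhds_of_subset_interior (n := ⊤) 𝓘(ℝ, E d)
    hK.isClosed hKL
  have hsupp : tsupport χ ⊆ L := by
    refine closure_minimal (fun x hx => ?_) hL.isClosed
    by_contra hxL
    exact hx (h2 x hxL)
  refine ⟨χ, χ.contMDiff.contDiff, HasCompactSupport.of_support_subset_isCompact hL
    ((subset_tsupport _).trans hsupp), hsupp.trans hLΩ, fun x hx => ?_⟩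
  exact eventually_nhdsSet_iff_forall.1 h1 x hx

theorem materialDeriv_congr (v : ℝ → E d → E d) {φ ψ : ℝ × E d → ℝ} {z : ℝ × E d}
    (h : φ =ᶠ[𝓝 z] ψ) : materialDeriv v φ z = materialDeriv v ψ z := by
  simp only [materialDeriv, h.fderiv_eq]

/-- A solution whose support stays in the compact set `K` is a flow on `K`. -/
theorem IsSolution.isFlowOn {v : ℝ → E d → E d} {Ω K : Set (E d)} {a b : ℝ} {ρbar : E d → ℝ}
    {ρ : ℝ → E d → ℝ} (h : IsSolution v Ω Ω a b ρbar ρ) (hΩ : IsOpen Ω) (hab : a < b)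
    (hK : IsCompact K) (hKΩ : K ⊆ Ω)
    (hv : IntegrableOn (fun z : ℝ × E d => v z.1 z.2) (Ioo a b ×ˢ K))
    (hsupp : ∀ t ∈ Icc a b, ∀ᵐ x ∂(volume.restrict Ω), x ∉ K → ρ t x = 0) :
    IsFlowOn v K a b ρ := by
  have hKm := hK.measurableSet
  have hrK : ∀ {p : E d → Prop}, (∀ᵐ x ∂(volume.restrict Ω), p x) →
      ∀ᵐ x ∂(volume.restrict K), p x := fun hp =>
    ae_restrict_of_ae_restrict_of_subset hKΩ hp
  obtain ⟨C, hC⟩ := h.mem_class.bounded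
  have hslice : ∀ t ∈ Icc a b, AEStronglyMeasurable (ρ t) (volume.restrict K) := fun t ht =>
    (h.mem_class.measurable_slice t ht).mono_measure (Measure.restrict_mono hKΩ le_rfl)
  have hnn : ∀ t ∈ Icc a b, ∀ᵐ x ∂(volume.restrict K), 0 ≤ ρ t x := fun t ht =>
    hrK (h.mem_class.nonneg t ht)
  have hbd : ∀ t ∈ Icc a b, ∀ᵐ x ∂(volume.restrict K), ρ t x ≤ C := fun t ht => hrK (hC t ht)
  have hmΩ : AEStronglyMeasurable (fun z : ℝ × E d => ρ z.1 z.2)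
      (volume.restrict (Ioo a b ×ˢ Ω)) := h.mem_class.measurable.mono_measure
    (Measure.restrict_mono (prod_mono_left Ioo_subset_Icc_self) le_rfl)
  have hm : AEStronglyMeasurable (fun z : ℝ × E d => ρ z.1 z.2)
      (volume.restrict (Ioo a b ×ˢ K)) := hmΩ.mono_measure
    (Measure.restrict_mono (prod_mono_right hKΩ) le_rfl)
  have hjoint : ∀ᵐ z ∂(volume.restrict (Ioo a b ×ˢ K)), ‖ρ z.1 z.2‖ ≤ C := by
    filter_upwards [ae_le_of_forall_slice (f := fun _ => 0) aestronglyMeasurable_const hm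
        (ae_mem_of_forall_Icc hnn),
      ae_le_of_forall_slice (g := fun _ => C) hm aestronglyMeasurable_const
        (ae_mem_of_forall_Icc hbd)] with z h1 h2
    rwa [Real.norm_eq_abs, abs_of_nonneg h1]
  have hvanish : ∀ᵐ z ∂(volume.restrict (Ioo a b ×ˢ Ω)), z.2 ∉ K → ρ z.1 z.2 = 0 := by
    have hi : Measurable fun z : ℝ × E d => Kᶜ.indicator (fun _ => (1 : ℝ)) z.2 :=
      (measurable_const.indicator hKm.compl).comp measurable_snd
    have := ae_le_of_forall_slice (I := Ioo a b) (K := Ω) (g := fun _ => 0)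
      (hi.aestronglyMeasurable.mul hmΩ.norm) aestronglyMeasurable_const (by
        refine ae_mem_of_forall_Icc fun t ht => ?_
        filter_upwards [hsupp t ht] with x hx
        by_cases hxK : x ∈ K
        · simp [hxK]
        · simp [hx hxK])
    filter_upwards [this] with z hz hzK
    simpa [hzK] using hz
  have hmul : ∀ {f : ℝ × E d → ℝ}, IntegrableOn f (Ioo a b ×ˢ K) →
      IntegrableOn (fun z => ρ z.1 z.2 * f z) (Ioo a b ×ˢ K) := fun hf => hf.bdd_mul hm hjoint
  have hweak : ∀ g : E d → ℝ, IntegrableOn g K →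
      ContinuousOn (fun t => ∫ x in K, g x * ρ t x) (Icc a b) := by
    intro g hg
    have := h.weakStar (K.indicator g) (((integrable_indicator_iff hKm).2 hg).integrableOn)
    refine this.congr fun t _ => ?_
    have e : ∀ x, K.indicator g x * ρ t x = K.indicator (fun x => g x * ρ t x) x := by
      intro x
      by_cases hx : x ∈ K <;> simp [hx]
    simp_rw [e]
    rw [setIntegral_indicator hKm, inter_eq_self_of_subset_right hKΩ]
  obtain ⟨χ, hχ, hχc, hχΩ, hχ1⟩ := exists_contDiff_cutoff hK hΩ hKΩ
  refine ⟨hm, hslice, hnn, ⟨C, hbd⟩, fun φ hφ => ?_⟩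
  have hf : ContinuousOn (fun t => ∫ x in K, φ (t, x) * ρ t x) (Icc a b) :=
    continuousOn_integral_mul_of_weakStar hK hslice
      (fun t ht => abs_le_of_nonneg_of_le (hnn t ht) (hbd t ht)) hweak hφ.continuous
  have hL := hmul (integrableOn_materialDeriv hK hv hφ)
  have hfi : IntervalIntegrable (fun t => ∫ x in K, φ (t, x) * ρ t x) volume a b :=
    ContinuousOn.intervalIntegrable (by rwa [uIcc_of_le hab.le])
  have hGi := intervalIntegrable_slice hab.le hL
  obtain ⟨c, hc⟩ := exists_ae_eq_add_integral_of_forall_compactSupport hab hfi hGi (by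
    intro θ hθ hθc hθs
    have hθt : ContDiff ℝ ∞ fun z : ℝ × E d => θ z.1 := hθ.comp contDiff_fst
    have hχt : ContDiff ℝ ∞ fun z : ℝ × E d => χ z.2 := hχ.comp contDiff_snd
    -- The factor θ gives compact support in time and χ gives it in Ω. The density lives on K, where
    -- χ is locally 1, so χ drops out of the equation.
    let Φ : ℝ × E d → ℝ := fun z => θ z.1 * φ z * χ z.2
    have hΦ : ContDiff ℝ ∞ Φ := (hθt.mul hφ).mul hχt
    have hsub : Function.support Φ ⊆ tsupport θ ×ˢ tsupport χ := by
      intro z hz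
      refine ⟨subset_tsupport _ fun h0 => hz ?_, subset_tsupport _ fun h0 => hz ?_⟩
      · simp [Φ, h0]
      · simp [Φ, h0]
    have hcomp : IsCompact (tsupport θ ×ˢ tsupport χ) := hθc.isCompact.prod hχc.isCompact
    have hts : tsupport Φ ⊆ tsupport θ ×ˢ tsupport χ := closure_minimal hsub hcomp.isClosed
    have e := h.equation Φ hΦ (HasCompactSupport.of_support_subset_isCompact hcomp hsub)
      (hts.trans (prod_mono hθs hχΩ))
    have e1 : ∫ z in Ioo a b ×ˢ Ω, ρ z.1 z.2 * fderiv ℝ Φ z ((1 : ℝ), v z.1 z.2)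
        = ∫ z in Ioo a b ×ˢ K, ρ z.1 z.2 * materialDeriv v Φ z := by
      refine (setIntegral_eq_of_subset_of_ae_sdiff_eq_zero
        (measurableSet_Ioo.prod hΩ.measurableSet).nullMeasurableSet
        (prod_mono_right hKΩ) ?_).trans rfl
      filter_upwards [(ae_restrict_iff' (measurableSet_Ioo.prod hΩ.measurableSet)).1 hvanish]
        with z hz hz'
      rw [hz hz'.1 fun hzK => hz'.2 ⟨hz'.1.1, hzK⟩, zero_mul]
    have hθ' : Continuous (deriv θ) := hθ.continuous_deriv (by simp)
    have hcontint : ∀ {φ : ℝ × E d → ℝ}, Continuous φ → IntegrableOn φ (Ioo a b ×ˢ K) :=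
      fun {φ} hφ => (hφ.continuousOn.integrableOn_compact (isCompact_Icc.prod hK)).mono_set
        (prod_mono_left (Ioo_subset_Icc_self (a := a) (b := b)))
    have i1 : IntegrableOn (fun z : ℝ × E d => ρ z.1 z.2 * (deriv θ z.1 * φ z)) (Ioo a b ×ˢ K) :=
      hmul (hcontint ((hθ'.comp continuous_fst).mul hφ.continuous))
    have i2 : IntegrableOn (fun z : ℝ × E d => ρ z.1 z.2 * (θ z.1 * materialDeriv v φ z))
        (Ioo a b ×ˢ K) := by
      refine hmul ?_
      obtain ⟨B, hB⟩ := isCompact_Icc.exists_bound_of_continuousOn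
        (hθ.continuous.continuousOn (s := Icc a b))
      refine (integrableOn_materialDeriv hK hv hφ).bdd_mul (c := B)
        hθt.continuous.aestronglyMeasurable ?_
      filter_upwards [ae_restrict_mem (measurableSet_Ioo.prod hKm)] with z hz
      exact hB _ (Ioo_subset_Icc_self hz.1)
    have e2 : ∫ z in Ioo a b ×ˢ K, ρ z.1 z.2 * materialDeriv v Φ z
        = ∫ z in Ioo a b ×ˢ K, (ρ z.1 z.2 * (deriv θ z.1 * φ z)
          + ρ z.1 z.2 * (θ z.1 * materialDeriv v φ z)) := by
      refine setIntegral_congr_fun (measurableSet_Ioo.prod hKm) fun z hz => ?_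
      have h1 : Φ =ᶠ[𝓝 z] fun z => θ z.1 * φ z := by
        have h2 := continuous_snd.continuousAt.eventually (hχ1 z.2 hz.2)
        filter_upwards [h2] with y hy
        simp only [Φ, hy, mul_one]
      rw [materialDeriv_congr v h1, materialDeriv_mul v hθt hφ, materialDeriv_time v hθ]
      ring
    rw [e1, e2, integral_add i1 i2, integral_Ioo_prod_eq le_rfl hab.le le_rfl i1,
      integral_Ioo_prod_eq le_rfl hab.le le_rfl i2,
      ← intervalIntegral.integral_add (intervalIntegrable_slice hab.le i1)
        (intervalIntegrable_slice hab.le i2)] at e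
    rw [← e]
    refine intervalIntegral.integral_congr fun τ _ => ?_
    simp only
    rw [← integral_const_mul, ← integral_const_mul]
    congr 1
    · refine integral_congr_ae (ae_of_all _ fun x => ?_)
      simp only
      ring
    · refine integral_congr_ae (ae_of_all _ fun x => ?_)
      simp only
      ring)
  have hIc : ContinuousOn (fun τ => c + ∫ t in a..τ, ∫ x in K, ρ t x * materialDeriv v φ (t, x))
      (Icc a b) := by
    have := (hGi.absolutelyContinuousOnInterval_intervalIntegral (c := a)
      left_mem_uIcc).continuousOn
    rw [uIcc_of_le hab.le] at this
    exact continuousOn_const.add this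
  -- The distributional equation holds only for almost every time. Weak* continuity makes both sides
  -- continuous on [a, b], so it holds at every time, endpoints included.
  have hEq := Measure.eqOn_Icc_of_ae_eq volume hab.ne (by
    rw [Measure.restrict_congr_set Ioo_ae_eq_Icc.symm]
    exact (ae_restrict_iff' measurableSet_Ioo).2 hc) hf hIc
  intro s t hs hst ht
  have hsub : ∀ {p q}, a ≤ p → p ≤ q → q ≤ b → IntervalIntegrable (fun τ => ∫ x in K,
      ρ τ x * materialDeriv v φ (τ, x)) volume p q := by
    intro p q h1 h2 h3
    refine hGi.mono_set ?_
    rw [uIcc_of_le h2, uIcc_of_le hab.le]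
    exact Icc_subset_Icc h1 h3
  have h1 := hEq ⟨hs.trans hst, ht⟩
  have h2 := hEq ⟨hs, hst.trans ht⟩
  simp only at h1 h2
  rw [h1, h2, integral_Ioo_prod_eq hs hst ht hL,
    ← intervalIntegral.integral_add_adjacent_intervals (hsub le_rfl hs (hst.trans ht))
      (hsub hs hst ht)]
  ring

/-- A flow on a compact set, extended by zero, is a solution in the whole space. -/
theorem IsFlowOn.isSolution {v : ℝ → E d → E d} {Ω K : Set (E d)} {a b : ℝ}
    {ρ : ℝ → E d → ℝ} (h : IsFlowOn v K a b ρ) (hab : a ≤ b)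
    (hK : IsCompact K) (hKΩ : K ⊆ Ω)
    (hv : IntegrableOn (fun z : ℝ × E d => v z.1 z.2) (Ioo a b ×ˢ K)) {ρbar : E d → ℝ}
    (hρbar : ∀ᵐ x ∂(volume.restrict K), ρ a x = ρbar x) :
    IsSolution v Ω univ a b (K.indicator ρbar) (fun t => K.indicator (ρ t)) := by
  have hKm := hK.measurableSet
  have hext : ∀ {p : E d → Prop}, (∀ᵐ x ∂(volume.restrict K), p x) →
      ∀ᵐ x ∂(volume.restrict Ω), x ∈ K → p x := fun hp =>
    ae_restrict_of_ae ((ae_restrict_iff' hKm).1 hp)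
  refine ⟨⟨?_, fun t ht => ?_, fun t ht => ?_, ?_, ⟨K, hK, hKΩ, fun t _ => ?_⟩⟩, ?_, ?_, ?_⟩
  · have e : (fun z : ℝ × E d => K.indicator (ρ z.1) z.2)
        = (univ ×ˢ K).indicator (fun z : ℝ × E d => ρ z.1 z.2) := by
      ext z
      by_cases hz : z.2 ∈ K <;> simp [indicator, hz]
    have hm : MeasurableSet ((univ : Set ℝ) ×ˢ K) := MeasurableSet.univ.prod hKm
    rw [e, aestronglyMeasurable_indicator_iff hm, Measure.restrict_restrict hm, prod_inter_prod,
      univ_inter, inter_eq_self_of_subset_left hKΩ, volume_restrict_prod,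
      Measure.restrict_congr_set Ioo_ae_eq_Icc.symm, ← volume_restrict_prod]
    exact h.measurable
  · rw [aestronglyMeasurable_indicator_iff hKm, Measure.restrict_restrict hKm,
      inter_eq_self_of_subset_left hKΩ]
    exact h.measurable_slice t ht
  · filter_upwards [hext (h.nonneg t ht)] with x hx
    by_cases hxK : x ∈ K
    · rw [indicator_of_mem hxK]
      exact hx hxK
    · rw [indicator_of_notMem hxK]
  · obtain ⟨C, hC0, hC⟩ := h.exists_bound
    refine ⟨C, fun t ht => ?_⟩
    filter_upwards [hext (hC t ht)] with x hx
    by_cases hxK : x ∈ K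
    · rw [indicator_of_mem hxK]
      exact (Real.le_norm_self _).trans (hx hxK)
    · rwa [indicator_of_notMem hxK]
  · exact ae_of_all _ fun x hx => indicator_of_notMem hx _
  · intro g hg
    refine (h.continuousOn_integral hK hab hv (hg.mono_set hKΩ)).congr fun t _ => ?_
    have e : ∀ x, g x * K.indicator (ρ t) x = K.indicator (fun x => g x * ρ t x) x := by
      intro x
      by_cases hx : x ∈ K <;> simp [hx]
    simp_rw [e]
    rw [setIntegral_indicator hKm, inter_eq_self_of_subset_right hKΩ]
  · intro φ hφ _ hφs
    have e := h.equation φ hφ a b le_rfl hab le_rfl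
    have h0 : ∀ t, t ∉ Ioo a b → ∀ x, φ (t, x) = 0 := fun t ht x =>
      image_eq_zero_of_notMem_tsupport fun hz => ht (hφs hz).1
    simp only [h0 a (by simp), h0 b (by simp), zero_mul, integral_zero, sub_zero] at e
    rw [e]
    have e1 : ∀ z : ℝ × E d, K.indicator (ρ z.1) z.2 * fderiv ℝ φ z ((1 : ℝ), v z.1 z.2)
        = (univ ×ˢ K).indicator (fun z : ℝ × E d => ρ z.1 z.2 * materialDeriv v φ z) z := by
      intro z
      by_cases hz : z.2 ∈ K <;> simp [indicator, hz, materialDeriv]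
    simp_rw [e1]
    rw [setIntegral_indicator (MeasurableSet.univ.prod hKm), prod_inter_prod, inter_univ,
      inter_eq_self_of_subset_right hKΩ]
  · filter_upwards [hext hρbar] with x hx
    by_cases hxK : x ∈ K
    · rw [indicator_of_mem hxK, indicator_of_mem hxK, hx hxK]
    · rw [indicator_of_notMem hxK, indicator_of_notMem hxK]

/-- The hypothesis concerns open sets with compact closure in Ω; the interior of a compact set lying
between K and Ω is one that contains K. -/
theorem LocallyIntegrableField.integrableOn {T : ℝ} {Ω K : Set (E d)} {v : ℝ → E d → E d}
    (h : LocallyIntegrableField T Ω v) (hΩ : IsOpen Ω) (hK : IsCompact K) (hKΩ : K ⊆ Ω) :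
    IntegrableOn (fun z : ℝ × E d => v z.1 z.2) (Ioo 0 T ×ˢ K) := by
  obtain ⟨L, hL, hKL, hLΩ⟩ := exists_compact_between hK hΩ hKΩ
  have hcl : closure (interior L) ⊆ L := closure_minimal interior_subset hL.isClosed
  exact (h (interior L) isOpen_interior (hL.of_isClosed_subset isClosed_closure hcl)
    (hcl.trans hLΩ)).mono_set (prod_mono_right hKL)

/-! ### Uniform local uniqueness near a compact set. -/

/-- Local uniqueness is uniform near a compact set. -/
theorem LocalUniqueness.exists_uniqueInBall {T : ℝ} {Ω K : Set (E d)} {v : ℝ → E d → E d}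
    (h : LocalUniqueness T Ω v) (hK : IsCompact K) (hKΩ : K ⊆ Ω) {a b : ℝ}
    (ha : 0 ≤ a) (hb : b ≤ T)
    (hv : IntegrableOn (fun z : ℝ × E d => v z.1 z.2) (Ioo a b ×ˢ K)) :
    ∃ δ : ℝ, 0 < δ ∧ ∀ y ∈ K, ∀ s t R : ℝ, a ≤ s → s < t → t ≤ b → t - s < δ → R < δ →
      UniqueInBall v K s t y R := by
  have hKm := hK.measurableSet
  have hloc := fun p : {p : ℝ × E d // p ∈ Icc a b ×ˢ K} =>
    h p.1.1 (ha.trans p.2.1.1) p.1.2 (hKΩ p.2.2)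
  choose ε hε0 _ hεU using hloc
  -- A Lebesgue number of the cover of [a, b] × K by the space-time balls of local uniqueness. The
  -- product carries the maximum metric, so a duration and a radius both below δ fit into one of
  -- these balls.
  obtain ⟨δ, hδ, hδε⟩ := lebesgue_number_lemma_of_metric
    (c := fun p : {p : ℝ × E d // p ∈ Icc a b ×ˢ K} => Metric.ball p.1 (ε p))
    (isCompact_Icc.prod hK) (fun p => Metric.isOpen_ball)
    (fun p hp => mem_iUnion.2 ⟨⟨p, hp⟩, Metric.mem_ball_self (hε0 _)⟩)
  refine ⟨δ, hδ, ?_⟩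
  intro y hy s t R hs hst ht hstδ hR σ τ hσ hτ hσy hτy hστ
  have hsI : s ∈ Icc s t := left_mem_Icc.2 hst.le
  obtain ⟨p, hp⟩ := hδε (s, y) ⟨⟨hs, hst.le.trans ht⟩, hy⟩
  have hball : Metric.closedBall y R ⊆ Metric.ball p.1.2 (ε p) := by
    intro x hx
    have h1 : ((s, x) : ℝ × E d) ∈ Metric.ball (s, y) δ := by
      rw [Metric.mem_ball, Prod.dist_eq, max_lt_iff]
      exact ⟨by simpa using hδ, lt_of_le_of_lt hx hR⟩
    have h2 := hp h1
    rw [Metric.mem_ball, Prod.dist_eq, max_lt_iff] at h2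
    exact h2.2
  have htime : Icc s t ⊆ Icc (p.1.1 - ε p) (p.1.1 + ε p) ∩ Icc 0 T := by
    intro r hr
    refine ⟨?_, (ha.trans hs).trans hr.1, hr.2.trans (ht.trans hb)⟩
    have h1 : ((r, y) : ℝ × E d) ∈ Metric.ball (s, y) δ := by
      rw [Metric.mem_ball, Prod.dist_eq, max_lt_iff]
      refine ⟨?_, by simpa using hδ⟩
      rw [Real.dist_eq, abs_of_nonneg (by linarith [hr.1])]
      linarith [hr.2]
    have h2 := hp h1
    rw [Metric.mem_ball, Prod.dist_eq, max_lt_iff, Real.dist_eq] at h2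
    have h3 := abs_lt.1 h2.1
    exact ⟨by linarith [h3.1], by linarith [h3.2]⟩
  have hv' : IntegrableOn (fun z : ℝ × E d => v z.1 z.2) (Ioo s t ×ˢ K) :=
    hv.mono_set (prod_mono_left (Ioo_subset_Ioo hs ht))
  have hsupp : ∀ {ρ : E d → ℝ},
      (∀ᵐ x ∂(volume.restrict K), x ∉ Metric.closedBall y R → ρ x = 0) →
      ∀ᵐ x ∂(volume : Measure (E d)), x ∉ Metric.closedBall y R → K.indicator ρ x = 0 := by
    intro ρ hρ
    filter_upwards [(ae_restrict_iff' hKm).1 hρ] with x hx hxy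
    by_cases hxK : x ∈ K
    · rw [indicator_of_mem hxK, hx hxK hxy]
    · exact indicator_of_notMem hxK _
  obtain ⟨C, hC0, hC⟩ := hσ.exists_bound
  have hmem : MemLp (K.indicator (σ s)) ⊤ volume := by
    refine memLp_top_of_bound
      ((aestronglyMeasurable_indicator_iff hKm).2 (hσ.measurable_slice s hsI)) C ?_
    filter_upwards [(ae_restrict_iff' hKm).1 (hC s hsI)] with x hx
    by_cases hxK : x ∈ K
    · rw [indicator_of_mem hxK]
      exact hx hxK
    · rw [indicator_of_notMem hxK, norm_zero]
      exact hC0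
  have hnn : ∀ᵐ x ∂(volume : Measure (E d)), 0 ≤ K.indicator (σ s) x := by
    filter_upwards [(ae_restrict_iff' hKm).1 (hσ.nonneg s hsI)] with x hx
    by_cases hxK : x ∈ K
    · rw [indicator_of_mem hxK]
      exact hx hxK
    · rw [indicator_of_notMem hxK]
  have hcomp : IsCompact (Metric.closedBall y R) := isCompact_closedBall y R
  have key := hεU p (K.indicator (σ s)) hmem hnn
    ⟨_, hcomp, hball, ae_restrict_of_ae (hsupp (hσy s hsI))⟩ s t hst.le htime _ _
    (hσ.isSolution hst.le hK hKΩ hv' (ae_of_all _ fun _ => rfl))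
    (fun r hr => ⟨_, hcomp, hball, ae_restrict_of_ae (hsupp (hσy r hr))⟩)
    (hτ.isSolution hst.le hK hKΩ hv' (hστ.mono fun _ hx => hx.symm))
    (fun r hr => ⟨_, hcomp, hball, ae_restrict_of_ae (hsupp (hτy r hr))⟩)
    t (right_mem_Icc.2 hst.le)
  filter_upwards [ae_restrict_of_ae_restrict_of_subset hKΩ key, ae_restrict_mem hKm] with x hx hxK
  rwa [indicator_of_mem hxK, indicator_of_mem hxK] at hx

/-! ### Iteration in time and the limit of large speed levels. -/

namespace IsFlowOn

variable {v : ℝ → E d → E d} {K : Set (E d)} {a b : ℝ} {ρ σ τ : ℝ → E d → ℝ}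

/-- Dominated convergence: at each point the excess is zero once n ≥ ‖v‖, and the density is bounded
while ‖v‖ is integrable. -/
theorem tendsto_integral_mul_speedExcess (h : IsFlowOn v K a b ρ) (hK : IsCompact K)
    (hv : IntegrableOn (fun z : ℝ × E d => v z.1 z.2) (Ioo a b ×ˢ K)) (c : ℝ) :
    Tendsto (fun n : ℕ => ∫ z in Ioo a b ×ˢ K, ρ z.1 z.2 * (c * speedExcess v n z)) atTop
      (𝓝 0) := by
  have hlim := tendsto_integral_of_dominated_convergence
    (μ := volume.restrict (Ioo a b ×ˢ K)) (f := fun _ => 0)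
    (F := fun (n : ℕ) z => ρ z.1 z.2 * (c * speedExcess v n z))
    (fun z => ‖ρ z.1 z.2 * (c * ‖v z.1 z.2‖)‖)
    (fun n => (h.integrableOn_mul ((integrableOn_speedExcess hK hv n).const_mul c)).1)
    (h.integrableOn_mul (hv.norm.const_mul c)).norm
    (fun n => ae_of_all _ fun z => by
      simp only [norm_mul]
      refine mul_le_mul_of_nonneg_left (mul_le_mul_of_nonneg_left ?_ (norm_nonneg _))
        (norm_nonneg _)
      rw [Real.norm_eq_abs, abs_of_nonneg (speedExcess_nonneg v n z), norm_norm]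
      exact max_le (by linarith [Nat.cast_nonneg (α := ℝ) n]) (norm_nonneg _))
    (ae_of_all _ fun z => by
      refine tendsto_const_nhds.congr' ?_
      obtain ⟨N, hN⟩ := exists_nat_ge ‖v z.1 z.2‖
      filter_upwards [eventually_ge_atTop N] with n hn
      have : (N : ℝ) ≤ n := by exact_mod_cast hn
      rw [speedExcess, max_eq_right (by linarith), mul_zero, mul_zero])
  simpa using hlim

/-- If flows are unique in small balls for short times, then two flows with the same initial datum
share, for every `M`, all of their mass at the final time, up to an error controlled by the excess
of the speed over `M`. -/
theorem le_integral_min (hσ : IsFlowOn v K a b σ) (hτ : IsFlowOn v K a b τ)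
    (hK : IsCompact K) (hab : a < b)
    (hv : IntegrableOn (fun z : ℝ × E d => v z.1 z.2) (Ioo a b ×ˢ K))
    {C : ℝ} (hC0 : 0 ≤ C) (hC : ∀ y, deriv cutoff y ∈ Icc (-C) 0) {r M δ : ℝ}
    (hr : 0 < r) (hM : 0 ≤ M) (hδ : 0 < δ) {J : Finset (E d)}
    (hJ : ∀ x ∈ K, ∃ y ∈ J, x ∈ Metric.closedBall y r)
    (hU : ∀ y ∈ J, ∀ s t : ℝ, a ≤ s → s < t → t ≤ b → t - s < δ →
      UniqueInBall v K s t y (3 * r))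
    (hστ : ∀ᵐ x ∂(volume.restrict K), σ a x = τ a x) :
    (∫ x in K, σ a x)
        - 2 * ((∫ z in Ioo a b ×ˢ K, σ z.1 z.2 * (C * (6 / r) * speedExcess v M z))
          + ∫ z in Ioo a b ×ˢ K, τ z.1 z.2 * (C * (6 / r) * speedExcess v M z))
      ≤ ∫ x in K, min (σ b x) (τ b x) := by
  have hq : IntegrableOn (fun z => C * (6 / r) * speedExcess v M z) (Ioo a b ×ˢ K) :=
    (integrableOn_speedExcess hK hv M).const_mul _
  have hq0 : ∀ z, 0 ≤ C * (6 / r) * speedExcess v M z := fun z =>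
    mul_nonneg (by positivity) (speedExcess_nonneg v M z)
  -- The invariant of the iteration is a density common to both flows at time s, with the loss
  -- measured on (a, s) by the full flows σ and τ.
  let P : ℝ → Prop := fun s => ∃ f : E d → ℝ, AEStronglyMeasurable f (volume.restrict K) ∧
    (∀ᵐ x ∂(volume.restrict K), 0 ≤ f x) ∧ (∀ᵐ x ∂(volume.restrict K), f x ≤ σ s x) ∧
    (∀ᵐ x ∂(volume.restrict K), f x ≤ τ s x) ∧
    (∫ x in K, σ a x)
        - 2 * ((∫ z in Ioo a s ×ˢ K, σ z.1 z.2 * (C * (6 / r) * speedExcess v M z))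
          + ∫ z in Ioo a s ×ˢ K, τ z.1 z.2 * (C * (6 / r) * speedExcess v M z))
      ≤ ∫ x in K, f x
  have hsplit : ∀ {ρ : ℝ → E d → ℝ}, IsFlowOn v K a b ρ → ∀ {s t}, a ≤ s → s ≤ t → t ≤ b →
      ∫ z in Ioo a t ×ˢ K, ρ z.1 z.2 * (C * (6 / r) * speedExcess v M z)
        = (∫ z in Ioo a s ×ˢ K, ρ z.1 z.2 * (C * (6 / r) * speedExcess v M z))
          + ∫ z in Ioo s t ×ˢ K, ρ z.1 z.2 * (C * (6 / r) * speedExcess v M z) := by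
    intro ρ hρ s t hs hst ht
    have hi := hρ.integrableOn_mul hq
    have hii := intervalIntegrable_slice hab.le hi
    have hsub : ∀ {p q}, a ≤ p → p ≤ q → q ≤ b → IntervalIntegrable (fun t => ∫ x in K,
        ρ t x * (C * (6 / r) * speedExcess v M (t, x))) volume p q := by
      intro p q h1 h2 h3
      refine hii.mono_set ?_
      rw [uIcc_of_le h2, uIcc_of_le hab.le]
      exact Icc_subset_Icc h1 h3
    rw [integral_Ioo_prod_eq le_rfl (hs.trans hst) ht hi,
      integral_Ioo_prod_eq le_rfl hs (hst.trans ht) hi, integral_Ioo_prod_eq hs hst ht hi]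
    exact (intervalIntegral.integral_add_adjacent_intervals (hsub le_rfl hs (hst.trans ht))
      (hsub hs hst ht)).symm
  have hstep : ∀ s t, a ≤ s → s < t → t ≤ b → t - s < δ → 6 * M / r * (t - s) ≤ 1 →
      P s → P t := by
    rintro s t hs hst ht hstδ hstM ⟨f, hfm, hf0, hfσ, hfτ, hf⟩
    have hv' : IntegrableOn (fun z : ℝ × E d => v z.1 z.2) (Ioo s t ×ˢ K) :=
      hv.mono_set (prod_mono_left (Ioo_subset_Ioo hs ht))
    have hq' := hq.mono_set (prod_mono_left (t := K) (Ioo_subset_Ioo hs ht))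
    have htI : t ∈ Icc s t := right_mem_Icc.2 hst.le
    have hσ' := hσ.restrict hs ht
    have hτ' := hτ.restrict hs ht
    -- The shared density f is restarted inside each flow. The selected flows lie below σ and τ, so
    -- their losses on (s, t) are bounded by those of σ and τ.
    obtain ⟨σ₁, hσ₁, hσ₁σ, hσ₁f⟩ := hσ'.exists_flow_with_initial hK hst hv' hfm hf0 hfσ
    obtain ⟨τ₁, hτ₁, hτ₁τ, hτ₁f⟩ := hτ'.exists_flow_with_initial hK hst hv' hfm hf0 hfτ
    obtain ⟨f₁, h1, h2, h3, h4, h5⟩ := exists_common_mass hK hst hv' hC0 hC hr hM hstM J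
      (fun y hy => hU y hy s t hs hst ht hstδ) σ₁ τ₁ hσ₁ hτ₁
      (by
        filter_upwards [hσ₁f, hτ₁f] with x h1 h2
        rw [h1, h2])
      (by
        filter_upwards [ae_restrict_mem hK.measurableSet] with x hx h0
        obtain ⟨y, hy, hxy⟩ := hJ x hx
        exact absurd hxy (h0 y hy))
    refine ⟨f₁, h1, h2, ?_, ?_, ?_⟩
    · filter_upwards [h3, hσ₁σ t htI] with x h3 h6
      exact h3.trans h6
    · filter_upwards [h4, hτ₁τ t htI] with x h4 h6
      exact h4.trans h6
    · have hmono : ∀ {ρ ρ' : ℝ → E d → ℝ}, IsFlowOn v K s t ρ → IsFlowOn v K s t ρ' →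
          (∀ r ∈ Icc s t, ∀ᵐ x ∂(volume.restrict K), ρ' r x ≤ ρ r x) →
          ∫ z in Ioo s t ×ˢ K, ρ' z.1 z.2 * (C * (6 / r) * speedExcess v M z)
            ≤ ∫ z in Ioo s t ×ˢ K, ρ z.1 z.2 * (C * (6 / r) * speedExcess v M z) := by
        intro ρ ρ' hρ hρ' hle
        refine integral_mono_ae (hρ'.integrableOn_mul hq') (hρ.integrableOn_mul hq') ?_
        filter_upwards [hρ'.ae_le hρ hle] with z hz
        exact mul_le_mul_of_nonneg_right hz (hq0 z)
      have h6 := hmono hσ' hσ₁ hσ₁σ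
      have h7 := hmono hτ' hτ₁ hτ₁τ
      rw [hsplit hσ hs hst.le ht, hsplit hτ hs hst.le ht]
      rw [integral_congr_ae hσ₁f] at h5
      linarith
  -- N depends on M and may grow with it; this is harmless because the bound on the loss does not
  -- involve N.
  obtain ⟨N, hN⟩ := exists_nat_gt (max ((b - a) / δ) (6 * M / r * (b - a)))
  have hN0 : (0 : ℝ) < N := by
    refine lt_of_le_of_lt ?_ hN
    exact (div_nonneg (by linarith) hδ.le).trans (le_max_left _ _)
  let η : ℝ := (b - a) / N
  have hη : 0 < η := div_pos (by linarith) hN0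
  have hNη : N * η = b - a := mul_div_cancel₀ _ hN0.ne'
  have hηδ : η < δ := by
    rw [div_lt_iff₀ hN0]
    have := (le_max_left _ _).trans_lt hN
    rw [div_lt_iff₀ hδ] at this
    linarith
  have hηM : 6 * M / r * η ≤ 1 := by
    have := (le_max_right _ _).trans_lt hN
    simp only [η]
    rw [← mul_div_assoc, div_le_one hN0]
    exact this.le
  have hind : ∀ k : ℕ, k ≤ N → P (a + k * η) := by
    intro k
    induction k with
    | zero =>
      intro _
      have e : a + ((0 : ℕ) : ℝ) * η = a := by simp
      rw [e]
      have haI : a ∈ Icc a b := left_mem_Icc.2 hab.le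
      refine ⟨σ a, hσ.measurable_slice a haI, hσ.nonneg a haI, ae_of_all _ fun _ => le_rfl,
        hστ.mono fun x hx => hx.le, ?_⟩
      simp
    | succ k ih =>
      intro hk
      have hkN : ((k + 1 : ℕ) : ℝ) ≤ N := by exact_mod_cast hk
      have h1 : ((k + 1 : ℕ) : ℝ) * η ≤ N * η := mul_le_mul_of_nonneg_right hkN hη.le
      have h2 : a + ((k + 1 : ℕ) : ℝ) * η - (a + (k : ℝ) * η) = η := by
        push_cast
        ring
      refine hstep (a + (k : ℝ) * η) _ ?_ ?_ ?_ ?_ ?_ (ih (by omega))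
      · have : 0 ≤ (k : ℝ) * η := by positivity
        linarith
      · linarith
      · linarith
      · linarith
      · rw [h2]
        exact hηM
  obtain ⟨f, hfm, hf0, hfσ, hfτ, hf⟩ := hind N le_rfl
  have e : a + (N : ℝ) * η = b := by linarith
  rw [e] at hfσ hfτ hf
  have hbI : b ∈ Icc a b := right_mem_Icc.2 hab.le
  refine hf.trans (integral_mono_ae ?_
    ((hσ.integrableOn_slice hK hbI).inf (hτ.integrableOn_slice hK hbI)) ?_)
  · refine (hσ.integrableOn_slice hK hbI).mono' hfm ?_
    filter_upwards [hf0, hfσ] with x h1 h2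
    rwa [Real.norm_eq_abs, abs_of_nonneg h1]
  · filter_upwards [hfσ, hfτ] with x h1 h2
    exact le_min h1 h2

/-- If flows are unique in small balls for short times, then they are unique. -/
theorem ae_eq_of_uniqueInBall (hσ : IsFlowOn v K a b σ) (hτ : IsFlowOn v K a b τ)
    (hK : IsCompact K) (hab : a < b)
    (hv : IntegrableOn (fun z : ℝ × E d => v z.1 z.2) (Ioo a b ×ˢ K)) {δ : ℝ} (hδ : 0 < δ)
    (hU : ∀ y ∈ K, ∀ s t R : ℝ, a ≤ s → s < t → t ≤ b → t - s < δ → R < δ →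
      UniqueInBall v K s t y R)
    (hστ : ∀ᵐ x ∂(volume.restrict K), σ a x = τ a x) :
    ∀ᵐ x ∂(volume.restrict K), σ b x = τ b x := by
  obtain ⟨C, hC0, hC⟩ := exists_deriv_cutoff_bound
  -- With r = δ/4, the enlarged radius 3r is still below δ. This r does not depend on M.
  have hr : 0 < δ / 4 := by positivity
  obtain ⟨J, hJK, hJ⟩ := hK.elim_nhds_subcover (fun y => Metric.closedBall y (δ / 4))
    fun y _ => Metric.closedBall_mem_nhds y hr
  have hbI : b ∈ Icc a b := right_mem_Icc.2 hab.le
  have hbound := fun n : ℕ => hσ.le_integral_min hτ hK hab hv hC0 hC hr (Nat.cast_nonneg n) hδ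
    (J := J) (fun x hx => by simpa using hJ hx)
    (fun y hy s t hs hst ht hstδ => hU y (hJK y hy) s t _ hs hst ht hstδ (by linarith)) hστ
  have hlim := ((hσ.tendsto_integral_mul_speedExcess hK hv (C * (6 / (δ / 4)))).add
    (hτ.tendsto_integral_mul_speedExcess hK hv (C * (6 / (δ / 4))))).const_mul 2
  -- In the limit the minimum carries all the initial mass. Both flows still have this mass at time
  -- b and lie above the minimum, so both are equal to it.
  have hmass := le_of_tendsto' (tendsto_const_nhds.sub hlim) hbound
  rw [add_zero, mul_zero, sub_zero] at hmass
  have hmin : IntegrableOn (fun x => min (σ b x) (τ b x)) K :=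
    (hσ.integrableOn_slice hK hbI).inf (hτ.integrableOn_slice hK hbI)
  have hzero : ∀ {ρ : ℝ → E d → ℝ}, IsFlowOn v K a b ρ →
      (∫ x in K, ρ a x = ∫ x in K, σ a x) → (∀ x, min (σ b x) (τ b x) ≤ ρ b x) →
      ∀ᵐ x ∂(volume.restrict K), ρ b x - min (σ b x) (τ b x) = 0 := by
    intro ρ hρ hρσ hle
    have hi := hρ.integrableOn_slice hK hbI
    have h1 : ∫ x in K, (ρ b x - min (σ b x) (τ b x)) = 0 := by
      refine le_antisymm ?_ (integral_nonneg fun x => sub_nonneg.2 (hle x))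
      rw [integral_sub hi hmin, hρ.integral_eq le_rfl hab.le le_rfl, hρσ]
      linarith
    exact (integral_eq_zero_iff_of_nonneg (fun x => sub_nonneg.2 (hle x)) (hi.sub hmin)).1 h1
  filter_upwards [hzero hσ rfl fun x => min_le_left _ _,
    hzero hτ (integral_congr_ae (hστ.mono fun x hx => hx.symm)) fun x => min_le_right _ _]
    with x h1 h2
  linarith

end IsFlowOn

/-! ### Conclusion. -/

/-- Solutions with the same initial datum agree if the field is locally integrable and local
uniqueness holds. -/
theorem IsSolution.ae_eq_of_localUniqueness {T : ℝ} {Ω : Set (E d)}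
    {v : ℝ → E d → E d} (hΩ : IsOpen Ω) (hint : LocallyIntegrableField T Ω v)
    (hloc : LocalUniqueness T Ω v) {ρbar : E d → ℝ} {a b : ℝ} (hI : Icc a b ⊆ Icc 0 T)
    {ρ₁ ρ₂ : ℝ → E d → ℝ} (h₁ : IsSolution v Ω Ω a b ρbar ρ₁) (h₂ : IsSolution v Ω Ω a b ρbar ρ₂)
    {t : ℝ} (ht : t ∈ Icc a b) : ρ₁ t =ᵐ[volume.restrict Ω] ρ₂ t := by
  have hinit := h₁.initial.trans h₂.initial.symm
  rcases ht.1.eq_or_lt with rfl | hat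
  · exact hinit
  have hab : a < b := hat.trans_le ht.2
  obtain ⟨K₁, hK₁, hK₁Ω, hs₁⟩ := h₁.mem_class.support
  obtain ⟨K₂, hK₂, hK₂Ω, hs₂⟩ := h₂.mem_class.support
  have hK := hK₁.union hK₂
  have hKΩ := union_subset hK₁Ω hK₂Ω
  have h0a : 0 ≤ a := (hI (left_mem_Icc.2 hab.le)).1
  have hbT : b ≤ T := (hI (right_mem_Icc.2 hab.le)).2
  have hv := (hint.integrableOn hΩ hK hKΩ).mono_set (prod_mono_left (Ioo_subset_Ioo h0a hbT))
  have hvt := hv.mono_set (prod_mono_left (Ioo_subset_Ioo le_rfl ht.2))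
  have f₁ := h₁.isFlowOn hΩ hab hK hKΩ hv fun s hs =>
    (hs₁ s hs).mono fun x hx hxK => hx fun h => hxK (Or.inl h)
  have f₂ := h₂.isFlowOn hΩ hab hK hKΩ hv fun s hs =>
    (hs₂ s hs).mono fun x hx hxK => hx fun h => hxK (Or.inr h)
  -- Uniqueness of flows is known at the final time only, so it is applied on [a, t], with t as
  -- final time.
  obtain ⟨δ, hδ, hU⟩ := hloc.exists_uniqueInBall hK hKΩ h0a (ht.2.trans hbT) hvt
  have key := (f₁.restrict le_rfl ht.2).ae_eq_of_uniqueInBall (f₂.restrict le_rfl ht.2) hK hat hvt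
    hδ hU (ae_restrict_of_ae_restrict_of_subset hKΩ hinit)
  filter_upwards [ae_restrict_of_ae ((ae_restrict_iff' hK.measurableSet).1 key), hs₁ t ht,
    hs₂ t ht] with x hx hx₁ hx₂
  by_cases hxK : x ∈ K₁ ∪ K₂
  · exact hx hxK
  · rw [hx₁ fun h => hxK (Or.inl h), hx₂ fun h => hxK (Or.inr h)]

end ContinuityEquation

/-- If a Borel vector field is locally integrable in `(0,T) × Ω`, then uniqueness of bounded
nonnegative weakly* continuous solutions of the continuity equation in small space-time
neighbourhoods implies their uniqueness in all of `Ω`. -/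
theorem lemmaA1 (d : ℕ) (T : ℝ) (hT : 0 < T)
    (Ω : Set (ContinuityEquation.E d)) (hΩ : IsOpen Ω)
    (v : ℝ → ContinuityEquation.E d → ContinuityEquation.E d)
    (hv : ContinuityEquation.IsBorelField T Ω v)
    (ha : ContinuityEquation.LocallyIntegrableField T Ω v)
    (hloc : ContinuityEquation.LocalUniqueness T Ω v) :
    ContinuityEquation.GlobalUniqueness T Ω v := by
  intro ρbar _ _ _ a b _ hI ρ₁ ρ₂ h₁ h₂ t ht
  exact h₁.ae_eq_of_localUniqueness hΩ ha hloc hI h₂ ht
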